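/- **Setting.** Let $d\ge 2$. All vectors in $\mathbb R^d,\mathbb C^d,\mathbb Z^d$ carry the norm $\|u\|=\sum_i|u_i|$, and matrices the corresponding operator norm. Let $F\subset SL(d,\mathbb R)$ be a fundamental domain of $SL(d,\mathbb Z)\backslash SL(d,\mathbb R)$: for every $M$ there is exactly one $P\in SL(d,\mathbb Z)$ with $PM\in F$. Let $\delta,\nu>0$. *Continued fractions.* For $\omega=(\alpha,1)\in\mathbb R^d$ put $M_\omega=\begin{pmatrix} I&\alpha\\0&1\end{pmatrix}$, $E^t=\operatorname{diag}(e^{-t},\dots,e^{-t},e^{(d-1)t})$, and let $P(t)\in SL(d,\mathbb Z)$ be the matrix with $P(t)M_\omega E^t\in F$. Given $0=t_0<t_1<\cdots\to\infty$ put $P_0=I$, $P_n=P(t_n)$ for $n\ge1$, $T_0=I$, $T_n=P_nP_{n-1}^{-1}$; let $\gamma_n$ be the last component of $e^{(d-1)t_n}P_n\omega$, and $\lambda_n=e^{(d-1)t_n}/\gamma_n$, $\eta_n=\lambda_n/\lambda_{n-1}$, $\omega_n=\lambda_nP_n\omega$. The sequence $t$ is a *stopping-time sequence* for $\omega$ if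 $P_{n+1}\ne P_n$ and $\gamma_n\neq0$ for all $n$. *Resonance widths* are a decreasing sequence $\sigma_n>0$, $n\ge0$. Put $I_n^+=\{k\in\mathbb Z^d:|k\cdot\omega_n|\le\sigma_n\|k\|\}$, $I_n^-=\mathbb Z^d\setminus I_n^+$ and $A_n=\sup_{k\in I_n^+\setminus\{0\}}\|{}^{t}T_{n+1}^{-1}k\|/\|k\|$. *The class $\mathcal Y$* consists of those $\omega=(\alpha,1)$ for which there are resonance widths $\sigma$ and stopping times $t$ such that the series $$\sum_{n\ge0}A_0\cdots A_n\log\Bigl(|\eta_{n+1}|\,\|T_{n+1}\|\,\frac{\sigma_n\|\omega_{n+1}\|}{\sigma_{n+1}}\Bigr)$$ converges (absolutely) and $\lim_{n}2^{2n}\sigma_n\|P_n^{-1}\|\,\|T_0\|^2\cdots\|T_n\|^2=0$. *Function spaces.* $\mathcal A_\rho$ and $\mathcal A'_\rho$ are the spaces of $\mathbb Z^d$-periodic functions $f(x)=\sum_{k\in\mathbb Z^d}f_ke^{2\pi i k\cdot x}$ with values in $\mathbb C^d$ for which, respectively, $\|f\|_\rho=\sum_k\|f_k\|e^{\rho\|k\|}$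 and $\|f\|'_\rho=\sum_k(1+2\pi\|k\|)\|f_k\|e^{\rho\|k\|}$ is finite; $\mathbb E f=f_0$, $\mathbb I$ is the identity, and $\mathbb I_n^\pm$ are the projections to the modes in $I_n^\pm$. For a diffeomorphism $\psi$ put $\psi^*X=(D\psi)^{-1}X\circ\psi$. A real field $X$ has $\operatorname{Rot}X=\omega$ if its lifted flow $\Phi^t$ satisfies $(\Phi^t(x)-x)/t\to\omega$ as $t\to+\infty$, for every $x\in\mathbb R^d$. *Renormalization.* Put $\varepsilon_n=\frac{\sigma_n}{42}\min\{\frac{\nu}{4\pi},\frac{\sigma_n}{72\|\omega_n\|}\}$ and $\mathcal L_n(f)=\eta_nT_n f\circ T_n^{-1}$. Let $\|\widetilde{\mathcal L}_n\|$ be the least $C\ge 0$ such that $\|\mathcal L_nf\|'_{s'}\le C\|f\|_s$ for all $s,s'>0$ with $s'\le s/A_{n-1}-\delta$ and all $f\in(\mathbb I^+_{n-1}-\mathbb E)\mathcal A_s$. Put $$\phi_n=\max\Bigl\{1,2(d+1)\|\widetilde{\mathcal L}_n\|\frac{\varepsilon_{n-1}}{\varepsilon_n}\Bigr\},\quad \mathcal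 B_n(\omega,\sigma)=\sum_{i=0}^{n-1}A_0\cdots A_i\log\bigl(e^{\delta+\nu/A_i}\phi_{i+1}\bigr),\quad \rho_n=\frac{\rho-\mathcal B_n(\omega,\sigma)}{A_0\cdots A_{n-1}},$$ with $\rho_0=\rho$, and $\mathcal B(\omega,\sigma)=\lim_n\mathcal B_n(\omega,\sigma)$. A real field $X$ is *infinitely renormalizable* (for these data) if there are fields $X_0=X,X_1,\dots$ and real-analytic diffeomorphisms $U_0,U_1,\dots$ of $\mathbb T^d$ such that for all $n\ge0$: $\rho_n>\nu$; $X_n\in\mathcal A'_{\rho_n}$ and $\|X_n-\omega_n\|'_{\rho_n}<\varepsilon_n$; $U_n-\mathrm{id}\in\mathcal A'_{\rho_n-\nu}$, $U_n^*X_n\in\mathcal A_{\rho_n-\nu}$ and $\mathbb I_n^-U_n^*X_n=0$, with $\|U_n-\mathrm{id}\|'_{\rho_n-\nu}\le\frac{42}{\sigma_n}\|\mathbb I_n^-X_n\|_{\rho_n-\nu}$ and $\|U_n^*X_n-\omega_n\|_{\rho_n-\nu}\le2\|X_n-\omega_n\|'_{\rho_n}$; and $X_{n+1}=\mathcal L_{n+1}(U_n^*X_n)$.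 **Theorem.** Let $\omega\in\mathcal Y$ and $r>0$. There are $\varepsilon>0$, $\rho>0$, resonance widths $\sigma$ with $\sigma_n<\|\omega_n\|$ for all $n$, and stopping times $t$ for $\omega$ such that the following holds. If $X\in\mathcal A_r$ is real-valued on $\mathbb R^d$, $\operatorname{Rot}X=\omega$ and $\|(\mathbb I-\mathbb E)X\|_r<\varepsilon$, then there is a real-analytic diffeomorphism $\psi$ of $\mathbb T^d$ such that $\widetilde X=\psi^*X$ satisfies the hypotheses of the convergence theorem, that is, $$\widetilde X\in\mathcal A'_\rho,\qquad \operatorname{Rot}\widetilde X=\omega,\qquad \|(\mathbb I-\mathbb E)\widetilde X\|'_\rho<\frac{\varepsilon_0}{d+1},\qquad \mathcal B(\omega,\sigma)\text{ exists and }\rho>\mathcal B(\omega,\sigma),$$ and $\widetilde X$ is infinitely renormalizable. -/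

import Mathlib

open Filter Topology MeasureTheory
open scoped ENNReal BigOperators MatrixGroups

noncomputable section

namespace TorusRenorm

/-! Throughout, the dimension is `d = m + 1`; the last coordinate is `Fin.last m`. -/

/-! ### Norms -/

/-- The `ℓ¹` norm of a vector. -/
def l1 {n : ℕ} {R : Type*} [Norm R] (u : Fin n → R) : ℝ := ∑ i, ‖u i‖

/-- The operator norm of an integer matrix acting on `ℝ^d` with the `ℓ¹` norm. -/
def matNorm {m : ℕ} (T : SL(m + 1, ℤ)) : ℝ :=
  ‖LinearMap.toContinuousLinearMap
    (Matrix.toLpLin 1 1 ((T : Matrix (Fin (m + 1)) (Fin (m + 1)) ℤ).map (Int.cast : ℤ → ℝ)))‖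

/-- The action of an integer matrix on vectors with entries in `𝕜`. -/
def act {m : ℕ} {𝕜 : Type*} [Ring 𝕜] (T : SL(m + 1, ℤ)) (x : Fin (m + 1) → 𝕜) :
    Fin (m + 1) → 𝕜 :=
  ((T : Matrix (Fin (m + 1)) (Fin (m + 1)) ℤ).map (Int.cast : ℤ → 𝕜)).mulVec x

/-- The action of the inverse transpose of `T` on frequency vectors. -/
def invTranspose {m : ℕ} (T : SL(m + 1, ℤ)) (k : Fin (m + 1) → ℤ) : Fin (m + 1) → ℤ :=
  ((T⁻¹ : SL(m + 1, ℤ)) : Matrix (Fin (m + 1)) (Fin (m + 1)) ℤ).transpose.mulVec k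

/-- The scalar product of a frequency vector with a real vector. -/
def dotZ {m : ℕ} (k : Fin (m + 1) → ℤ) (x : Fin (m + 1) → ℝ) : ℝ := ∑ i, (k i : ℝ) * x i

/-! ### Multidimensional continued fractions -/

/-- `F` is a fundamental domain of `SL(d,ℤ) \ SL(d,ℝ)`: every coset meets `F` for exactly one
`P ∈ SL(d,ℤ)`. -/
def IsFundDomain {m : ℕ} (F : Set SL(m + 1, ℝ)) : Prop :=
  ∀ M : SL(m + 1, ℝ),
    ∃! P : SL(m + 1, ℤ), Matrix.SpecialLinearGroup.map (Int.castRingHom ℝ) P * M ∈ F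

/-- The flow matrix `E^t = diag(e^{-t}, …, e^{-t}, e^{(d-1)t})`. -/
def flowE (m : ℕ) (t : ℝ) : SL(m + 1, ℝ) :=
  ⟨Matrix.diagonal
      (fun i => if i = Fin.last m then Real.exp (m * t) else Real.exp (-t)), by
    rw [Matrix.det_diagonal, Fin.prod_univ_castSucc]
    simp only [Fin.castSucc_ne_last, if_false, if_true, Finset.prod_const, Finset.card_univ,
      Fintype.card_fin, ← Real.exp_nat_mul, ← Real.exp_add]
    simp⟩

/-- The matrix `M_ω` with identity block and last column `(α, 1)`, where `ω = (α, 1)`; only the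
first `d - 1` coordinates of `ω` are used. -/
def matOmega {m : ℕ} (ω : Fin (m + 1) → ℝ) : SL(m + 1, ℝ) :=
  ⟨Matrix.of (fun i j => if i = j then 1 else if j = Fin.last m then ω i else 0), by
    rw [Matrix.det_of_isUpperTriangular]
    · simp
    · intro i j hij
      have h1 : i ≠ j := fun h => by subst h; exact lt_irrefl _ hij
      have h2 : j ≠ Fin.last m := fun h => by
        subst h; exact absurd hij (not_lt.mpr (Fin.le_last i))
      simp [h1, h2]⟩

/-- The continued fraction matrices `P_n = P(t_n)`, where `P(t)` is the element of `SL(d,ℤ)` with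
`P(t) M_ω E^t ∈ F`, and `P_0 = I`. -/
def cfP {m : ℕ} (F : Set SL(m + 1, ℝ)) (ω : Fin (m + 1) → ℝ) (t : ℕ → ℝ) (n : ℕ) :
    SL(m + 1, ℤ) :=
  if n = 0 then 1 else
    Classical.epsilon fun P : SL(m + 1, ℤ) =>
      Matrix.SpecialLinearGroup.map (Int.castRingHom ℝ) P * (matOmega ω * flowE m (t n)) ∈ F

/-- The transfer matrices `T_n = P_n P_{n-1}⁻¹`, with `T_0 = I`. -/
def cfT {m : ℕ} (F : Set SL(m + 1, ℝ)) (ω : Fin (m + 1) → ℝ) (t : ℕ → ℝ) (n : ℕ) :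
    SL(m + 1, ℤ) :=
  cfP F ω t n * (cfP F ω t (n - 1))⁻¹

/-- `γ_n`, the last component of `e^{(d-1) t_n} P_n ω`. -/
def gam {m : ℕ} (F : Set SL(m + 1, ℝ)) (ω : Fin (m + 1) → ℝ) (t : ℕ → ℝ) (n : ℕ) : ℝ :=
  Real.exp (m * t n) * act (cfP F ω t n) ω (Fin.last m)

/-- `λ_n = e^{(d-1) t_n} / γ_n`. -/
def lam {m : ℕ} (F : Set SL(m + 1, ℝ)) (ω : Fin (m + 1) → ℝ) (t : ℕ → ℝ) (n : ℕ) : ℝ :=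
  Real.exp (m * t n) / gam F ω t n

/-- `η_n = λ_n / λ_{n-1}` (used for `n ≥ 1`). -/
def eta {m : ℕ} (F : Set SL(m + 1, ℝ)) (ω : Fin (m + 1) → ℝ) (t : ℕ → ℝ) (n : ℕ) : ℝ :=
  lam F ω t n / lam F ω t (n - 1)

/-- `ω_n = λ_n P_n ω`. -/
def om {m : ℕ} (F : Set SL(m + 1, ℝ)) (ω : Fin (m + 1) → ℝ) (t : ℕ → ℝ) (n : ℕ) :
    Fin (m + 1) → ℝ :=
  lam F ω t n • act (cfP F ω t n) ω

/-- Stopping times: `0 = t_0 < t_1 < … → ∞` along which the continued fraction matrices change.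
The condition `γ_n ≠ 0` says that `λ_n` and `ω_n` are defined. -/
structure IsStoppingTimes {m : ℕ} (F : Set SL(m + 1, ℝ)) (ω : Fin (m + 1) → ℝ) (t : ℕ → ℝ) :
    Prop where
  zero : t 0 = 0
  strictMono : StrictMono t
  tendsto : Tendsto t atTop atTop
  change : ∀ n, cfP F ω t (n + 1) ≠ cfP F ω t n
  gam_ne : ∀ n, gam F ω t n ≠ 0

/-- Resonance widths: a decreasing sequence of positive numbers. -/
structure IsResonanceWidths (σ : ℕ → ℝ) : Prop where
  pos : ∀ n, 0 < σ n
  strictAnti : StrictAnti σ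

/-- The resonant modes with respect to `v`: `|k · v| ≤ s ‖k‖`. The far from resonance modes are
the complement. -/
def cone {m : ℕ} (v : Fin (m + 1) → ℝ) (s : ℝ) : Set (Fin (m + 1) → ℤ) :=
  {k | |dotZ k v| ≤ s * l1 k}

/-- `A_n`, the supremum of `‖ᵗT_{n+1}⁻¹ k‖ / ‖k‖` over the nonzero modes of the `n`-th resonant
cone. -/
def cfA {m : ℕ} (F : Set SL(m + 1, ℝ)) (ω : Fin (m + 1) → ℝ) (t σ : ℕ → ℝ) (n : ℕ) : ℝ :=
  sSup ((fun k => l1 (invTranspose (cfT F ω t (n + 1)) k) / l1 k) ''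
    (cone (om F ω t n) (σ n) \ {0}))

/-- The product `A_0 ⋯ A_{n-1}`. -/
def prodA {m : ℕ} (F : Set SL(m + 1, ℝ)) (ω : Fin (m + 1) → ℝ) (t σ : ℕ → ℝ) (n : ℕ) : ℝ :=
  ∏ i ∈ Finset.range n, cfA F ω t σ i

/-- The class `𝒴` of vectors `ω = (α, 1)`. -/
def classY {m : ℕ} (F : Set SL(m + 1, ℝ)) : Set (Fin (m + 1) → ℝ) :=
  {ω | ω (Fin.last m) = 1 ∧ ∃ σ t : ℕ → ℝ,
    IsResonanceWidths σ ∧ IsStoppingTimes F ω t ∧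
    Summable (fun n => prodA F ω t σ (n + 1) *
      Real.log (|eta F ω t (n + 1)| * matNorm (cfT F ω t (n + 1)) *
        (σ n * l1 (om F ω t (n + 1)) / σ (n + 1)))) ∧
    Tendsto (fun n => 2 ^ (2 * n) * σ n * matNorm (cfP F ω t n)⁻¹ *
      ∏ i ∈ Finset.range (n + 1), matNorm (cfT F ω t i) ^ 2) atTop (𝓝 0)}

/-! ### Vector fields on the torus

Vector fields on `𝕋^d` are `ℤ^d`-periodic maps on `ℝ^d`. An analytic function on the complex strip
`D_ρ` is determined by its restriction to `ℝ^d`, and a Fourier series with finite `ρ`-norm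
converges on `D_ρ`, so the elements of the spaces below are described by their restrictions to
`ℝ^d`. -/

/-- The Fourier coefficient of `f` at `k`. -/
def coeff {m : ℕ} (f : (Fin (m + 1) → ℝ) → (Fin (m + 1) → ℂ)) (k : Fin (m + 1) → ℤ) :
    Fin (m + 1) → ℂ :=
  fun j => ∫ x in Set.Icc (0 : Fin (m + 1) → ℝ) 1,
    Complex.exp (-(2 * Real.pi * dotZ k x : ℝ) * Complex.I) * f x j

/-- The norm `‖𝕀_S f‖_ρ` of the projection of `f` to the modes in `S`. -/
def normA {m : ℕ} (S : Set (Fin (m + 1) → ℤ)) (ρ : ℝ)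
    (f : (Fin (m + 1) → ℝ) → (Fin (m + 1) → ℂ)) : ℝ≥0∞ :=
  ∑' k : S, ENNReal.ofReal (l1 (coeff f k) * Real.exp (ρ * l1 (k : Fin (m + 1) → ℤ)))

/-- The norm `‖𝕀_S f‖'_ρ` of the projection of `f` to the modes in `S`. -/
def normA' {m : ℕ} (S : Set (Fin (m + 1) → ℤ)) (ρ : ℝ)
    (f : (Fin (m + 1) → ℝ) → (Fin (m + 1) → ℂ)) : ℝ≥0∞ :=
  ∑' k : S, ENNReal.ofReal ((1 + 2 * Real.pi * l1 (k : Fin (m + 1) → ℤ)) *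
    l1 (coeff f k) * Real.exp (ρ * l1 (k : Fin (m + 1) → ℤ)))

/-- The space `𝒜_ρ`. -/
structure MemA {m : ℕ} (ρ : ℝ) (f : (Fin (m + 1) → ℝ) → (Fin (m + 1) → ℂ)) : Prop where
  hasSum : ∀ x j, HasSum
    (fun k => coeff f k j * Complex.exp ((2 * Real.pi * dotZ k x : ℝ) * Complex.I)) (f x j)
  norm_lt : normA Set.univ ρ f < ⊤

/-- The space `𝒜'_ρ`. -/
structure MemA' {m : ℕ} (ρ : ℝ) (f : (Fin (m + 1) → ℝ) → (Fin (m + 1) → ℂ)) : Prop where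
  hasSum : ∀ x j, HasSum
    (fun k => coeff f k j * Complex.exp ((2 * Real.pi * dotZ k x : ℝ) * Complex.I)) (f x j)
  norm_lt : normA' Set.univ ρ f < ⊤

/-- A real field regarded as a complex valued one. -/
def cx {m : ℕ} (X : (Fin (m + 1) → ℝ) → (Fin (m + 1) → ℝ)) :
    (Fin (m + 1) → ℝ) → (Fin (m + 1) → ℂ) :=
  fun x i => (X x i : ℂ)

/-- `Rot X = ω`: the lifted flow `Φ` of `X` satisfies `(Φ^t(x) - x) / t → ω` for every `x`. -/
def HasRot {m : ℕ} (X : (Fin (m + 1) → ℝ) → (Fin (m + 1) → ℝ)) (ω : Fin (m + 1) → ℝ) : Prop :=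
  ∃ Φ : ℝ → (Fin (m + 1) → ℝ) → (Fin (m + 1) → ℝ),
    (∀ x, Φ 0 x = x) ∧ (∀ x t, HasDerivAt (fun s => Φ s x) (X (Φ t x)) t) ∧
    ∀ x, Tendsto (fun t : ℝ => t⁻¹ • (Φ t x - x)) atTop (𝓝 ω)

/-- `ψ` is the lift to `ℝ^d` of a real-analytic diffeomorphism of `𝕋^d`. -/
def IsAnalyticTorusDiffeo {m : ℕ} (ψ : (Fin (m + 1) → ℝ) → (Fin (m + 1) → ℝ)) : Prop :=
  AnalyticOnNhd ℝ ψ Set.univ ∧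
  (∃ B : GL (Fin (m + 1)) ℤ, ∀ (x : Fin (m + 1) → ℝ) (k : Fin (m + 1) → ℤ),
    ψ (x + fun i => (k i : ℝ)) =
      ψ x + fun i => (((B : Matrix (Fin (m + 1)) (Fin (m + 1)) ℤ).mulVec k i : ℤ) : ℝ)) ∧
  ∃ χ : (Fin (m + 1) → ℝ) → (Fin (m + 1) → ℝ),
    AnalyticOnNhd ℝ χ Set.univ ∧ Function.LeftInverse χ ψ ∧ Function.RightInverse χ ψ

/-- The pull-back `ψ^* X = (Dψ)⁻¹ X ∘ ψ`. -/
def pullback {m : ℕ} (ψ X : (Fin (m + 1) → ℝ) → (Fin (m + 1) → ℝ)) :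
    (Fin (m + 1) → ℝ) → (Fin (m + 1) → ℝ) :=
  fun x => (fderiv ℝ ψ x).inverse (X (ψ x))

/-- The rescaling `X ↦ e T X ∘ T⁻¹`. -/
def rescale {m : ℕ} {𝕜 : Type*} [RCLike 𝕜] (e : ℝ) (T : SL(m + 1, ℤ))
    (X : (Fin (m + 1) → ℝ) → (Fin (m + 1) → 𝕜)) : (Fin (m + 1) → ℝ) → (Fin (m + 1) → 𝕜) :=
  fun x => (e : 𝕜) • act T (X (act T⁻¹ x))

/-! ### The renormalization scheme -/

/-- The radius `ε = (s / 42) min {ν / 4π, s / (72 ‖v‖)}` of the domain of the uniformization. -/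
def unifRadius {m : ℕ} (ν s : ℝ) (v : Fin (m + 1) → ℝ) : ℝ :=
  s / 42 * min (ν / (4 * Real.pi)) (s / (72 * l1 v))

/-- `ε_n`. -/
def eps {m : ℕ} (F : Set SL(m + 1, ℝ)) (ν : ℝ) (ω : Fin (m + 1) → ℝ) (t σ : ℕ → ℝ) (n : ℕ) : ℝ :=
  unifRadius ν (σ n) (om F ω t n)

/-- The norm of the rescaling operator `ℒ_n` on the nonconstant resonant modes: the least `C` that
bounds it from `(𝕀⁺_{n-1} - 𝔼) 𝒜_s` to `𝒜'_{s'}` for all widths `s, s' > 0` with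
`s' ≤ s / A_{n-1} - δ`. -/
def rescaleNorm {m : ℕ} (F : Set SL(m + 1, ℝ)) (δ : ℝ) (ω : Fin (m + 1) → ℝ) (t σ : ℕ → ℝ)
    (n : ℕ) : ℝ :=
  sInf {C : ℝ | 0 ≤ C ∧ ∀ s s' : ℝ, 0 < s → 0 < s' → s' ≤ s / cfA F ω t σ (n - 1) - δ →
    ∀ f : (Fin (m + 1) → ℝ) → (Fin (m + 1) → ℂ), MemA s f →
      (∀ k, k ∉ cone (om F ω t (n - 1)) (σ (n - 1)) \ {0} → coeff f k = 0) →
      normA' Set.univ s' (rescale (eta F ω t n) (cfT F ω t n) f) ≤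
        ENNReal.ofReal C * normA Set.univ s f}

/-- `φ_n = max {1, 2 (d+1) ‖ℒ_n‖ ε_{n-1} / ε_n}`. -/
def phi {m : ℕ} (F : Set SL(m + 1, ℝ)) (δ ν : ℝ) (ω : Fin (m + 1) → ℝ) (t σ : ℕ → ℝ) (n : ℕ) : ℝ :=
  max 1 (2 * ((m : ℝ) + 2) * rescaleNorm F δ ω t σ n *
    (eps F ν ω t σ (n - 1) / eps F ν ω t σ n))

/-- `ℬ_n(ω, σ) = ∑_{i<n} A_0 ⋯ A_i log (e^{δ + ν / A_i} φ_{i+1})`. -/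
def calB {m : ℕ} (F : Set SL(m + 1, ℝ)) (δ ν : ℝ) (ω : Fin (m + 1) → ℝ) (t σ : ℕ → ℝ) (n : ℕ) :
    ℝ :=
  ∑ i ∈ Finset.range n, prodA F ω t σ (i + 1) *
    Real.log (Real.exp (δ + ν / cfA F ω t σ i) * phi F δ ν ω t σ (i + 1))

/-- The strip widths `ρ_n = (ρ - ℬ_n) / (A_0 ⋯ A_{n-1})`, with `ρ_0 = ρ`. -/
def width {m : ℕ} (F : Set SL(m + 1, ℝ)) (δ ν : ℝ) (ω : Fin (m + 1) → ℝ) (t σ : ℕ → ℝ) (ρ : ℝ)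
    (n : ℕ) : ℝ :=
  (ρ - calB F δ ν ω t σ n) / prodA F ω t σ n

/-- `U` is a uniformization of `X` (full elimination of the far from resonance modes with respect
to `v`), for `X` in the ball of `𝒜'_{ρ+ν}` with centre `v` and radius `ε`. -/
structure IsUniformization {m : ℕ} (v : Fin (m + 1) → ℝ) (s ρ ν : ℝ)
    (X U : (Fin (m + 1) → ℝ) → (Fin (m + 1) → ℝ)) : Prop where
  rho_pos : 0 < ρ
  memX : MemA' (ρ + ν) (cx X)
  ball : normA' Set.univ (ρ + ν) (cx fun x => X x - v) < ENNReal.ofReal (unifRadius ν s v)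
  diffeo : IsAnalyticTorusDiffeo U
  memU : MemA' ρ (cx fun x => U x - x)
  mem : MemA ρ (cx (pullback U X))
  resonant : ∀ k, k ∉ cone v s → coeff (cx (pullback U X)) k = 0
  near_id : normA' Set.univ ρ (cx fun x => U x - x) ≤
    ENNReal.ofReal (42 / s) * normA (cone v s)ᶜ ρ (cx X)
  near : normA Set.univ ρ (cx fun x => pullback U X x - v) ≤
    2 * normA' Set.univ (ρ + ν) (cx fun x => X x - v)

/-- `X` is infinitely renormalizable: the iterates `X_0 = X`, `X_{n+1} = ℐ ℒ_{n+1} 𝒰_n (X_n)`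
exist for all `n`, each `X_n` being in the domain of `𝒰_n`, with strip widths `ρ_n`. -/
def InfinitelyRenormalizable {m : ℕ} (F : Set SL(m + 1, ℝ)) (δ ν : ℝ) (ω : Fin (m + 1) → ℝ)
    (t σ : ℕ → ℝ) (ρ : ℝ) (X : (Fin (m + 1) → ℝ) → (Fin (m + 1) → ℝ)) : Prop :=
  ∃ Xs Us : ℕ → (Fin (m + 1) → ℝ) → (Fin (m + 1) → ℝ),
    Xs 0 = X ∧ ∀ n,
      IsUniformization (om F ω t n) (σ n) (width F δ ν ω t σ ρ n - ν) ν (Xs n) (Us n) ∧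
      Xs (n + 1) = rescale (eta F ω t (n + 1)) (cfT F ω t (n + 1)) (pullback (Us n) (Xs n))

/-- The hypotheses of the convergence theorem for a real-analytic field `X`. -/
structure ConvergenceHypotheses {m : ℕ} (F : Set SL(m + 1, ℝ)) (δ ν : ℝ) (ω : Fin (m + 1) → ℝ)
    (t σ : ℕ → ℝ) (ρ : ℝ) (X : (Fin (m + 1) → ℝ) → (Fin (m + 1) → ℝ)) : Prop where
  widths : IsResonanceWidths σ
  times : IsStoppingTimes F ω t
  widths_lt : ∀ n, σ n < l1 (om F ω t n)
  rho_pos : 0 < ρ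
  mem : MemA' ρ (cx X)
  rot : HasRot X ω
  small : normA' {0}ᶜ ρ (cx X) < ENNReal.ofReal (eps F ν ω t σ 0 / ((m : ℝ) + 2))
  strip : ∃ B : ℝ, Tendsto (calB F δ ν ω t σ) atTop (𝓝 B) ∧ B < ρ

end TorusRenorm

end

open TorusRenorm
open scoped MatrixGroups

/-!
A vector `ω` of the class `𝒴` satisfies a Brjuno condition, and a field `X` close to a constant
with rotation vector `ω` is then analytically conjugate to the constant field `ω`. The conjugacy
`ψ` does more than the theorem asks: the renormalization of `ψ^* X = ω` is explicit, the iterates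
being the constant fields `ω_n` and the changes of variables the identity. What remains is to
choose stopping times and resonance widths for which `ℬ_n` converges.

*Conjugacy.* Functions with absolutely convergent Fourier series on a strip are handled by the
predicate `WienerLE`, which allows repeated frequencies, so that sums, products and compositions
(`WienerLE.comp_sub`) need no regrouping and no uniqueness of coefficients. The field is written
as `ω + c + g`. In one Newton step (`exists_newton_step`) the modes of `g` with `0 < ‖k‖ ≤ N` are
removed by `id + h`, where `∂_ω h` is this part of `g`; the remainder is quadratic in `g` up to a
truncation error. The drift `c` needs no parameter to compensate for it, because the rotation
vector is invariant under conjugation (`HasRot.of_conj`) and forces `‖c‖ ≤ sup ‖g‖`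
(`HasRot.norm_const_le`). With the truncations `N_i = (3/2)^i`, the sizes solving the recursion of
`exists_newton_exponents` lead to a finite loss of analyticity exactly because of the Brjuno
condition; the limit of the conjugacies is given by `IsBrjuno.exists_conjugacy`.

*Small divisors.* Let `β_n` be the absolute value of the logarithm in the `n`-th term of the
series that defines `𝒴`, so that `∑ A_0 ⋯ A_n β_n < ∞`. The logarithms telescope, and together
with the second condition on `𝒴` this bounds `l`, `log (‖T_1‖ ⋯ ‖T_l‖)`, `|log |λ_l||`,
`log ‖ω_l‖` and `-log σ_l` by a multiple of `1 + ∑_{n < l} β_n` (`exists_growthBound`). A mode `k ≠ 0`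
has to leave the resonant cones at some index `n`: as long as it stays it is contracted by `A_0 ⋯
A_{n-1}`, which has limit inferior `0` by `exists_prodA_lt`, but nonzero integer vectors have norm
at least `1`. At that index `|k · ω| > σ_n / |λ_n|`, which is the Brjuno condition
(`isBrjuno_of_growthBound`).

*Scheme.* The given widths need not make `ℬ_n` converge, since the terms `δ` and `ν` in its
definition enter with weights `A_0 ⋯ A_n`. The stopping times are therefore thinned out to those
at which `A_0 ⋯ A_{l-1}` has halved, and the widths are taken so small that the new cones lie in
all the intermediate old ones (`transfer_mem_cone`). Then the new products of the `A_n` decrease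
geometrically and `log φ_n` is controlled by the growth bound (`log_phi_le`), whence
`exists_scheme`.
-/

namespace TorusRenorm

section

/-! ### Absolutely convergent trigonometric series -/

theorem l1_nonneg {n : ℕ} {R : Type*} [SeminormedAddGroup R] (u : Fin n → R) : 0 ≤ l1 u :=
  Finset.sum_nonneg fun _ _ => norm_nonneg _

theorem l1_zero {n : ℕ} {R : Type*} [SeminormedAddGroup R] : l1 (0 : Fin n → R) = 0 := by
  simp [l1]

theorem l1_add_le {n : ℕ} {R : Type*} [SeminormedAddGroup R] (u v : Fin n → R) :
    l1 (u + v) ≤ l1 u + l1 v := by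
  unfold l1
  rw [← Finset.sum_add_distrib]
  exact Finset.sum_le_sum fun i _ => norm_add_le _ _

theorem l1_neg {n : ℕ} {R : Type*} [SeminormedAddGroup R] (u : Fin n → R) :
    l1 (-u) = l1 u := by
  simp [l1]

theorem norm_le_l1 {n : ℕ} {R : Type*} [SeminormedAddGroup R] (u : Fin n → R) (j : Fin n) :
    ‖u j‖ ≤ l1 u :=
  Finset.single_le_sum (f := fun i => ‖u i‖) (fun _ _ => norm_nonneg _) (Finset.mem_univ j)

variable {m : ℕ}

theorem dotZ_add_left (k l : Fin (m + 1) → ℤ) (x : Fin (m + 1) → ℝ) :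
    dotZ (k + l) x = dotZ k x + dotZ l x := by
  simp [dotZ, add_mul, Finset.sum_add_distrib]

theorem dotZ_neg_left (k : Fin (m + 1) → ℤ) (x : Fin (m + 1) → ℝ) :
    dotZ (-k) x = -dotZ k x := by
  simp [dotZ]

theorem dotZ_zero_left (x : Fin (m + 1) → ℝ) : dotZ 0 x = 0 := by simp [dotZ]

theorem dotZ_add_right (k : Fin (m + 1) → ℤ) (x y : Fin (m + 1) → ℝ) :
    dotZ k (x + y) = dotZ k x + dotZ k y := by
  simp [dotZ, mul_add, Finset.sum_add_distrib]

theorem abs_dotZ_le (k : Fin (m + 1) → ℤ) (x : Fin (m + 1) → ℝ) :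
    |dotZ k x| ≤ l1 k * ‖x‖ := by
  unfold dotZ l1
  rw [Finset.sum_mul]
  refine (Finset.abs_sum_le_sum_abs _ _).trans (Finset.sum_le_sum fun i _ => ?_)
  rw [abs_mul, Int.norm_eq_abs]
  exact mul_le_mul_of_nonneg_left (norm_le_pi_norm x i) (abs_nonneg _)

/-- The character `x ↦ e^{2πi k·x}`. -/
noncomputable def mode (k : Fin (m + 1) → ℤ) (x : Fin (m + 1) → ℝ) : ℂ :=
  Complex.exp ((2 * Real.pi * dotZ k x : ℝ) * Complex.I)

theorem norm_mode (k : Fin (m + 1) → ℤ) (x : Fin (m + 1) → ℝ) : ‖mode k x‖ = 1 :=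
  Complex.norm_exp_ofReal_mul_I _

theorem mode_zero (x : Fin (m + 1) → ℝ) : mode 0 x = 1 := by
  simp [mode, dotZ_zero_left]

theorem mode_add_left (k l : Fin (m + 1) → ℤ) (x : Fin (m + 1) → ℝ) :
    mode (k + l) x = mode k x * mode l x := by
  rw [mode, mode, mode, ← Complex.exp_add, dotZ_add_left]
  congr 1; push_cast; ring

theorem mode_add_right (k : Fin (m + 1) → ℤ) (x y : Fin (m + 1) → ℝ) :
    mode k (x + y) = mode k x * mode k y := by
  rw [mode, mode, mode, ← Complex.exp_add, dotZ_add_right]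
  congr 1; push_cast; ring

theorem mode_neg (k : Fin (m + 1) → ℤ) (x : Fin (m + 1) → ℝ) :
    mode (-k) x = (starRingEnd ℂ) (mode k x) := by
  rw [mode, mode, ← Complex.exp_conj, dotZ_neg_left, map_mul, Complex.conj_ofReal, Complex.conj_I]
  congr 1; push_cast; ring

theorem mode_intCast (k l : Fin (m + 1) → ℤ) : mode k (fun i => (l i : ℝ)) = 1 := by
  rw [mode, Complex.exp_eq_one_iff]
  refine ⟨∑ i, k i * l i, ?_⟩
  simp only [dotZ]; push_cast; ring

theorem one_le_expWeight {ρ : ℝ} (hρ : 0 ≤ ρ) (k : Fin (m + 1) → ℤ) :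
    1 ≤ Real.exp (ρ * l1 k) :=
  Real.one_le_exp (mul_nonneg hρ (l1_nonneg k))

/-- `f` is the sum of a series `∑ aᵢ e^{2πi κᵢ·x}` with `∑ |aᵢ| e^{ρ‖κᵢ‖} ≤ C`. Frequencies may be
repeated, so that sums and products of series need no regrouping. -/
def WienerLE (ρ C : ℝ) (f : (Fin (m + 1) → ℝ) → ℂ) : Prop :=
  ∃ (ι : Type) (a : ι → ℂ) (κ : ι → Fin (m + 1) → ℤ) (S : ℝ), S ≤ C ∧
    HasSum (fun i => ‖a i‖ * Real.exp (ρ * l1 (κ i))) S ∧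
    ∀ x, HasSum (fun i => a i * mode (κ i) x) (f x)

namespace WienerLE

variable {ρ ρ' C C' : ℝ} {f g : (Fin (m + 1) → ℝ) → ℂ}

theorem mono (h : WienerLE ρ C f) (hC : C ≤ C') : WienerLE ρ C' f := by
  obtain ⟨ι, a, κ, S, hS, h1, h2⟩ := h
  exact ⟨ι, a, κ, S, hS.trans hC, h1, h2⟩

theorem nonneg (h : WienerLE ρ C f) : 0 ≤ C := by
  obtain ⟨ι, a, κ, S, hS, h1, h2⟩ := h
  exact (h1.nonneg fun i => by positivity).trans hS

theorem congr (h : WienerLE ρ C f) (hfg : ∀ x, f x = g x) : WienerLE ρ C g :=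
  (funext hfg : f = g) ▸ h

theorem mono_strip (h : WienerLE ρ C f) (hρ : ρ' ≤ ρ) : WienerLE ρ' C f := by
  obtain ⟨ι, a, κ, S, hS, h1, h2⟩ := h
  have hle : ∀ i, ‖a i‖ * Real.exp (ρ' * l1 (κ i)) ≤ ‖a i‖ * Real.exp (ρ * l1 (κ i)) := fun i =>
    mul_le_mul_of_nonneg_left (Real.exp_le_exp.2 (mul_le_mul_of_nonneg_right hρ (l1_nonneg _)))
      (norm_nonneg _)
  have hs := Summable.of_nonneg_of_le (fun i => by positivity) hle h1.summable
  exact ⟨ι, a, κ, _, (hasSum_le hle hs.hasSum h1).trans hS, hs.hasSum, h2⟩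

theorem single (ρ : ℝ) (a : ℂ) (k : Fin (m + 1) → ℤ) :
    WienerLE ρ (‖a‖ * Real.exp (ρ * l1 k)) (fun x => a * mode k x) :=
  ⟨Unit, fun _ => a, fun _ => k, _, le_rfl, hasSum_unique _, fun _ => hasSum_unique _⟩

theorem const (ρ : ℝ) (a : ℂ) : WienerLE ρ ‖a‖ (fun _ : Fin (m + 1) → ℝ => a) := by
  have h := single (m := m) ρ a 0
  rw [l1_zero, mul_zero, Real.exp_zero, mul_one] at h
  exact h.congr fun x => by rw [mode_zero, mul_one]

theorem norm_le (hρ : 0 ≤ ρ) (h : WienerLE ρ C f) (x : Fin (m + 1) → ℝ) : ‖f x‖ ≤ C := by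
  obtain ⟨ι, a, κ, S, hS, h1, h2⟩ := h
  refine le_trans ?_ hS
  have hb : ∀ i, ‖a i * mode (κ i) x‖ ≤ ‖a i‖ * Real.exp (ρ * l1 (κ i)) := fun i => by
    rw [norm_mul, norm_mode, mul_one]
    exact le_mul_of_one_le_right (norm_nonneg _) (one_le_expWeight hρ _)
  rw [← (h2 x).tsum_eq]
  exact tsum_of_norm_bounded h1 hb

/-- The class is closed under sums of families with summable bounds. -/
theorem hasSum {β : Type} (hρ : 0 ≤ ρ) {f : β → (Fin (m + 1) → ℝ) → ℂ}
    {F : (Fin (m + 1) → ℝ) → ℂ} {C : β → ℝ} {S : ℝ} (h : ∀ b, WienerLE ρ (C b) (f b))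
    (hC : HasSum C S) (hF : ∀ x, HasSum (fun b => f b x) (F x)) : WienerLE ρ S F := by
  choose ι a κ s hs hsum hrep using h
  have hs0 : ∀ b, 0 ≤ s b := fun b => (hsum b).nonneg fun i => by positivity
  have hsS : Summable s := Summable.of_nonneg_of_le hs0 hs hC.summable
  have hw : Summable fun p : Σ b, ι b => ‖a p.1 p.2‖ * Real.exp (ρ * l1 (κ p.1 p.2)) := by
    rw [summable_sigma_of_nonneg fun p => by positivity]
    refine ⟨fun b => (hsum b).summable, ?_⟩
    simpa only [(hsum _).tsum_eq] using hsS
  refine ⟨Σ b, ι b, fun p => a p.1 p.2, fun p => κ p.1 p.2, _, ?_, hw.hasSum, fun x => ?_⟩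
  · exact hasSum_le hs (hw.hasSum.sigma hsum) hC
  · have hx : Summable fun p : Σ b, ι b => a p.1 p.2 * mode (κ p.1 p.2) x := by
      refine Summable.of_norm_bounded hw fun p => ?_
      rw [norm_mul, norm_mode, mul_one]
      exact le_mul_of_one_le_right (norm_nonneg _) (one_le_expWeight hρ _)
    have h3 := hx.hasSum.sigma fun b => hrep b x
    exact h3.unique (hF x) ▸ hx.hasSum

theorem sum {β : Type} [Fintype β] (hρ : 0 ≤ ρ) {f : β → (Fin (m + 1) → ℝ) → ℂ} {C : β → ℝ}
    (h : ∀ b, WienerLE ρ (C b) (f b)) : WienerLE ρ (∑ b, C b) (fun x => ∑ b, f b x) :=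
  hasSum hρ h (hasSum_fintype _) fun _ => hasSum_fintype _

theorem add (hρ : 0 ≤ ρ) (hf : WienerLE ρ C f) (hg : WienerLE ρ C' g) :
    WienerLE ρ (C + C') (fun x => f x + g x) := by
  have h := sum hρ (β := Bool) (f := fun b => if b then f else g)
    (C := fun b => if b then C else C') (by rintro (_ | _) <;> simpa)
  simpa using h

theorem mul (hρ : 0 ≤ ρ) (hf : WienerLE ρ C f) (hg : WienerLE ρ C' g) :
    WienerLE ρ (C * C') (fun x => f x * g x) := by
  have hC' := hg.nonneg
  obtain ⟨ι, a, κ, S, hS, h1, h2⟩ := hf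
  obtain ⟨ι', a', κ', S', hS', h1', h2'⟩ := hg
  have hS0 : 0 ≤ S := h1.nonneg fun i => by positivity
  have hprod := h1.summable.mul_of_nonneg h1'.summable (fun i => by positivity)
    (fun i => by positivity)
  have hle : ∀ p : ι × ι', ‖a p.1 * a' p.2‖ * Real.exp (ρ * l1 (κ p.1 + κ' p.2)) ≤
      ‖a p.1‖ * Real.exp (ρ * l1 (κ p.1)) * (‖a' p.2‖ * Real.exp (ρ * l1 (κ' p.2))) := fun p => by
    rw [norm_mul, mul_mul_mul_comm, ← Real.exp_add, ← mul_add]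
    gcongr
    exact l1_add_le _ _
  have hs := Summable.of_nonneg_of_le (fun p => by positivity) hle hprod
  refine ⟨ι × ι', fun p => a p.1 * a' p.2, fun p => κ p.1 + κ' p.2, _, ?_, hs.hasSum,
    fun x => ?_⟩
  · have h3 := hasSum_le hle hs.hasSum (h1.mul h1' hprod)
    exact h3.trans (mul_le_mul hS hS' (h1'.nonneg fun i => by positivity) (hS0.trans hS))
  · have hx : Summable fun p : ι × ι' => (a p.1 * mode (κ p.1) x) * (a' p.2 * mode (κ' p.2) x) := by
      refine Summable.of_norm_bounded hs fun p => ?_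
      rw [norm_mul, norm_mul, norm_mul, norm_mode, norm_mode, mul_one, mul_one, norm_mul]
      exact le_mul_of_one_le_right (by positivity) (one_le_expWeight hρ _)
    have h3 := (h2 x).mul (h2' x) hx
    refine h3.congr_fun ?_ |> fun h => h
    intro p
    simp only [mode_add_left]; ring

theorem const_mul (hρ : 0 ≤ ρ) (a : ℂ) (hf : WienerLE ρ C f) :
    WienerLE ρ (‖a‖ * C) (fun x => a * f x) :=
  mul hρ (const ρ a) hf

theorem neg (hρ : 0 ≤ ρ) (hf : WienerLE ρ C f) : WienerLE ρ C (fun x => -f x) := by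
  simpa using const_mul hρ (-1) hf

theorem sub (hρ : 0 ≤ ρ) (hf : WienerLE ρ C f) (hg : WienerLE ρ C' g) :
    WienerLE ρ (C + C') (fun x => f x - g x) := by
  simpa [sub_eq_add_neg] using add hρ hf (neg hρ hg)

theorem conj (hf : WienerLE ρ C f) : WienerLE ρ C (fun x => (starRingEnd ℂ) (f x)) := by
  obtain ⟨ι, a, κ, S, hS, h1, h2⟩ := hf
  refine ⟨ι, fun i => (starRingEnd ℂ) (a i), fun i => -κ i, S, hS, by simpa [l1_neg] using h1,
    fun x => ?_⟩
  have h3 := Complex.hasSum_conj'.2 (h2 x)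
  simpa only [map_mul, mode_neg] using h3

theorem re (hρ : 0 ≤ ρ) (hf : WienerLE ρ C f) : WienerLE ρ C (fun x => ((f x).re : ℂ)) := by
  have h := const_mul hρ (1 / 2) (add hρ hf hf.conj)
  refine (h.mono (by norm_num; linarith)).congr fun x => ?_
  rw [Complex.add_conj]; push_cast; ring

theorem pow (hρ : 0 ≤ ρ) (hf : WienerLE ρ C f) (n : ℕ) :
    WienerLE ρ (C ^ n) (fun x => f x ^ n) := by
  induction n with
  | zero => simpa using const (m := m) ρ 1
  | succ n ih => simpa only [pow_succ] using mul hρ ih hf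

theorem exp_sub_one (hρ : 0 ≤ ρ) (hf : WienerLE ρ C f) :
    WienerLE ρ (Real.exp C - 1) (fun x => Complex.exp (f x) - 1) := by
  have hr : HasSum (fun n : ℕ => C ^ (n + 1) / (n + 1).factorial) (Real.exp C - 1) := by
    have h := NormedSpace.expSeries_div_hasSum_exp (𝔸 := ℝ) C
    rw [← Real.exp_eq_exp_ℝ] at h
    simpa using (hasSum_nat_add_iff' 1).2 h
  refine hasSum hρ (f := fun (n : ℕ) x => f x ^ (n + 1) / (n + 1).factorial)
    (fun n => ?_) hr fun x => ?_
  · have h := const_mul hρ (1 / ((n + 1).factorial : ℂ)) (pow hρ hf (n + 1))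
    refine (h.mono (le_of_eq ?_)).congr fun x => by ring
    rw [norm_div, norm_one, Complex.norm_natCast]; ring
  · have h := NormedSpace.expSeries_div_hasSum_exp (𝔸 := ℂ) (f x)
    rw [← Complex.exp_eq_exp_ℂ] at h
    simpa using (hasSum_nat_add_iff' 1).2 h

theorem periodic (hf : WienerLE ρ C f) (x : Fin (m + 1) → ℝ) (l : Fin (m + 1) → ℤ) :
    f (x + fun i => (l i : ℝ)) = f x := by
  obtain ⟨ι, a, κ, S, hS, h1, h2⟩ := hf
  refine (h2 _).unique ?_
  simpa only [mode_add_right, mode_intCast, mul_one] using h2 x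

end WienerLE

/-! ### Composition with a near-identity map -/

theorem mode_comp_sub {ρ H : ℝ} (hρ : 0 ≤ ρ) {h : (Fin (m + 1) → ℝ) → Fin (m + 1) → ℝ}
    (hh : ∀ j, WienerLE ρ H (fun x => (h x j : ℂ))) (k : Fin (m + 1) → ℤ) :
    WienerLE ρ (Real.exp (ρ * l1 k) * (Real.exp (2 * Real.pi * l1 k * H) - 1))
      (fun x => mode k (x + h x) - mode k x) := by
  have h1 : WienerLE ρ (∑ j, 2 * Real.pi * ‖k j‖ * H)
      (fun x => ∑ j, (2 * Real.pi * k j * Complex.I) * (h x j : ℂ)) := by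
    refine WienerLE.sum hρ fun j => ?_
    refine (WienerLE.const_mul hρ _ (hh j)).mono (le_of_eq ?_)
    simp [abs_of_pos Real.pi_pos, Int.norm_eq_abs]
  have h2 : ∑ j, 2 * Real.pi * ‖k j‖ * H = 2 * Real.pi * l1 k * H := by
    rw [l1, Finset.mul_sum, Finset.sum_mul]
  rw [h2] at h1
  have h3 := WienerLE.mul hρ (WienerLE.single ρ 1 k) (WienerLE.exp_sub_one hρ h1)
  rw [norm_one, one_mul] at h3
  refine h3.congr fun x => ?_
  rw [mode_add_right, one_mul, mul_sub, mul_one]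
  congr 2
  rw [mode]
  congr 1
  simp only [dotZ]
  push_cast
  rw [Finset.mul_sum, Finset.sum_mul]
  exact Finset.sum_congr rfl fun j _ => by ring

/-- Composition with `id + h` moves a function by at most `4π‖h‖/δ` times its norm on a strip that
is wider by `δ`. -/
theorem WienerLE.comp_sub {ρ δ H C : ℝ} (hρ : 0 ≤ ρ) (hδ : 0 < δ)
    {h : (Fin (m + 1) → ℝ) → Fin (m + 1) → ℝ}
    (hh : ∀ j, WienerLE ρ H (fun x => (h x j : ℂ))) (hH : 4 * Real.pi * H ≤ δ)
    {g : (Fin (m + 1) → ℝ) → ℂ} (hg : WienerLE (ρ + δ) C g) :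
    WienerLE ρ (4 * Real.pi * H / δ * C) (fun x => g (x + h x) - g x) := by
  have hH0 : 0 ≤ H := (hh 0).nonneg
  obtain ⟨ι, a, κ, S, hS, h1, h2⟩ := hg
  have hpi := Real.pi_pos
  refine WienerLE.mono (C := 4 * Real.pi * H / δ * S) ?_
    (mul_le_mul_of_nonneg_left hS (by positivity))
  refine WienerLE.hasSum hρ
    (f := fun i x => a i * (mode (κ i) (x + h x) - mode (κ i) x))
    (C := fun i => 4 * Real.pi * H / δ * (‖a i‖ * Real.exp ((ρ + δ) * l1 (κ i))))
    (fun i => ?_) (h1.mul_left _) fun x => ?_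
  · refine (WienerLE.const_mul hρ (a i) (mode_comp_sub hρ hh (κ i))).mono ?_
    have hy := l1_nonneg (κ i)
    set y := l1 (κ i)
    set t := 2 * Real.pi * H with ht
    have ht0 : 0 ≤ t := by positivity
    have htd : t ≤ δ / 2 := by rw [ht]; linarith
    -- `e^{ty} - 1 ≤ t y e^{ty}`; one half of `δ` absorbs the exponential, the other the factor `y`
    have e1 : Real.exp (2 * Real.pi * y * H) - 1 ≤ t * y * Real.exp (t * y) := by
      have h3 := Real.add_one_le_exp (-(t * y))
      have h4 := mul_le_mul_of_nonneg_right h3 (Real.exp_pos (t * y)).le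
      rw [← Real.exp_add, neg_add_cancel, Real.exp_zero] at h4
      have h5 : 2 * Real.pi * y * H = t * y := by rw [ht]; ring
      rw [h5]; linarith
    have e2 : Real.exp (t * y) ≤ Real.exp (δ / 2 * y) :=
      Real.exp_le_exp.2 (mul_le_mul_of_nonneg_right htd hy)
    have e3 : y ≤ 2 / δ * Real.exp (δ / 2 * y) := by
      have h3 := Real.add_one_le_exp (δ / 2 * y)
      rw [div_mul_eq_mul_div, le_div_iff₀ hδ]; linarith
    have e4 : Real.exp (2 * Real.pi * y * H) - 1 ≤ 4 * Real.pi * H / δ * Real.exp (δ * y) := by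
      calc _ ≤ t * y * Real.exp (t * y) := e1
        _ ≤ t * (2 / δ * Real.exp (δ / 2 * y)) * Real.exp (δ / 2 * y) := by gcongr
        _ = 4 * Real.pi * H / δ * (Real.exp (δ / 2 * y) * Real.exp (δ / 2 * y)) := by
          rw [ht]; ring
        _ = _ := by rw [← Real.exp_add]; congr 2; ring
    calc ‖a i‖ * (Real.exp (ρ * y) * (Real.exp (2 * Real.pi * y * H) - 1))
        ≤ ‖a i‖ * (Real.exp (ρ * y) * (4 * Real.pi * H / δ * Real.exp (δ * y))) := by gcongr
      _ = 4 * Real.pi * H / δ * (‖a i‖ * (Real.exp (ρ * y) * Real.exp (δ * y))) := by ring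
      _ = _ := by rw [← Real.exp_add, ← add_mul]
  · simpa only [mul_sub] using (h2 _).sub (h2 x)

/-! ### Derivatives -/

/-- The linear form `v ↦ 2πi k·v`. -/
noncomputable def modeForm (k : Fin (m + 1) → ℤ) : (Fin (m + 1) → ℝ) →L[ℝ] ℂ :=
  ∑ j, (ContinuousLinearMap.proj j : (Fin (m + 1) → ℝ) →L[ℝ] ℝ).smulRight
    (2 * Real.pi * k j * Complex.I)

theorem modeForm_apply (k : Fin (m + 1) → ℤ) (v : Fin (m + 1) → ℝ) :
    modeForm k v = (2 * Real.pi * dotZ k v : ℝ) * Complex.I := by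
  simp only [modeForm, _root_.sum_apply, ContinuousLinearMap.smulRight_apply,
    ContinuousLinearMap.proj_apply, dotZ, Complex.real_smul]
  push_cast
  rw [Finset.mul_sum, Finset.sum_mul]
  exact Finset.sum_congr rfl fun j _ => by ring

theorem mode_eq_exp (k : Fin (m + 1) → ℤ) (x : Fin (m + 1) → ℝ) :
    mode k x = Complex.exp (modeForm k x) := by
  rw [mode, modeForm_apply]

theorem norm_modeForm_apply_le (k : Fin (m + 1) → ℤ) (v : Fin (m + 1) → ℝ) :
    ‖modeForm k v‖ ≤ 2 * Real.pi * l1 k * ‖v‖ := by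
  rw [modeForm_apply, norm_mul, Complex.norm_I, mul_one, Complex.norm_real, norm_mul,
    Real.norm_of_nonneg (by positivity : (0 : ℝ) ≤ 2 * Real.pi), mul_assoc _ (l1 k)]
  exact mul_le_mul_of_nonneg_left (abs_dotZ_le k v) (by positivity)

theorem norm_modeForm_le (k : Fin (m + 1) → ℤ) : ‖modeForm k‖ ≤ 2 * Real.pi * l1 k :=
  ContinuousLinearMap.opNorm_le_bound _ (by have := l1_nonneg k; positivity)
    (norm_modeForm_apply_le k)

theorem hasFDerivAt_mode (k : Fin (m + 1) → ℤ) (x : Fin (m + 1) → ℝ) :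
    HasFDerivAt (mode k) (mode k x • modeForm k) x := by
  have h := (modeForm k).hasFDerivAt (x := x) |>.cexp
  simpa only [← mode_eq_exp] using h

/-- Termwise differentiation of a trigonometric series. -/
theorem exists_hasFDerivAt_of_hasSum_mode {ι : Type} {a : ι → ℂ} {κ : ι → Fin (m + 1) → ℤ} {S : ℝ}
    {f : (Fin (m + 1) → ℝ) → ℂ} (h1 : HasSum (fun i => ‖a i‖ * l1 (κ i)) S)
    (h2 : ∀ x, HasSum (fun i => a i * mode (κ i) x) (f x)) :
    ∃ f' : (Fin (m + 1) → ℝ) → (Fin (m + 1) → ℝ) →L[ℝ] ℂ,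
      (∀ x, HasFDerivAt f (f' x) x) ∧
      (∀ x v, HasSum (fun i => a i * modeForm (κ i) v * mode (κ i) x) (f' x v)) ∧
      ∀ x, ‖f' x‖ ≤ 2 * Real.pi * S := by
  have hb : ∀ i x, ‖(a i * mode (κ i) x) • modeForm (κ i)‖ ≤
      2 * Real.pi * (‖a i‖ * l1 (κ i)) := fun i x => by
    rw [norm_smul, norm_mul, norm_mode, mul_one]
    calc _ ≤ ‖a i‖ * (2 * Real.pi * l1 (κ i)) := by gcongr; exact norm_modeForm_le _
      _ = _ := by ring
  have hu := h1.mul_left (2 * Real.pi)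
  refine ⟨fun x => ∑' i, (a i * mode (κ i) x) • modeForm (κ i), fun x => ?_, fun x v => ?_,
    fun x => tsum_of_norm_bounded hu fun i => hb i x⟩
  · have h3 := hasFDerivAt_tsum hu.summable (f := fun i x => a i * mode (κ i) x)
      (f' := fun i x => (a i * mode (κ i) x) • modeForm (κ i)) (fun i x => ?_) (fun i x => hb i x)
      (h2 0).summable x
    · have h4 : (fun y => ∑' i, a i * mode (κ i) y) = f := funext fun y => (h2 y).tsum_eq
      rwa [h4] at h3
    · have := (hasFDerivAt_mode (κ i) x).const_mul (a i)
      rwa [smul_smul] at this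
  · have h3 : Summable fun i => (a i * mode (κ i) x) • modeForm (κ i) :=
      Summable.of_norm_bounded hu.summable fun i => hb i x
    have h4 := h3.hasSum.mapL (ContinuousLinearMap.apply ℝ ℂ v)
    refine h4.congr_fun ?_
    intro i
    simp; ring

theorem WienerLE.exists_hasFDerivAt {ρ C : ℝ} (hρ : 0 < ρ) {f : (Fin (m + 1) → ℝ) → ℂ}
    (hf : WienerLE ρ C f) :
    ∃ f' : (Fin (m + 1) → ℝ) → (Fin (m + 1) → ℝ) →L[ℝ] ℂ,
      (∀ x, HasFDerivAt f (f' x) x) ∧ ∀ x, ‖f' x‖ ≤ 2 * Real.pi / ρ * C := by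
  obtain ⟨ι, a, κ, S, hS, h1, h2⟩ := hf
  have hle : ∀ i, ‖a i‖ * l1 (κ i) ≤ 1 / ρ * (‖a i‖ * Real.exp (ρ * l1 (κ i))) := fun i => by
    rw [one_div, inv_mul_eq_div, le_div_iff₀ hρ, mul_assoc]
    gcongr
    have := Real.add_one_le_exp (ρ * l1 (κ i))
    linarith
  have hs := Summable.of_nonneg_of_le
    (fun i => mul_nonneg (norm_nonneg _) (l1_nonneg _)) hle (h1.summable.mul_left _)
  obtain ⟨f', h3, -, h5⟩ := exists_hasFDerivAt_of_hasSum_mode hs.hasSum h2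
  refine ⟨f', h3, fun x => (h5 x).trans ?_⟩
  have h6 := hasSum_le hle hs.hasSum (h1.mul_left _)
  calc _ ≤ 2 * Real.pi * (1 / ρ * S) := by gcongr
    _ ≤ 2 * Real.pi * (1 / ρ * C) := by gcongr
    _ = _ := by ring

/-- The Taylor series at `x` is obtained by expanding each exponential and regrouping. -/
theorem WienerLE.analyticOnNhd {ρ C : ℝ} (hρ : 0 < ρ) {f : (Fin (m + 1) → ℝ) → ℂ}
    (hf : WienerLE ρ C f) : AnalyticOnNhd ℝ f Set.univ := by
  obtain ⟨ι, a, κ, S, hS, h1, h2⟩ := hf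
  intro x _
  have hpi := Real.pi_pos
  obtain ⟨R, hR⟩ : ∃ R : NNReal, 2 * Real.pi * (R : ℝ) = ρ :=
    ⟨Real.toNNReal (ρ / (2 * Real.pi)), by
      rw [Real.coe_toNNReal _ (by positivity)]; field_simp⟩
  have hR0 : (0 : ℝ) < R := by
    by_contra h
    have : (R : ℝ) = 0 := le_antisymm (not_lt.1 h) R.2
    rw [this] at hR; linarith
  -- the `n`-th Taylor term of the `i`-th exponential
  set q : ι → (n : ℕ) → ContinuousMultilinearMap ℝ (fun _ : Fin n => Fin (m + 1) → ℝ) ℂ :=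
    fun i n => (a i * mode (κ i) x / n.factorial) •
      (ContinuousMultilinearMap.mkPiAlgebraFin ℝ n ℂ).compContinuousLinearMap
        (fun _ => modeForm (κ i)) with hq
  have hqn : ∀ i n, ‖q i n‖ * (R : ℝ) ^ n ≤ ‖a i‖ * Real.exp (ρ * l1 (κ i)) := fun i n => by
    have e1 : ‖(ContinuousMultilinearMap.mkPiAlgebraFin ℝ n ℂ).compContinuousLinearMap
        (fun _ => modeForm (κ i))‖ ≤ (2 * Real.pi * l1 (κ i)) ^ n := by
      refine (ContinuousMultilinearMap.norm_compContinuousLinearMap_le _ _).trans ?_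
      rw [ContinuousMultilinearMap.norm_mkPiAlgebraFin, one_mul, Finset.prod_const,
        Finset.card_univ, Fintype.card_fin]
      exact pow_le_pow_left₀ (norm_nonneg _) (norm_modeForm_le _) n
    have hy := l1_nonneg (κ i)
    rw [hq, norm_smul, norm_div, norm_mul, norm_mode, mul_one, Complex.norm_natCast]
    calc _ ≤ ‖a i‖ / n.factorial * (2 * Real.pi * l1 (κ i)) ^ n * (R : ℝ) ^ n := by gcongr
      _ = ‖a i‖ * ((ρ * l1 (κ i)) ^ n / n.factorial) := by rw [← hR]; ring
      _ ≤ _ := by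
        gcongr
        exact Real.pow_div_factorial_le_exp _ (by positivity) n
  have hqs : ∀ n, Summable fun i => q i n := fun n => by
    refine Summable.of_norm_bounded (h1.summable.mul_right (((R : ℝ) ^ n)⁻¹)) fun i => ?_
    rw [← div_eq_mul_inv, le_div_iff₀ (by positivity)]
    exact hqn i n
  refine ⟨fun n => ∑' i, q i n, R, ?_, by exact_mod_cast hR0, fun {y} hy => ?_⟩
  · refine FormalMultilinearSeries.le_radius_of_bound _ S fun n => ?_
    rw [← le_div_iff₀ (by positivity)]
    have h3 := h1.div_const ((R : ℝ) ^ n)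
    refine tsum_of_norm_bounded h3 fun i => ?_
    rw [le_div_iff₀ (by positivity)]
    exact hqn i n
  · have hyR : ‖y‖ ≤ R := by
      rw [Metric.mem_eball, edist_zero_right] at hy
      have : ‖y‖₊ < R := by exact_mod_cast hy
      exact_mod_cast this.le
    have hqy : ∀ i n, q i n (fun _ => y) =
        a i * mode (κ i) x * (modeForm (κ i) y ^ n / n.factorial) := fun i n => by
      simp [hq]; ring
    have hexp : ∀ i, HasSum (fun n => ‖a i‖ * (‖modeForm (κ i) y‖ ^ n / n.factorial))
        (‖a i‖ * Real.exp ‖modeForm (κ i) y‖) := fun i => by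
      have h := NormedSpace.expSeries_div_hasSum_exp (𝔸 := ℝ) ‖modeForm (κ i) y‖
      rw [← Real.exp_eq_exp_ℝ] at h
      exact h.mul_left _
    have hle : ∀ i, ‖a i‖ * Real.exp ‖modeForm (κ i) y‖ ≤ ‖a i‖ * Real.exp (ρ * l1 (κ i)) := by
      intro i
      have hy0 := l1_nonneg (κ i)
      gcongr
      calc _ ≤ 2 * Real.pi * l1 (κ i) * ‖y‖ := norm_modeForm_apply_le _ _
        _ ≤ 2 * Real.pi * l1 (κ i) * R := by gcongr
        _ = _ := by rw [← hR]; ring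
    have hdouble : Summable fun p : ι × ℕ => q p.1 p.2 (fun _ => y) := by
      have : Summable fun p : ι × ℕ =>
          ‖a p.1‖ * (‖modeForm (κ p.1) y‖ ^ p.2 / p.2.factorial) := by
        rw [summable_prod_of_nonneg fun p => by positivity]
        refine ⟨fun i => (hexp i).summable, ?_⟩
        simp only [(hexp _).tsum_eq]
        exact Summable.of_nonneg_of_le (fun i => by positivity) hle h1.summable
      refine Summable.of_norm_bounded this fun p => le_of_eq ?_
      rw [hqy, norm_mul, norm_mul, norm_mode, mul_one, norm_div, norm_pow, Complex.norm_natCast]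
    have hin : ∀ i, HasSum (fun n => q i n (fun _ => y)) (a i * mode (κ i) (x + y)) := fun i => by
      have h := NormedSpace.expSeries_div_hasSum_exp (𝔸 := ℂ) (modeForm (κ i) y)
      rw [← Complex.exp_eq_exp_ℂ] at h
      simp only [hqy]
      rw [mode_add_right, ← mul_assoc, mode_eq_exp _ y]
      exact h.mul_left _
    have hni : ∀ n, HasSum (fun i => q i n (fun _ => y)) ((∑' i, q i n) (fun _ => y)) := fun n =>
      (hqs n).hasSum.mapL (ContinuousMultilinearMap.apply ℝ _ ℂ (fun _ => y))
    have h3 := hdouble.hasSum.prod_fiberwise hin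
    have h4 := ((Equiv.prodComm ℕ ι).hasSum_iff.2 hdouble.hasSum).prod_fiberwise hni
    rwa [h3.unique (h2 (x + y))] at h4

end

section

/-! ### Near-identity maps and rotation vectors -/

variable {m : ℕ}

theorem norm_sub_le_half_mul {h : (Fin (m + 1) → ℝ) → Fin (m + 1) → ℝ}
    {h' : (Fin (m + 1) → ℝ) → (Fin (m + 1) → ℝ) →L[ℝ] (Fin (m + 1) → ℝ)}
    (hd : ∀ x, HasFDerivAt h (h' x) x) (hb : ∀ x, ‖h' x‖ ≤ 1 / 2) (x y : Fin (m + 1) → ℝ) :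
    ‖h x - h y‖ ≤ 1 / 2 * ‖x - y‖ :=
  convex_univ.norm_image_sub_le_of_norm_hasFDerivWithin_le
    (fun z _ => (hd z).hasFDerivWithinAt) (fun z _ => hb z) (Set.mem_univ y) (Set.mem_univ x)

theorem exists_homeomorph_id_add {h : (Fin (m + 1) → ℝ) → Fin (m + 1) → ℝ}
    {h' : (Fin (m + 1) → ℝ) → (Fin (m + 1) → ℝ) →L[ℝ] (Fin (m + 1) → ℝ)}
    (hd : ∀ x, HasFDerivAt h (h' x) x) (hb : ∀ x, ‖h' x‖ ≤ 1 / 2) :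
    ∃ e : (Fin (m + 1) → ℝ) ≃ₜ (Fin (m + 1) → ℝ), ∀ x, e x = x + h x := by
  have ha : ApproximatesLinearOn (fun x => x + h x)
      ((ContinuousLinearEquiv.refl ℝ (Fin (m + 1) → ℝ)) :
        (Fin (m + 1) → ℝ) →L[ℝ] (Fin (m + 1) → ℝ)) Set.univ (1 / 2) := by
    intro x _ y _
    have h1 := norm_sub_le_half_mul hd hb x y
    have h2 : x + h x - (y + h y) - (x - y) = h x - h y := by abel
    simpa [h2] using h1
  refine ⟨ha.toHomeomorph _ (Or.inr ?_), fun x => rfl⟩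
  have h3 : ‖(((ContinuousLinearEquiv.refl ℝ (Fin (m + 1) → ℝ)).symm :
        (Fin (m + 1) → ℝ) →L[ℝ] (Fin (m + 1) → ℝ)))‖₊ = 1 := by
    rw [← NNReal.coe_inj]
    exact ContinuousLinearMap.norm_id
  rw [h3, inv_one]
  exact NNReal.half_lt_self one_ne_zero

theorem exists_equiv_id_add (A : (Fin (m + 1) → ℝ) →L[ℝ] (Fin (m + 1) → ℝ)) (hA : ‖A‖ ≤ 1 / 2) :
    ∃ i : (Fin (m + 1) → ℝ) ≃L[ℝ] (Fin (m + 1) → ℝ),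
      (i : (Fin (m + 1) → ℝ) →L[ℝ] (Fin (m + 1) → ℝ)) = ContinuousLinearMap.id ℝ _ + A := by
  have hlt : ‖-A‖ < 1 := by rw [norm_neg]; linarith
  refine ⟨ContinuousLinearEquiv.ofUnit (Units.oneSub (-A) hlt), ?_⟩
  have h1 : ((Units.oneSub (-A) hlt : ((Fin (m + 1) → ℝ) →L[ℝ] (Fin (m + 1) → ℝ))ˣ) :
      (Fin (m + 1) → ℝ) →L[ℝ] (Fin (m + 1) → ℝ)) = ContinuousLinearMap.id ℝ _ + A := by
    rw [Units.val_oneSub, sub_neg_eq_add]; rfl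
  exact h1

/-- The rotation vector does not change when a field is pulled back by `id + h`, with `h` bounded
and of derivative at most `1/2`. -/
theorem HasRot.of_conj {X Y : (Fin (m + 1) → ℝ) → (Fin (m + 1) → ℝ)} {ω : Fin (m + 1) → ℝ}
    (hX : HasRot X ω) {h : (Fin (m + 1) → ℝ) → Fin (m + 1) → ℝ}
    {h' : (Fin (m + 1) → ℝ) → (Fin (m + 1) → ℝ) →L[ℝ] (Fin (m + 1) → ℝ)}
    (hd : ∀ x, HasFDerivAt h (h' x) x) (hb : ∀ x, ‖h' x‖ ≤ 1 / 2) {B : ℝ} (hB : ∀ x, ‖h x‖ ≤ B)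
    (hY : ∀ x, Y x + h' x (Y x) = X (x + h x)) : HasRot Y ω := by
  obtain ⟨Φ, h0, h1, h2⟩ := hX
  obtain ⟨e, he⟩ := exists_homeomorph_id_add hd hb
  choose i hi using fun x => exists_equiv_id_add (h' x) (hb x)
  -- the conjugated flow; displacements of conjugated points differ by at most `2B`
  refine ⟨fun t x => e.symm (Φ t (e x)), fun x => by simp [h0], fun x t => ?_, fun x => ?_⟩
  · set z := Φ t (e x) with hz
    have hde : HasFDerivAt e (i (e.symm z) : (Fin (m + 1) → ℝ) →L[ℝ] (Fin (m + 1) → ℝ))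
        (e.symm z) := by
      rw [hi, show (e : (Fin (m + 1) → ℝ) → Fin (m + 1) → ℝ) = fun x => x + h x from funext he]
      exact (hasFDerivAt_id _).add (hd _)
    have hds := HasFDerivAt.of_local_left_inverse e.symm.continuous.continuousAt hde
      (Eventually.of_forall fun y => e.apply_symm_apply y)
    have h3 := HasFDerivAt.comp_hasDerivAt t hds (h1 (e x) t)
    refine h3.congr_deriv ?_
    have h4 : i (e.symm z) (Y (e.symm z)) = X z := by
      have : i (e.symm z) (Y (e.symm z)) = Y (e.symm z) + h' (e.symm z) (Y (e.symm z)) := by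
        rw [← ContinuousLinearEquiv.coe_coe, hi]; rfl
      rw [this, hY, ← he, e.apply_symm_apply]
    rw [← h4]
    exact (i (e.symm z)).symm_apply_apply _
  · have h3 : Tendsto (fun t : ℝ => t⁻¹ • (h x - h (e.symm (Φ t (e x))))) atTop (𝓝 0) := by
      refine squeeze_zero_norm' (a := fun t : ℝ => t⁻¹ * (B + B)) ?_ ?_
      · filter_upwards [eventually_gt_atTop 0] with t ht
        rw [norm_smul, Real.norm_of_nonneg (inv_pos.2 ht).le]
        exact mul_le_mul_of_nonneg_left ((norm_sub_le _ _).trans (add_le_add (hB _) (hB _)))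
          (inv_pos.2 ht).le
      · simpa using tendsto_inv_atTop_zero.mul_const (B + B)
    have h4 := (h2 (e x)).add h3
    rw [add_zero] at h4
    refine h4.congr fun t => ?_
    rw [← smul_add]
    congr 1
    have h5 := he (e.symm (Φ t (e x)))
    rw [e.apply_symm_apply] at h5
    have h6 : Φ t (e x) - e x + (h x - h (e.symm (Φ t (e x)))) =
        (e.symm (Φ t (e x)) + h (e.symm (Φ t (e x)))) - (x + h x) +
          (h x - h (e.symm (Φ t (e x)))) := by rw [← h5, ← he x]
    rw [h6]; abel

/-- A field `ω + c + g` with rotation vector `ω` has `‖c‖ ≤ sup ‖g‖`, because in time `t` its orbits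
stay within `t sup ‖g‖` of uniform motion with velocity `ω + c`. -/
theorem HasRot.norm_const_le {ω c : Fin (m + 1) → ℝ} {g : (Fin (m + 1) → ℝ) → Fin (m + 1) → ℝ}
    (h : HasRot (fun x => ω + c + g x) ω) {ε : ℝ} (hg : ∀ x, ‖g x‖ ≤ ε) : ‖c‖ ≤ ε := by
  obtain ⟨Φ, h0, h1, h2⟩ := h
  have h3 : ∀ t : ℝ, 0 < t → ‖t⁻¹ • (Φ t 0 - 0) - (ω + c)‖ ≤ ε := fun t ht => by
    have hd : ∀ s, HasDerivAt (fun s => Φ s 0 - s • (ω + c)) (g (Φ s 0)) s := fun s => by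
      have h4 := (h1 0 s).sub ((hasDerivAt_id s).smul_const (ω + c))
      refine h4.congr_deriv ?_
      simp
    have h5 := norm_image_sub_le_of_norm_deriv_le_segment' (a := 0) (b := t) (C := ε)
      (fun s _ => (hd s).hasDerivWithinAt) (fun s _ => hg _) t ⟨ht.le, le_rfl⟩
    simp only [h0, zero_smul, sub_zero] at h5
    have h6 : t⁻¹ • (Φ t 0 - 0) - (ω + c) = t⁻¹ • (Φ t 0 - t • (ω + c)) := by
      rw [sub_zero, smul_sub, smul_smul, inv_mul_cancel₀ ht.ne', one_smul]
    rw [h6, norm_smul, Real.norm_of_nonneg (inv_pos.2 ht).le, inv_mul_le_iff₀ ht]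
    linarith
  have h4 : Tendsto (fun t : ℝ => ‖t⁻¹ • (Φ t 0 - 0) - (ω + c)‖) atTop (𝓝 ‖ω - (ω + c)‖) :=
    ((h2 0).sub_const _).norm
  have h5 := le_of_tendsto h4 (by
    filter_upwards [eventually_gt_atTop 0] with t ht using h3 t ht)
  simpa using h5

/-! ### One step of the iteration -/

/-- `M` and `u₀` with small `M`: the solution of `(1 + M) u = u₀` given by the Neumann series. -/
theorem exists_neumann {ρ q B : ℝ} (hρ : 0 ≤ ρ) {M : Fin (m + 1) → Fin (m + 1) →
    (Fin (m + 1) → ℝ) → ℝ} {u₀ : Fin (m + 1) → (Fin (m + 1) → ℝ) → ℝ}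
    (hM : ∀ i j, WienerLE ρ q (fun x => (M i j x : ℂ))) (hq : (m + 1) * q ≤ 1 / 2)
    (hu : ∀ i, WienerLE ρ B (fun x => (u₀ i x : ℂ))) :
    ∃ u : Fin (m + 1) → (Fin (m + 1) → ℝ) → ℝ,
      (∀ i, WienerLE ρ (2 * B) (fun x => (u i x : ℂ))) ∧
      ∀ i x, u i x + ∑ j, M i j x * u j x = u₀ i x := by
  -- `v n = (-M)ⁿ u₀`
  set v : ℕ → Fin (m + 1) → (Fin (m + 1) → ℝ) → ℝ := fun n =>
    n.rec u₀ (fun _ w i x => -∑ j, M i j x * w j x) with hv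
  have hv0 : v 0 = u₀ := rfl
  have hvs : ∀ n i x, v (n + 1) i x = -∑ j, M i j x * v n j x := fun _ _ _ => rfl
  have hB : 0 ≤ B := (hu 0).nonneg
  have hW : ∀ n i, WienerLE ρ (B * (1 / 2) ^ n) (fun x => (v n i x : ℂ)) := by
    intro n
    induction n with
    | zero => intro i; simpa [hv0] using hu i
    | succ n ih =>
      intro i
      have h1 := WienerLE.neg hρ (WienerLE.sum hρ fun j => WienerLE.mul hρ (hM i j) (ih j))
      refine (h1.mono ?_).congr fun x => by rw [hvs]; push_cast; rfl
      rw [Finset.sum_const, Finset.card_univ, Fintype.card_fin, nsmul_eq_mul, pow_succ]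
      push_cast
      calc (m + 1 : ℝ) * (q * (B * (1 / 2) ^ n)) = ((m + 1) * q) * (B * (1 / 2) ^ n) := by ring
        _ ≤ (1 / 2) * (B * (1 / 2) ^ n) := by gcongr
        _ = _ := by ring
  have hgeo : HasSum (fun n : ℕ => B * (1 / 2) ^ n) (2 * B) := by
    simpa [mul_comm] using hasSum_geometric_two.mul_left B
  have hs : ∀ i x, Summable fun n => v n i x := fun i x =>
    Summable.of_norm_bounded hgeo.summable fun n => by
      simpa using WienerLE.norm_le hρ (hW n i) x
  refine ⟨fun i x => ∑' n, v n i x, fun i => ?_, fun i x => ?_⟩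
  · refine WienerLE.hasSum hρ (fun n => hW n i) hgeo fun x => ?_
    exact Complex.hasSum_ofReal.2 (hs i x).hasSum
  · have h1 : HasSum (fun n => ∑ j, M i j x * v n j x) (∑ j, M i j x * ∑' n, v n j x) :=
      hasSum_sum fun j _ => (hs j x).hasSum.mul_left _
    have h2 : HasSum (fun n => v (n + 1) i x) (-∑ j, M i j x * ∑' n, v n j x) := by
      simpa only [hvs] using h1.neg
    have h3 := (hasSum_nat_add_iff' 1).2 (hs i x).hasSum
    rw [Finset.sum_range_one, hv0] at h3
    have := h2.unique h3
    linarith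

theorem WienerLE.of_dominated {ι : Type} {a b : ι → ℂ} {κ : ι → Fin (m + 1) → ℤ}
    {ρ₁ ρ₂ S K : ℝ} (hρ : 0 ≤ ρ₂) (h1 : HasSum (fun i => ‖a i‖ * Real.exp (ρ₁ * l1 (κ i))) S)
    (hb : ∀ i, ‖b i‖ * Real.exp (ρ₂ * l1 (κ i)) ≤ K * (‖a i‖ * Real.exp (ρ₁ * l1 (κ i)))) :
    WienerLE ρ₂ (K * S) (fun x => ∑' i, b i * mode (κ i) x) ∧
      ∀ x, HasSum (fun i => b i * mode (κ i) x) (∑' i, b i * mode (κ i) x) := by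
  have hs := Summable.of_nonneg_of_le (fun i => by positivity) hb (h1.summable.mul_left K)
  have hx : ∀ x, HasSum (fun i => b i * mode (κ i) x) (∑' i, b i * mode (κ i) x) := fun x =>
    (Summable.of_norm_bounded hs fun i => by
      rw [norm_mul, norm_mode, mul_one]
      exact le_mul_of_one_le_right (norm_nonneg _) (one_le_expWeight hρ _)).hasSum
  exact ⟨⟨ι, b, κ, _, hasSum_le hb hs.hasSum (h1.mul_left K), hs.hasSum, hx⟩, hx⟩

/-- Splitting of a function into a constant, a part on which the homological equation
`∂_ω h = g₁` can be solved, and a small remainder: the modes with `k = 0`, `0 < ‖k‖ ≤ N` and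
`N < ‖k‖`. -/
theorem exists_homological {ω : Fin (m + 1) → ℝ} {ρ δ N L ε : ℝ} (hρ : 0 ≤ ρ) (hδ : 0 ≤ δ)
    (hN : 0 ≤ N)
    (hdiv : ∀ k : Fin (m + 1) → ℤ, k ≠ 0 → l1 k ≤ N → Real.exp (-L) ≤ |dotZ k ω|)
    {g : (Fin (m + 1) → ℝ) → ℝ} (hg : WienerLE (ρ + δ) ε (fun x => (g x : ℂ))) :
    ∃ (c : ℝ) (g₁ g₂ h : (Fin (m + 1) → ℝ) → ℝ)
      (h' : (Fin (m + 1) → ℝ) → (Fin (m + 1) → ℝ) →L[ℝ] ℝ),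
      (∀ x, g x = c + g₁ x + g₂ x) ∧ |c| ≤ ε ∧
      WienerLE ρ (Real.exp (-δ * N) * ε) (fun x => (g₂ x : ℂ)) ∧
      WienerLE (ρ + δ) (Real.exp L * ε) (fun x => (h x : ℂ)) ∧
      (∀ x, HasFDerivAt h (h' x) x) ∧ (∀ x, h' x ω = g₁ x) ∧
      ∀ j, WienerLE ρ (N * Real.exp L * ε) (fun x => (h' x (Pi.single j 1) : ℂ)) := by
  classical
  obtain ⟨ι, a, κ, S, hS, h1, h2⟩ := hg
  have hpi := Real.pi_pos
  have hρδ : 0 ≤ ρ + δ := by linarith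
  have hmono : ∀ i, Real.exp (ρ * l1 (κ i)) ≤ Real.exp ((ρ + δ) * l1 (κ i)) := fun i =>
    Real.exp_le_exp.2 (mul_le_mul_of_nonneg_right (by linarith) (l1_nonneg _))
  set a₀ : ι → ℂ := fun i => if κ i = 0 then a i else 0 with ha₀
  set a₁ : ι → ℂ := fun i => if κ i ≠ 0 ∧ l1 (κ i) ≤ N then a i else 0 with ha₁
  set a₂ : ι → ℂ := fun i => if κ i ≠ 0 ∧ N < l1 (κ i) then a i else 0 with ha₂
  set b : ι → ℂ := fun i => a₁ i / modeForm (κ i) ω with hb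
  have hsplit : ∀ i, a i = a₀ i + a₁ i + a₂ i := fun i => by
    simp only [ha₀, ha₁, ha₂]
    by_cases h : κ i = 0
    · simp [h]
    · by_cases h' : l1 (κ i) ≤ N
      · simp [h, h', not_lt.2 h']
      · simp [h, h', not_le.1 h']
  -- the coefficients `b` of `h` are those of `g₁` divided by `2πi k·ω`
  have hnb : ∀ i, ‖b i‖ * (2 * Real.pi) ≤ Real.exp L * ‖a i‖ := fun i => by
    simp only [hb, ha₁]
    split_ifs with h
    · have h3 := hdiv _ h.1 h.2
      have h4 : 0 < |dotZ (κ i) ω| := (Real.exp_pos _).trans_le h3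
      rw [norm_div, modeForm_apply, norm_mul, Complex.norm_I, mul_one, Complex.norm_real, norm_mul,
        Real.norm_of_nonneg (by positivity : (0 : ℝ) ≤ 2 * Real.pi), Real.norm_eq_abs]
      have h5 : ‖a i‖ / (2 * Real.pi * |dotZ (κ i) ω|) * (2 * Real.pi) =
          ‖a i‖ / |dotZ (κ i) ω| := by field_simp
      rw [h5, div_le_iff₀ h4]
      calc ‖a i‖ = Real.exp L * ‖a i‖ * Real.exp (-L) := by
            rw [mul_right_comm, ← Real.exp_add]; simp
        _ ≤ _ := by gcongr
    · simp; positivity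
  have hnb1 : ∀ i, ‖b i‖ ≤ Real.exp L * ‖a i‖ := fun i => by
    refine le_trans ?_ (hnb i)
    exact le_mul_of_one_le_right (norm_nonneg _) (by linarith [Real.pi_gt_three])
  have hbz : ∀ i, N < l1 (κ i) → b i = 0 := fun i hi => by
    simp [hb, ha₁, not_le.2 hi]
  have hbN : ∀ i, ‖b i‖ * (2 * Real.pi * l1 (κ i)) ≤ N * (Real.exp L * ‖a i‖) := fun i => by
    rcases lt_or_ge N (l1 (κ i)) with h | h
    · rw [hbz i h, norm_zero, zero_mul]; positivity
    · calc ‖b i‖ * (2 * Real.pi * l1 (κ i)) = l1 (κ i) * (‖b i‖ * (2 * Real.pi)) := by ring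
        _ ≤ _ := mul_le_mul h (hnb i) (by positivity) hN
  obtain ⟨W0, H0⟩ := WienerLE.of_dominated (b := a₀) (K := 1) hρδ h1 fun i => by
    rw [one_mul]; gcongr; simp only [ha₀]; split_ifs <;> simp
  obtain ⟨W1, H1⟩ := WienerLE.of_dominated (b := a₁) (K := 1) hρδ h1 fun i => by
    rw [one_mul]; gcongr; simp only [ha₁]; split_ifs <;> simp
  obtain ⟨W2, H2⟩ := WienerLE.of_dominated (b := a₂) (K := Real.exp (-δ * N)) hρ h1 fun i => by
    simp only [ha₂]
    split_ifs with h
    · rw [mul_left_comm, ← Real.exp_add]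
      gcongr
      nlinarith [h.2]
    · simp; positivity
  obtain ⟨WH, HH⟩ := WienerLE.of_dominated (b := b) (K := Real.exp L) hρδ h1 fun i => by
    rw [← mul_assoc]; gcongr; exact hnb1 i
  have hsl : Summable fun i => ‖b i‖ * l1 (κ i) := by
    refine Summable.of_nonneg_of_le (fun i => mul_nonneg (norm_nonneg _) (l1_nonneg _))
      (fun i => ?_) (h1.summable.mul_left (N * Real.exp L))
    have hy := l1_nonneg (κ i)
    calc ‖b i‖ * l1 (κ i) ≤ ‖b i‖ * (2 * Real.pi * l1 (κ i)) := by
          gcongr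
          exact le_mul_of_one_le_left hy (by linarith [Real.pi_gt_three])
      _ ≤ N * (Real.exp L * ‖a i‖) := hbN i
      _ ≤ N * (Real.exp L * (‖a i‖ * Real.exp ((ρ + δ) * l1 (κ i)))) := by
          gcongr
          exact le_mul_of_one_le_right (norm_nonneg _) (one_le_expWeight hρδ _)
      _ = _ := by ring
  obtain ⟨hc', hd, hv, -⟩ := exists_hasFDerivAt_of_hasSum_mode hsl.hasSum HH
  have hS0 : 0 ≤ S := h1.nonneg fun i => by positivity
  have hconst : ∀ x, ∑' i, a₀ i * mode (κ i) x = ∑' i, a₀ i := fun x => by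
    refine tsum_congr fun i => ?_
    simp only [ha₀]
    split_ifs with h
    · rw [h, mode_zero, mul_one]
    · simp
  refine ⟨(∑' i, a₀ i).re, fun x => (∑' i, a₁ i * mode (κ i) x).re,
    fun x => (∑' i, a₂ i * mode (κ i) x).re, fun x => (∑' i, b i * mode (κ i) x).re,
    fun x => Complex.reCLM.comp (hc' x), fun x => ?_, ?_, ?_, ?_, fun x => ?_, fun x => ?_,
    fun j => ?_⟩
  · have h3 := ((H0 x).add (H1 x)).add (H2 x)
    have h4 := (h2 x).unique (h3.congr_fun fun i => by rw [hsplit i]; ring)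
    have h5 := congrArg Complex.re h4
    rw [Complex.ofReal_re, Complex.add_re, Complex.add_re, hconst] at h5
    exact h5
  · refine (Complex.abs_re_le_norm _).trans ?_
    have h3 := WienerLE.norm_le hρδ W0 0
    rw [hconst, one_mul] at h3
    exact h3.trans hS
  · exact WienerLE.re hρ (W2.mono (by gcongr))
  · exact WienerLE.re hρδ (WH.mono (by gcongr))
  · exact Complex.reCLM.hasFDerivAt.comp x (hd x)
  · change (hc' x ω).re = _
    congr 1
    refine (hv x ω).unique ((H1 x).congr_fun fun i => ?_)
    simp only [hb]
    -- where the divisor vanishes, so does the coefficient of `g₁`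
    by_cases h : modeForm (κ i) ω = 0
    · have : a₁ i = 0 := by
        simp only [ha₁]
        rw [if_neg]
        rintro ⟨h3, h4⟩
        have h5 := (Real.exp_pos _).trans_le (hdiv _ h3 h4)
        rw [modeForm_apply] at h
        have h6 : 2 * Real.pi * dotZ (κ i) ω = 0 := by
          rcases mul_eq_zero.1 h with h | h
          · exact_mod_cast h
          · exact absurd h Complex.I_ne_zero
        rcases mul_eq_zero.1 h6 with h | h
        · linarith
        · rw [h, abs_zero] at h5; exact lt_irrefl _ h5
      rw [this]; simp
    · rw [div_mul_cancel₀ _ h]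
  · obtain ⟨WD, HD⟩ := WienerLE.of_dominated (ρ₂ := ρ)
      (b := fun i => b i * modeForm (κ i) (Pi.single j 1))
      (K := N * Real.exp L) hρ h1 fun i => by
        calc _ ≤ (‖b i‖ * (2 * Real.pi * l1 (κ i))) * Real.exp ((ρ + δ) * l1 (κ i)) := by
              have h6 := norm_modeForm_apply_le (κ i) (Pi.single j (1 : ℝ))
              rw [Pi.norm_single, norm_one, mul_one] at h6
              rw [norm_mul]
              have hy := l1_nonneg (κ i)
              exact mul_le_mul (mul_le_mul_of_nonneg_left h6 (norm_nonneg _)) (hmono i)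
                (Real.exp_pos _).le (by positivity)
          _ ≤ (N * (Real.exp L * ‖a i‖)) * Real.exp ((ρ + δ) * l1 (κ i)) := by
              gcongr ?_ * _
              exact hbN i
          _ = _ := by ring
    refine WienerLE.re hρ ((WD.mono (by gcongr)).congr fun x => ?_)
    exact (HD x).unique (hv x _)

/-- One Newton step. The rotation vector controls the drift `c`, and after conjugation by `id + h`
the field is `ω + c' + g'` with `g'` quadratically small up to the truncation error `e^{-δN}`. The
new drift `c'` is the sum of `c` and the average of `g`; it is of the order of `ε` only, but the
rotation vector bounds it by `g'` at the next step. -/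
theorem exists_newton_step {ω c : Fin (m + 1) → ℝ} {ρ δ N L ε : ℝ}
    {g : (Fin (m + 1) → ℝ) → Fin (m + 1) → ℝ} (hρ : 0 ≤ ρ) (hδ : 0 < δ) (hN : 1 ≤ N)
    (hδN : 1 ≤ δ * N)
    (hdiv : ∀ k : Fin (m + 1) → ℤ, k ≠ 0 → l1 k ≤ N → Real.exp (-L) ≤ |dotZ k ω|)
    (hg : ∀ j, WienerLE (ρ + δ) ε (fun x => (g x j : ℂ)))
    (hrot : HasRot (fun x => ω + c + g x) ω) (hq : 16 * (m + 1) * (N * Real.exp L * ε) ≤ 1) :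
    ∃ (h : (Fin (m + 1) → ℝ) → Fin (m + 1) → ℝ)
      (h' : (Fin (m + 1) → ℝ) → (Fin (m + 1) → ℝ) →L[ℝ] (Fin (m + 1) → ℝ))
      (c' : Fin (m + 1) → ℝ) (g' : (Fin (m + 1) → ℝ) → Fin (m + 1) → ℝ),
      (∀ j, WienerLE (ρ + δ) (Real.exp L * ε) (fun x => (h x j : ℂ))) ∧
      (∀ x, HasFDerivAt h (h' x) x) ∧ (∀ x, ‖h' x‖ ≤ 1 / 2) ∧
      (∀ x, (ω + c' + g' x) + h' x (ω + c' + g' x) = ω + c + g (x + h x)) ∧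
      (∀ j, WienerLE ρ (ε * (36 * (m + 1) * (N * Real.exp L * ε) + 2 * Real.exp (-δ * N)))
        (fun x => (g' x j : ℂ))) ∧
      HasRot (fun x => ω + c' + g' x) ω := by
  have hρδ : 0 ≤ ρ + δ := by linarith
  have hN0 : 0 ≤ N := by linarith
  have hε : 0 ≤ ε := (hg 0).nonneg
  set q := N * Real.exp L * ε with hqdef
  have hq0 : 0 ≤ q := by positivity
  have hm0 : (0 : ℝ) ≤ m := Nat.cast_nonneg m
  choose c₀ g₁ g₂ h h' hsplit hc₀ hg₂ hh hd hω hp using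
    fun j => exists_homological hρ hδ.le hN0 hdiv (hg j)
  have hgn : ∀ x, ‖g x‖ ≤ ε := fun x => (pi_norm_le_iff_of_nonneg hε).2 fun j => by
    simpa using WienerLE.norm_le hρδ (hg j) x
  have hcn : ∀ j, |c j| ≤ ε := fun j => (norm_le_pi_norm c j).trans (hrot.norm_const_le hgn)
  set c' : Fin (m + 1) → ℝ := fun j => c j + c₀ j with hc'
  have hc'n : ∀ j, |c' j| ≤ 2 * ε := fun j =>
    (abs_add_le _ _).trans (by linarith [hcn j, hc₀ j])
  -- the displacement and its derivative as vector valued maps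
  set hv : (Fin (m + 1) → ℝ) → Fin (m + 1) → ℝ := fun x j => h j x with hhv
  set hv' : (Fin (m + 1) → ℝ) → (Fin (m + 1) → ℝ) →L[ℝ] (Fin (m + 1) → ℝ) :=
    fun x => ContinuousLinearMap.pi fun j => h' j x with hhv'
  have hvd : ∀ x, HasFDerivAt hv (hv' x) x := fun x => hasFDerivAt_pi.2 fun j => hd j x
  have hexpand : ∀ j x (v : Fin (m + 1) → ℝ), h' j x v = ∑ i, h' j x (Pi.single i 1) * v i := by
    intro j x v
    conv_lhs => rw [← Finset.univ_sum_single v, map_sum]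
    refine Finset.sum_congr rfl fun i _ => ?_
    rw [show (Pi.single i (v i) : Fin (m + 1) → ℝ) = v i • Pi.single i 1 by
      rw [← Pi.single_smul, smul_eq_mul, mul_one], map_smul, smul_eq_mul, mul_comm]
  have hqm : (m + 1) * q ≤ 1 / 2 := by nlinarith
  have hvn : ∀ x, ‖hv' x‖ ≤ 1 / 2 := fun x => by
    refine ContinuousLinearMap.opNorm_le_bound _ (by norm_num) fun v => ?_
    refine (pi_norm_le_iff_of_nonneg (by positivity)).2 fun j => ?_
    change ‖h' j x v‖ ≤ _
    rw [hexpand, Real.norm_eq_abs]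
    refine (Finset.abs_sum_le_sum_abs _ _).trans ?_
    calc ∑ i, |h' j x (Pi.single i 1) * v i| ≤ ∑ _i : Fin (m + 1), q * ‖v‖ := by
          refine Finset.sum_le_sum fun i _ => ?_
          rw [abs_mul]
          refine mul_le_mul ?_ (norm_le_pi_norm v i) (abs_nonneg _) hq0
          simpa using WienerLE.norm_le hρ (hp j i) x
      _ = (m + 1) * q * ‖v‖ := by simp [mul_assoc]
      _ ≤ _ := by gcongr
  have hH : 4 * Real.pi * (Real.exp L * ε) ≤ 16 * (Real.exp L * ε) := by
    have : 0 ≤ Real.exp L * ε := by positivity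
    nlinarith [Real.pi_lt_four]
  have hNH : 16 * (Real.exp L * ε) ≤ 16 * q * δ := by
    have : 0 ≤ Real.exp L * ε := by positivity
    rw [hqdef]; nlinarith
  have hq1 : 16 * q ≤ 1 := by nlinarith
  have hHδ : 4 * Real.pi * (Real.exp L * ε) ≤ δ := by nlinarith
  -- `g'` solves `(1 + Dh) g' = u₀`, where `u₀ = (g ∘ (id + h) - g) + g₂ - Dh c'` is the error of
  -- replacing `g ∘ (id + h)` by `g`, plus the modes above `N` and the effect of `Dh` on the drift
  have hcomp : ∀ j, WienerLE ρ (16 * q * ε) (fun x => ((g (x + hv x) j - g x j : ℝ) : ℂ)) :=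
    fun j => by
      have h1 := WienerLE.comp_sub hρ hδ (fun i => (hh i).mono_strip (by linarith)) hHδ (hg j)
      refine (h1.mono ?_).congr fun x => by push_cast; rfl
      gcongr
      rw [div_le_iff₀ hδ]
      linarith
  have hDc : ∀ j, WienerLE ρ (2 * (m + 1) * q * ε) (fun x => (h' j x c' : ℂ)) := fun j => by
    have h1 := WienerLE.sum hρ fun i => WienerLE.mul hρ (hp j i) (WienerLE.const ρ (c' i : ℂ))
    refine (h1.mono ?_).congr fun x => by rw [hexpand j x c']; push_cast; rfl
    calc ∑ i, q * ‖(c' i : ℂ)‖ ≤ ∑ _i : Fin (m + 1), q * (2 * ε) := by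
          refine Finset.sum_le_sum fun i _ => mul_le_mul_of_nonneg_left ?_ hq0
          simpa using hc'n i
      _ = _ := by simp; ring
  have hu₀ : ∀ j, WienerLE ρ (ε * (18 * (m + 1) * q + Real.exp (-δ * N)))
      (fun x => ((g (x + hv x) j - g x j + g₂ j x - h' j x c' : ℝ) : ℂ)) := fun j => by
    have h1 := WienerLE.sub hρ (WienerLE.add hρ (hcomp j) (hg₂ j)) (hDc j)
    refine (h1.mono ?_).congr fun x => by push_cast; rfl
    nlinarith [mul_nonneg (mul_nonneg hm0 hq0) hε]
  obtain ⟨u, hu, hueq⟩ := exists_neumann hρ hp hqm hu₀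
  have hconj : ∀ x, (ω + c' + fun j => u j x) + hv' x (ω + c' + fun j => u j x) =
      ω + c + g (x + hv x) := fun x => by
    funext j
    have h1 := hueq j x
    rw [← hexpand j x (fun i => u i x)] at h1
    have h2 : hv' x (ω + c' + fun j => u j x) j =
        h' j x ω + h' j x c' + h' j x (fun j => u j x) := by
      change h' j x (ω + c' + fun j => u j x) = _
      rw [map_add, map_add]
    rw [Pi.add_apply, h2, hω]
    simp only [Pi.add_apply, hc']
    have h3 := hsplit j x
    linarith
  refine ⟨hv, hv', c', fun x j => u j x, hh, hvd, hvn, hconj, fun j => ?_, ?_⟩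
  · exact (hu j).mono (le_of_eq (by ring))
  · refine hrot.of_conj hvd hvn (B := Real.exp L * ε) (fun x => ?_) hconj
    refine (pi_norm_le_iff_of_nonneg (by positivity)).2 fun j => ?_
    simpa using WienerLE.norm_le hρδ (hh j) x

end

section

/-! ### Convergence of the iteration -/

variable {m : ℕ}

theorem exists_hasFDerivAt_pi {ρ C : ℝ} (hρ : 0 < ρ) {f : (Fin (m + 1) → ℝ) → Fin (m + 1) → ℝ}
    (hf : ∀ j, WienerLE ρ C (fun x => (f x j : ℂ))) :
    ∃ f' : (Fin (m + 1) → ℝ) → (Fin (m + 1) → ℝ) →L[ℝ] (Fin (m + 1) → ℝ),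
      (∀ x, HasFDerivAt f (f' x) x) ∧ ∀ x, ‖f' x‖ ≤ 2 * Real.pi / ρ * C := by
  choose g' hg hb using fun j => (hf j).exists_hasFDerivAt hρ
  have hC : 0 ≤ C := (hf 0).nonneg
  have hpi := Real.pi_pos
  refine ⟨fun x => ContinuousLinearMap.pi fun j => Complex.reCLM.comp (g' j x), fun x => ?_,
    fun x => ?_⟩
  · exact hasFDerivAt_pi.2 fun j => Complex.reCLM.hasFDerivAt.comp x (hg j x)
  · refine ContinuousLinearMap.opNorm_le_bound _ (by positivity) fun v => ?_
    refine (pi_norm_le_iff_of_nonneg (by positivity)).2 fun j => ?_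
    change ‖(g' j x v).re‖ ≤ _
    exact (Complex.abs_re_le_norm _).trans (((g' j x).le_opNorm v).trans (by gcongr; exact hb j x))

theorem exists_seq_of_step {α : Type*} {P : ℕ → α → Prop} {R : ℕ → α → α → Prop} {a : α}
    (h0 : P 0 a) (hs : ∀ n s, P n s → ∃ s', P (n + 1) s' ∧ R n s s') :
    ∃ s : ℕ → α, s 0 = a ∧ (∀ n, P n (s n)) ∧ ∀ n, R n (s n) (s (n + 1)) := by
  choose F hF hR using hs
  let f : (n : ℕ) → {s // P n s} := fun n =>
    Nat.rec ⟨a, h0⟩ (fun n s => ⟨F n s.1 s.2, hF n s.1 s.2⟩) n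
  exact ⟨fun n => (f n).1, rfl, fun n => (f n).2, fun n => hR n _ _⟩

/-- If strip widths, truncations, divisor bounds and sizes are related as one Newton step requires,
the composed changes of variables converge to `id + H` conjugating the field to `ω`. -/
theorem exists_conjugacy_of_scales {ω c : Fin (m + 1) → ℝ}
    {g : (Fin (m + 1) → ℝ) → Fin (m + 1) → ℝ} {r η : ℝ} {ρ δ N L ε : ℕ → ℝ} (hr : 0 < r)
    (hη : 34 * η ≤ 1) (hρr : ∀ n, r ≤ ρ n) (hρ : ∀ n, ρ n = ρ (n + 1) + δ n) (hδ : ∀ n, 0 < δ n)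
    (hN : ∀ n, 1 ≤ N n) (hL : ∀ n, 0 ≤ L n) (hδN : ∀ n, 1 ≤ δ n * N n)
    (hdiv : ∀ n, ∀ k : Fin (m + 1) → ℤ, k ≠ 0 → l1 k ≤ N n → Real.exp (-L n) ≤ |dotZ k ω|)
    (hq : ∀ n, 16 * (m + 1) * (N n * Real.exp (L n) * ε n) ≤ 1)
    (hqη : ∀ n, N n * Real.exp (L n) * ε n ≤ η * (1 / 2) ^ n)
    (hε : ∀ n, ε n * (36 * (m + 1) * (N n * Real.exp (L n) * ε n) +
      2 * Real.exp (-δ n * N n)) ≤ ε (n + 1))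
    (hg : ∀ j, WienerLE (ρ 0) (ε 0) (fun x => (g x j : ℂ)))
    (hrot : HasRot (fun x => ω + c + g x) ω) :
    ∃ (H : (Fin (m + 1) → ℝ) → Fin (m + 1) → ℝ)
      (H' : (Fin (m + 1) → ℝ) → (Fin (m + 1) → ℝ) →L[ℝ] (Fin (m + 1) → ℝ)),
      (∀ j, WienerLE r (34 * η) (fun x => (H x j : ℂ))) ∧ (∀ x, HasFDerivAt H (H' x) x) ∧
      ∀ x, ω + c + g (x + H x) = ω + H' x ω := by
  set X : (Fin (m + 1) → ℝ) → Fin (m + 1) → ℝ := fun x => ω + c + g x with hX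
  have hρ0 : ∀ n, 0 < ρ n := fun n => hr.trans_le (hρr n)
  have hXc : Continuous X := by
    obtain ⟨g', hg', -⟩ := exists_hasFDerivAt_pi (hρ0 0) hg
    exact continuous_const.add (continuous_iff_continuousAt.2 fun x => (hg' x).continuousAt)
  have hη0 : 0 ≤ η := by
    have h1 : 0 ≤ N 0 * Real.exp (L 0) * ε 0 :=
      mul_nonneg (mul_nonneg (by linarith [hN 0]) (Real.exp_pos _).le) (hg 0).nonneg
    have h2 := hqη 0
    rw [pow_zero, mul_one] at h2
    linarith
  have hsum : ∀ n, ∑ i ∈ Finset.range n, 17 * η * (1 / 2 : ℝ) ^ i ≤ 34 * η := fun n => by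
    rw [← Finset.mul_sum]
    have h1 := Summable.sum_le_tsum (Finset.range n) (fun i _ => by positivity)
      summable_geometric_two
    rw [tsum_geometric_two] at h1
    nlinarith
  -- a state consists of the constant and variable parts of the conjugated field, and of the
  -- displacement of the conjugacy with its derivative
  obtain ⟨s, hs0, hP, hR⟩ := exists_seq_of_step
    (α := (Fin (m + 1) → ℝ) × ((Fin (m + 1) → ℝ) → Fin (m + 1) → ℝ) ×
      ((Fin (m + 1) → ℝ) → Fin (m + 1) → ℝ) ×
      ((Fin (m + 1) → ℝ) → (Fin (m + 1) → ℝ) →L[ℝ] (Fin (m + 1) → ℝ)))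
    (P := fun n s => (∀ j, WienerLE (ρ n) (ε n) (fun x => (s.2.1 x j : ℂ))) ∧
      HasRot (fun x => ω + s.1 + s.2.1 x) ω ∧
      (∀ j, WienerLE (ρ n) (∑ i ∈ Finset.range n, 17 * η * (1 / 2 : ℝ) ^ i)
        (fun x => (s.2.2.1 x j : ℂ))) ∧
      (∀ x, HasFDerivAt s.2.2.1 (s.2.2.2 x) x) ∧
      ∀ x, X (x + s.2.2.1 x) = (ω + s.1 + s.2.1 x) + s.2.2.2 x (ω + s.1 + s.2.1 x))
    (R := fun n s s' => ∀ j, WienerLE (ρ (n + 1)) (17 * η * (1 / 2 : ℝ) ^ n)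
      (fun x => (s'.2.2.1 x j - s.2.2.1 x j : ℂ)))
    (a := (c, g, fun _ => 0, fun _ => 0))
    ⟨hg, hrot, fun j => by simpa using WienerLE.const (m := m) (ρ 0) 0,
      fun x => hasFDerivAt_const _ _, fun x => by simp [hX]⟩ (by
    rintro n ⟨c, g, H, H'⟩ ⟨hg, hrot, hH, hH', hconj⟩
    simp only at hg hrot hH hH' hconj
    have hρn : ρ n = ρ (n + 1) + δ n := hρ n
    rw [hρn] at hg hH
    have hρ1 := (hρ0 (n + 1)).le
    have hε0 : 0 ≤ ε n := (hg 0).nonneg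
    obtain ⟨h, h', c', g', h1, h2, h3, h4, h5, h6⟩ :=
      exists_newton_step hρ1 (hδ n) (hN n) (hδN n) (hdiv n) hg hrot (hq n)
    set q := N n * Real.exp (L n) * ε n with hqdef
    have he0 : 0 ≤ Real.exp (L n) * ε n := by positivity
    have heq : Real.exp (L n) * ε n ≤ q := by
      rw [hqdef, mul_assoc]; exact le_mul_of_one_le_left he0 (hN n)
    have heδ : 4 * Real.pi * (Real.exp (L n) * ε n) ≤ 16 * q * δ n := by
      have e1 : Real.exp (L n) * ε n ≤ (Real.exp (L n) * ε n) * (δ n * N n) :=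
        le_mul_of_one_le_right he0 (hδN n)
      have e2 : (Real.exp (L n) * ε n) * (δ n * N n) = q * δ n := by rw [hqdef]; ring
      nlinarith [Real.pi_lt_four]
    have hq16 : 16 * q ≤ 1 := by
      have := hq n
      have hm0 : (0 : ℝ) ≤ m := Nat.cast_nonneg m
      have hq0 : 0 ≤ q := he0.trans heq
      nlinarith [mul_nonneg hm0 hq0]
    -- composing `id + H` with `id + h` changes `H` by `h + (H ∘ (id + h) - H)`, of size at most
    -- `q + 16 q`
    have hdiff : ∀ j, WienerLE (ρ (n + 1)) (17 * η * (1 / 2 : ℝ) ^ n)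
        (fun x => ((h x j + H (x + h x) j : ℝ) - H x j : ℂ)) := fun j => by
      have e1 := WienerLE.comp_sub hρ1 (hδ n) (fun i => (h1 i).mono_strip (by linarith [hδ n]))
        (by nlinarith [hδ n]) (hH j)
      have e2 := WienerLE.add hρ1 ((h1 j).mono_strip (by linarith [hδ n])) e1
      refine (e2.mono ?_).congr fun x => by push_cast; ring
      have e3 : 4 * Real.pi * (Real.exp (L n) * ε n) / δ n ≤ 16 * q := by
        rw [div_le_iff₀ (hδ n)]; exact heδ
      have e4 : ∑ i ∈ Finset.range n, 17 * η * (1 / 2 : ℝ) ^ i ≤ 1 := (hsum n).trans hη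
      have e5 := mul_le_mul e3 e4 (hH j).nonneg (by linarith)
      have e6 := hqη n
      linarith
    refine ⟨(c', g', fun x => h x + H (x + h x),
      fun x => h' x + (H' (x + h x)).comp (ContinuousLinearMap.id ℝ _ + h' x)),
      ⟨fun j => (h5 j).mono (hε n), h6, fun j => ?_, fun x => ?_, fun x => ?_⟩, hdiff⟩
    · have e1 := WienerLE.add hρ1 ((hH j).mono_strip (by linarith [hδ n])) (hdiff j)
      rw [← Finset.sum_range_succ] at e1
      refine e1.congr fun x => ?_
      simp
    · exact (h2 x).add ((hH' (x + h x)).comp x ((hasFDerivAt_id x).add (h2 x)))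
    · change X (x + (h x + H (x + h x))) = (ω + c' + g' x) + (h' x (ω + c' + g' x) +
        H' (x + h x) ((ω + c' + g' x) + h' x (ω + c' + g' x)))
      rw [← add_assoc, hconj, h4, ← add_assoc, h4])
  set H : ℕ → (Fin (m + 1) → ℝ) → Fin (m + 1) → ℝ := fun n => (s n).2.2.1 with hHdef
  have hH0 : ∀ x j, H 0 x j = 0 := fun x j => by simp [hHdef, hs0]
  have hD : ∀ n j, WienerLE r (17 * η * (1 / 2 : ℝ) ^ n)
      (fun x => ((H (n + 1) x j - H n x j : ℝ) : ℂ)) := fun n j =>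
    ((hR n j).mono_strip (hρr _)).congr fun x => by push_cast; rfl
  have hgeo : ∀ n, HasSum (fun i : ℕ => 17 * η * (1 / 2 : ℝ) ^ (i + n)) (34 * η * (1 / 2) ^ n) := by
    intro n
    have := hasSum_geometric_two.mul_left (17 * η * (1 / 2) ^ n)
    convert! this using 1
    · funext i; rw [pow_add]; ring
    · ring
  have hDs : ∀ x j, Summable fun n => H (n + 1) x j - H n x j := fun x j => by
    have h1 : Summable fun i : ℕ => 17 * η * (1 / 2 : ℝ) ^ i := by simpa using (hgeo 0).summable
    refine Summable.of_norm_bounded h1 fun n => ?_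
    simpa only [Complex.norm_real] using WienerLE.norm_le hr.le (hD n j) x
  set Hl : (Fin (m + 1) → ℝ) → Fin (m + 1) → ℝ := fun x j => ∑' n, (H (n + 1) x j - H n x j)
    with hHl
  have htail : ∀ n x j, HasSum (fun i => H (i + n + 1) x j - H (i + n) x j)
      (Hl x j - H n x j) := fun n x j => by
    have h1 := (hasSum_nat_add_iff' n).2 (hDs x j).hasSum
    rw [Finset.sum_range_sub (fun i => H i x j), hH0, sub_zero] at h1
    exact h1
  have hdist : ∀ n j, WienerLE r (34 * η * (1 / 2) ^ n)
      (fun x => (((Hl x - H n x) j : ℝ) : ℂ)) := fun n j =>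
    WienerLE.hasSum hr.le (fun i => hD (i + n) j) (hgeo n)
      fun x => Complex.hasSum_ofReal.2 (htail n x j)
  have hHlW : ∀ j, WienerLE r (34 * η) (fun x => (Hl x j : ℂ)) := fun j => by
    have := (hdist 0 j).congr (g := fun x => (Hl x j : ℂ)) fun x => by
      rw [Pi.sub_apply, hH0, sub_zero]
    simpa using this
  obtain ⟨Hl', hHl', -⟩ := exists_hasFDerivAt_pi hr hHlW
  refine ⟨Hl, Hl', hHlW, hHl', fun x => ?_⟩
  have hpow : Tendsto (fun n : ℕ => (1 / 2 : ℝ) ^ n) atTop (𝓝 0) :=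
    tendsto_pow_atTop_nhds_zero_of_lt_one (by norm_num) (by norm_num)
  have hHn : Tendsto (fun n => H n x) atTop (𝓝 (Hl x)) := by
    rw [tendsto_iff_norm_sub_tendsto_zero]
    refine squeeze_zero (fun _ => norm_nonneg _) (g := fun n => 34 * η * (1 / 2) ^ n)
      (fun n => ?_) (by simpa using hpow.const_mul (34 * η))
    rw [norm_sub_rev]
    refine (pi_norm_le_iff_of_nonneg (by positivity)).2 fun j => ?_
    simpa only [Complex.norm_real] using WienerLE.norm_le hr.le (hdist n j) x
  have hH'n : Tendsto (fun n => (s n).2.2.2 x) atTop (𝓝 (Hl' x)) := by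
    rw [tendsto_iff_norm_sub_tendsto_zero]
    refine squeeze_zero (fun _ => norm_nonneg _)
      (g := fun n => 2 * Real.pi / r * (34 * η * (1 / 2) ^ n))
      (fun n => ?_) (by simpa using (hpow.const_mul (34 * η)).const_mul (2 * Real.pi / r))
    obtain ⟨F, hF, hFb⟩ := exists_hasFDerivAt_pi hr (hdist n)
    have h1 := (hF x).unique ((hHl' x).sub ((hP n).2.2.2.1 x))
    rw [norm_sub_rev, ← h1]
    exact hFb x
  have hεs : ∀ n, ε n ≤ η * (1 / 2) ^ n := fun n => by
    have h1 : 0 ≤ ε n := ((hP n).1 0).nonneg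
    refine le_trans ?_ (hqη n)
    rw [mul_assoc]
    refine (le_mul_of_one_le_left h1 (Real.one_le_exp (hL n))).trans ?_
    exact le_mul_of_one_le_left (by positivity) (hN n)
  have hε0 : Tendsto ε atTop (𝓝 0) :=
    squeeze_zero (fun n => ((hP n).1 0).nonneg) hεs (by simpa using hpow.const_mul η)
  have hgn : ∀ n y, ‖(s n).2.1 y‖ ≤ ε n := fun n y =>
    (pi_norm_le_iff_of_nonneg ((hP n).1 0).nonneg).2 fun j => by
      simpa only [Complex.norm_real] using WienerLE.norm_le (hρ0 n).le ((hP n).1 j) y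
  have hY : Tendsto (fun n => ω + (s n).1 + (s n).2.1 x) atTop (𝓝 ω) := by
    have h1 : Tendsto (fun n => (s n).1) atTop (𝓝 0) :=
      squeeze_zero_norm (fun n => (hP n).2.1.norm_const_le (hgn n)) hε0
    have h2 : Tendsto (fun n => (s n).2.1 x) atTop (𝓝 0) :=
      squeeze_zero_norm (fun n => hgn n x) hε0
    simpa using (h1.const_add ω).add h2
  -- both sides of `X ∘ (id + H_n) = (1 + DH_n) (ω + c_n + g_n)` converge, and `c_n, g_n → 0`
  have hlim1 : Tendsto (fun n => X (x + H n x)) atTop (𝓝 (X (x + Hl x))) :=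
    (hXc.tendsto _).comp (hHn.const_add x)
  have hlim2 : Tendsto (fun n => X (x + H n x)) atTop (𝓝 (ω + Hl' x ω)) := by
    have h1 := hY.add ((isBoundedBilinearMap_apply.continuous.tendsto (Hl' x, ω)).comp
      (hH'n.prodMk_nhds hY))
    exact h1.congr fun n => ((hP n).2.2.2.2 x).symm
  exact tendsto_nhds_unique hlim1 hlim2

/-! ### Brjuno vectors -/

/-- The Brjuno condition, with the small divisors measured at the scales `(3/2)^i`. -/
def IsBrjuno (ω : Fin (m + 1) → ℝ) : Prop :=
  ∃ L : ℕ → ℝ, (∀ i, 0 ≤ L i) ∧ Summable (fun i => (2 / 3 : ℝ) ^ i * L i) ∧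
    ∀ i, ∀ k : Fin (m + 1) → ℤ, k ≠ 0 → l1 k ≤ (3 / 2 : ℝ) ^ i → Real.exp (-L i) ≤ |dotZ k ω|

/-- The solution `E_i = ∑ 2⁻ʲ A_{i+j}` of `2 E_i - E_{i+1} = 2 A_i` inherits the summability of `A`,
because the ratio `3/2` of the scales is smaller than the exponent `2` of Newton's method. -/
theorem exists_newton_exponents {A : ℕ → ℝ} (hA : ∀ i, 0 ≤ A i)
    (hs : Summable fun i => (2 / 3 : ℝ) ^ i * A i) :
    ∃ E : ℕ → ℝ, (∀ i, E i = A i + E (i + 1) / 2) ∧ (∀ i, 0 ≤ E i) ∧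
      Summable fun i => (2 / 3 : ℝ) ^ i * E i := by
  obtain ⟨a, ha⟩ : ∃ a : ℕ → ℝ, ∀ i, a i = (2 / 3 : ℝ) ^ i * A i := ⟨_, fun _ => rfl⟩
  have ha0 : ∀ i, 0 ≤ a i := fun i => ha i ▸ mul_nonneg (by positivity) (hA i)
  replace hs : Summable a := hs.congr fun i => (ha i).symm
  have h1 : Summable fun p : ℕ × ℕ => (3 / 4 : ℝ) ^ p.1 * a (p.2 + p.1) := by
    rw [summable_prod_of_nonneg fun p => mul_nonneg (by positivity) (ha0 _)]
    have hsj : ∀ j, Summable fun i => a (i + j) := fun j => (summable_nat_add_iff j).2 hs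
    refine ⟨fun j => (hsj j).mul_left ((3 / 4 : ℝ) ^ j), ?_⟩
    have hle : ∀ j, ∑' i, (3 / 4 : ℝ) ^ j * a (i + j) ≤ (3 / 4 : ℝ) ^ j * ∑' i, a i := fun j => by
      rw [tsum_mul_left]
      refine mul_le_mul_of_nonneg_left ?_ (by positivity)
      rw [← hs.sum_add_tsum_nat_add j]
      exact le_add_of_nonneg_left (Finset.sum_nonneg fun i _ => ha0 i)
    exact Summable.of_nonneg_of_le
      (fun j => tsum_nonneg fun i => mul_nonneg (by positivity) (ha0 _)) hle
      ((summable_geometric_of_lt_one (by norm_num) (by norm_num)).mul_right _)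
  have h2 : Summable fun p : ℕ × ℕ => (3 / 4 : ℝ) ^ p.2 * a (p.1 + p.2) :=
    (Equiv.prodComm ℕ ℕ).summable_iff.1 h1
  have hterm : ∀ i j, (3 / 4 : ℝ) ^ j * a (i + j) = (2 / 3) ^ i * ((1 / 2) ^ j * A (i + j)) := by
    intro i j
    have : (3 / 4 : ℝ) ^ j * (2 / 3) ^ j = (1 / 2) ^ j := by rw [← mul_pow]; norm_num
    rw [← this]
    simp only [ha, pow_add]; ring
  have hj : ∀ i, Summable fun j => (1 / 2 : ℝ) ^ j * A (i + j) := fun i => by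
    have h3 := h2.prod_factor i
    simp only [hterm] at h3
    exact (summable_mul_left_iff (by positivity)).1 h3
  refine ⟨fun i => ∑' j, (1 / 2 : ℝ) ^ j * A (i + j), fun i => ?_,
    fun i => tsum_nonneg fun j => mul_nonneg (by positivity) (hA _), ?_⟩
  · simp only
    rw [(hj i).tsum_eq_zero_add, pow_zero, one_mul, add_zero, ← tsum_div_const]
    congr 1
    refine tsum_congr fun j => ?_
    rw [pow_succ, show i + (j + 1) = i + 1 + j by ring]; ring
  · have h3 := h2.prod
    simp only [hterm, tsum_mul_left] at h3
    exact h3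

/-- Conjugacy to `ω` of the fields with rotation vector `ω` that are close to constant. -/
theorem IsBrjuno.exists_conjugacy {ω : Fin (m + 1) → ℝ} (hω : IsBrjuno ω) {r η : ℝ} (hr : 0 < r)
    (hη : 0 < η) : ∃ ε : ℝ, 0 < ε ∧ ∀ (c : Fin (m + 1) → ℝ)
      (g : (Fin (m + 1) → ℝ) → Fin (m + 1) → ℝ),
      (∀ j, WienerLE r ε (fun x => (g x j : ℂ))) → HasRot (fun x => ω + c + g x) ω →
      ∃ (H : (Fin (m + 1) → ℝ) → Fin (m + 1) → ℝ)
        (H' : (Fin (m + 1) → ℝ) → (Fin (m + 1) → ℝ) →L[ℝ] (Fin (m + 1) → ℝ)),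
        (∀ j, WienerLE (r / 2) η (fun x => (H x j : ℂ))) ∧ (∀ x, HasFDerivAt H (H' x) x) ∧
        ∀ x, ω + c + g (x + H x) = ω + H' x ω := by
  obtain ⟨L, hL, hLs, hdiv⟩ := hω
  have hm0 : (0 : ℝ) ≤ m := Nat.cast_nonneg m
  -- `κ = e^{-Λ}` bounds the products `N e^L ε` at all steps
  obtain ⟨κ, hκ, hκm, hκη, hκ1⟩ : ∃ κ : ℝ, 0 < κ ∧ 72 * (m + 1) * κ ≤ 1 ∧ 34 * κ ≤ η ∧ κ ≤ 1 := by
    refine ⟨min (1 / (72 * (m + 1))) (η / 34), lt_min (by positivity) (by positivity), ?_, ?_, ?_⟩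
    · have := min_le_left (1 / (72 * (m + 1) : ℝ)) (η / 34)
      rwa [le_div_iff₀ (by positivity), mul_comm] at this
    · have := min_le_right (1 / (72 * (m + 1) : ℝ)) (η / 34)
      linarith
    · refine (min_le_left _ _).trans ?_
      rw [div_le_one (by positivity)]; linarith
  set Λ := -Real.log κ with hΛ
  have hΛ0 : 0 ≤ Λ := by rw [hΛ]; linarith [Real.log_nonpos hκ.le hκ1]
  have hexpΛ : Real.exp (-Λ) = κ := by rw [hΛ, neg_neg, Real.exp_log hκ]
  set A : ℕ → ℝ := fun i => L i + 2 * i + Λ with hAdef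
  have hA : ∀ i, 0 ≤ A i := fun i => by have := hL i; simp only [hAdef]; positivity
  have hAs : Summable fun i => (2 / 3 : ℝ) ^ i * A i := by
    have h1 : Summable fun i : ℕ => (i : ℝ) * (2 / 3 : ℝ) ^ i := by
      simpa using summable_pow_mul_geometric_of_norm_lt_one 1 (r := (2 / 3 : ℝ))
        (by rw [Real.norm_of_nonneg] <;> norm_num)
    have h2 : Summable fun i : ℕ => (2 / 3 : ℝ) ^ i :=
      summable_geometric_of_lt_one (by norm_num) (by norm_num)
    refine ((hLs.add (h1.mul_left 2)).add (h2.mul_right Λ)).congr fun i => ?_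
    simp only [hAdef]; ring
  -- with `ε_i = e^{-E_i}` the Newton estimate `ε_{i+1} ≥ C N_i e^{L_i} ε_i²` becomes
  -- `2 E_i - E_{i+1} = 2 A_i`; the slack `2i` in `A_i` absorbs the truncation level `N_i = (3/2)^i`
  obtain ⟨E, hE, hE0, hEs⟩ := exists_newton_exponents hA hAs
  -- the loss of analyticity for which the truncation error `e^{-δ_i N_i}` is at most `ε_{i+1} / 4`
  set δ : ℕ → ℝ := fun i => (E (i + 1) + 2) * (2 / 3) ^ i with hδdef
  have hδ0 : ∀ i, 0 < δ i := fun i => by have := hE0 (i + 1); simp only [hδdef]; positivity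
  have hδs : Summable δ := by
    have h1 := ((summable_nat_add_iff 1).2 hEs).mul_left (3 / 2)
    have h2 : Summable fun i : ℕ => (2 / 3 : ℝ) ^ i :=
      summable_geometric_of_lt_one (by norm_num) (by norm_num)
    refine (h1.add (h2.mul_left 2)).congr fun i => ?_
    simp only [hδdef, pow_succ]; ring
  -- starting at the scale `i₀` the total loss of analyticity is at most `r / 2`
  obtain ⟨i₀, hi₀⟩ : ∃ i₀ : ℕ, ∑' j, δ (j + i₀) ≤ r / 2 := by
    have h1 := tendsto_sum_nat_add δ
    exact ((tendsto_order.1 h1).2 (r / 2) (by linarith)).exists.imp fun i hi => hi.le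
  have hNδ : ∀ i, δ i * (3 / 2 : ℝ) ^ i = E (i + 1) + 2 := fun i => by
    simp only [hδdef]
    rw [mul_assoc, ← mul_pow]; norm_num
  have hexp2 : (4 : ℝ) ≤ Real.exp 2 := by
    have h1 := Real.add_one_le_exp (1 : ℝ)
    have h2 : Real.exp 2 = Real.exp 1 * Real.exp 1 := by rw [← Real.exp_add]; norm_num
    rw [h2]; nlinarith
  have hNA : ∀ i, (3 / 2 : ℝ) ^ i * Real.exp (L i) * Real.exp (-A i) ≤ κ * (1 / 2) ^ i := by
    intro i
    have h1 : Real.exp (L i) * Real.exp (-A i) = κ * Real.exp (-2) ^ i := by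
      rw [← Real.exp_nat_mul, ← hexpΛ, ← Real.exp_add, ← Real.exp_add]
      congr 1; simp only [hAdef]; ring
    rw [mul_assoc, h1, mul_left_comm, ← mul_pow]
    have h2 : Real.exp (-2) ≤ 1 / 4 := by
      rw [Real.exp_neg, one_div]; exact inv_anti₀ (by norm_num) hexp2
    gcongr
    linarith
  have hEA : ∀ i, Real.exp (-E i) ≤ Real.exp (-A i) := fun i =>
    Real.exp_le_exp.2 (by linarith [hE i, hE0 (i + 1)])
  have hq : ∀ i, (3 / 2 : ℝ) ^ i * Real.exp (L i) * Real.exp (-E i) ≤ κ * (1 / 2) ^ i := fun i =>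
    (mul_le_mul_of_nonneg_left (hEA i) (by positivity)).trans (hNA i)
  have hhalf : ∀ i : ℕ, (1 / 2 : ℝ) ^ i ≤ 1 := fun i => pow_le_one₀ (by norm_num) (by norm_num)
  refine ⟨Real.exp (-E i₀), Real.exp_pos _, fun c g hg hrot => ?_⟩
  suffices hmain : ∃ (H : (Fin (m + 1) → ℝ) → Fin (m + 1) → ℝ)
      (H' : (Fin (m + 1) → ℝ) → (Fin (m + 1) → ℝ) →L[ℝ] (Fin (m + 1) → ℝ)),
      (∀ j, WienerLE (r / 2) (34 * κ) (fun x => (H x j : ℂ))) ∧ (∀ x, HasFDerivAt H (H' x) x) ∧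
      ∀ x, ω + c + g (x + H x) = ω + H' x ω by
    obtain ⟨H, H', h1, h2, h3⟩ := hmain
    exact ⟨H, H', fun j => (h1 j).mono hκη, h2, h3⟩
  refine exists_conjugacy_of_scales (ω := ω) (c := c) (g := g) (r := r / 2)
    (η := κ) (ρ := fun n => r / 2 + ∑' j, δ (j + (n + i₀))) (δ := fun n => δ (n + i₀))
    (N := fun n => (3 / 2 : ℝ) ^ (n + i₀)) (L := fun n => L (n + i₀))
    (ε := fun n => Real.exp (-E (n + i₀))) (by linarith) (by nlinarith)
    (fun n => le_add_of_nonneg_right (tsum_nonneg fun j => (hδ0 _).le)) (fun n => ?_)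
    (fun n => hδ0 _) (fun n => one_le_pow₀ (by norm_num)) (fun n => hL _) (fun n => ?_)
    (fun n k hk hkN => hdiv _ k hk hkN) (fun n => ?_) (fun n => ?_) (fun n => ?_) ?_ hrot
  · have h1 := ((summable_nat_add_iff (n + i₀)).2 hδs).tsum_eq_zero_add
    simp only [zero_add] at h1
    rw [h1, add_assoc, add_comm (δ (n + i₀))]
    simp only [add_assoc, add_left_comm 1]
  · rw [hNδ]; linarith [hE0 (n + i₀ + 1)]
  · have h1 := hq (n + i₀)
    have h2 := hhalf (n + i₀)
    calc _ ≤ 16 * (m + 1) * (κ * (1 / 2) ^ (n + i₀)) := by gcongr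
      _ ≤ 16 * (m + 1) * (κ * 1) := by gcongr
      _ ≤ 1 := by nlinarith
  · refine (hq (n + i₀)).trans ?_
    rw [pow_add]
    have h2 := hhalf i₀
    gcongr
    exact mul_le_of_le_one_right (by positivity) h2
  · set i := n + i₀
    have e0 : n + 1 + i₀ = i + 1 := by omega
    rw [e0, neg_mul, hNδ]
    have e1 : Real.exp (-E i) * Real.exp (-E i) =
        Real.exp (-A i) * Real.exp (-A i) * Real.exp (-E (i + 1)) := by
      rw [← Real.exp_add, ← Real.exp_add, ← Real.exp_add]
      congr 1; linarith [hE i]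
    have e2 : Real.exp (-A i) ≤ 1 := Real.exp_le_one_iff.2 (by linarith [hA i])
    have e3 : Real.exp (-E i) ≤ 1 := Real.exp_le_one_iff.2 (by linarith [hE0 i])
    have e4 : Real.exp (-(E (i + 1) + 2)) = Real.exp (-E (i + 1)) * Real.exp (-2) := by
      rw [← Real.exp_add]; congr 1; ring
    have e5 : Real.exp (-2) ≤ 1 / 4 := by
      rw [Real.exp_neg, one_div]; exact inv_anti₀ (by norm_num) hexp2
    have e6 : (3 / 2 : ℝ) ^ i * Real.exp (L i) * Real.exp (-A i) ≤ κ * 1 :=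
      (hNA i).trans (mul_le_mul_of_nonneg_left (hhalf i) hκ.le)
    set x := Real.exp (-E (i + 1))
    have hx : 0 < x := Real.exp_pos _
    calc _ = 36 * (m + 1) * ((3 / 2 : ℝ) ^ i * Real.exp (L i)) *
          (Real.exp (-E i) * Real.exp (-E i)) +
          2 * Real.exp (-E i) * (x * Real.exp (-2)) := by rw [e4]; ring
      _ = 36 * (m + 1) * ((3 / 2 : ℝ) ^ i * Real.exp (L i) * Real.exp (-A i)) *
          Real.exp (-A i) * x + 2 * Real.exp (-E i) * (x * Real.exp (-2)) := by rw [e1]; ring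
      _ ≤ 36 * (m + 1) * (κ * 1) * 1 * x + 2 * 1 * (x * (1 / 4)) := by
          gcongr ?_ + ?_
          · refine mul_le_mul_of_nonneg_right ?_ hx.le
            exact mul_le_mul (mul_le_mul_of_nonneg_left e6 (by positivity)) e2
              (Real.exp_pos _).le (by positivity)
          · gcongr
      _ ≤ x := by nlinarith
  · simp only [zero_add]
    exact fun j => (hg j).mono_strip (by linarith)

end

section

/-! ### Unimodular matrices acting on vectors and on frequencies -/

variable {m : ℕ}

theorem act_mul {𝕜 : Type*} [CommRing 𝕜] (S T : SL(m + 1, ℤ)) (x : Fin (m + 1) → 𝕜) :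
    act (S * T) x = act S (act T x) := by
  have h : ((S * T : SL(m + 1, ℤ)) : Matrix (Fin (m + 1)) (Fin (m + 1)) ℤ).map
      (Int.cast : ℤ → 𝕜) =
      (S : Matrix (Fin (m + 1)) (Fin (m + 1)) ℤ).map (Int.cast : ℤ → 𝕜) *
      (T : Matrix (Fin (m + 1)) (Fin (m + 1)) ℤ).map (Int.cast : ℤ → 𝕜) := by
    rw [Matrix.SpecialLinearGroup.coe_mul]
    exact Matrix.map_mul (f := Int.castRingHom 𝕜)
  rw [act, act, act, Matrix.mulVec_mulVec, h]

theorem act_one {𝕜 : Type*} [Ring 𝕜] (x : Fin (m + 1) → 𝕜) : act (1 : SL(m + 1, ℤ)) x = x := by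
  simp [act]

theorem act_smul {𝕜 : Type*} [CommRing 𝕜] (T : SL(m + 1, ℤ)) (a : 𝕜) (x : Fin (m + 1) → 𝕜) :
    act T (a • x) = a • act T x := Matrix.mulVec_smul _ _ _

theorem act_apply {𝕜 : Type*} [Ring 𝕜] (T : SL(m + 1, ℤ)) (x : Fin (m + 1) → 𝕜)
    (i : Fin (m + 1)) : act T x i = ∑ j, ((T i j : ℤ) : 𝕜) * x j := rfl

theorem invTranspose_apply (T : SL(m + 1, ℤ)) (k : Fin (m + 1) → ℤ) (i : Fin (m + 1)) :
    invTranspose T k i = ∑ j, (T⁻¹ : SL(m + 1, ℤ)) j i * k j := rfl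

theorem invTranspose_mul (S T : SL(m + 1, ℤ)) (k : Fin (m + 1) → ℤ) :
    invTranspose (S * T) k = invTranspose S (invTranspose T k) := by
  simp only [invTranspose, mul_inv_rev, Matrix.SpecialLinearGroup.coe_mul, Matrix.transpose_mul,
    Matrix.mulVec_mulVec]

theorem invTranspose_one (k : Fin (m + 1) → ℤ) : invTranspose 1 k = k := by
  simp [invTranspose]

theorem invTranspose_zero (T : SL(m + 1, ℤ)) : invTranspose T 0 = 0 := by
  simp [invTranspose]

theorem invTranspose_inv_apply (T : SL(m + 1, ℤ)) (k : Fin (m + 1) → ℤ) :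
    invTranspose T⁻¹ (invTranspose T k) = k := by
  rw [← invTranspose_mul, inv_mul_cancel, invTranspose_one]

theorem invTranspose_ne_zero {T : SL(m + 1, ℤ)} {k : Fin (m + 1) → ℤ} (hk : k ≠ 0) :
    invTranspose T k ≠ 0 := fun h => hk <| by
  rw [← invTranspose_inv_apply T k, h, invTranspose_zero]

theorem dotZ_act (T : SL(m + 1, ℤ)) (k : Fin (m + 1) → ℤ) (x : Fin (m + 1) → ℝ) :
    dotZ k (act T x) = dotZ (invTranspose T⁻¹ k) x := by
  simp only [dotZ, act_apply, invTranspose_apply, inv_inv, Finset.mul_sum]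
  rw [Finset.sum_comm]
  refine Finset.sum_congr rfl fun j _ => ?_
  rw [Int.cast_sum, Finset.sum_mul]
  refine Finset.sum_congr rfl fun i _ => ?_
  push_cast; ring

theorem dotZ_invTranspose_act (T : SL(m + 1, ℤ)) (k : Fin (m + 1) → ℤ) (x : Fin (m + 1) → ℝ) :
    dotZ (invTranspose T k) (act T x) = dotZ k x := by
  rw [dotZ_act, invTranspose_inv_apply]

theorem dotZ_smul_right (k : Fin (m + 1) → ℤ) (a : ℝ) (x : Fin (m + 1) → ℝ) :
    dotZ k (a • x) = a * dotZ k x := by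
  simp only [dotZ, Finset.mul_sum, Pi.smul_apply, smul_eq_mul]
  exact Finset.sum_congr rfl fun i _ => by ring

theorem l1_smul {n : ℕ} {𝕜 : Type*} [NormedField 𝕜] (a : 𝕜) (x : Fin n → 𝕜) :
    l1 (a • x) = ‖a‖ * l1 x := by
  simp [l1, Finset.mul_sum]

theorem one_le_l1 {n : ℕ} {k : Fin n → ℤ} (hk : k ≠ 0) : 1 ≤ l1 k := by
  obtain ⟨i, hi⟩ := Function.ne_iff.1 hk
  refine le_trans ?_ (norm_le_l1 k i)
  rw [Int.norm_eq_abs]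
  exact_mod_cast Int.one_le_abs hi

theorem matNorm_nonneg (T : SL(m + 1, ℤ)) : 0 ≤ matNorm T := norm_nonneg _

theorem l1_act_le_real (T : SL(m + 1, ℤ)) (x : Fin (m + 1) → ℝ) :
    l1 (act T x) ≤ matNorm T * l1 x := by
  have h := ContinuousLinearMap.le_opNorm (LinearMap.toContinuousLinearMap
    (Matrix.toLpLin 1 1 ((T : Matrix (Fin (m + 1)) (Fin (m + 1)) ℤ).map (Int.cast : ℤ → ℝ))))
    (WithLp.toLp 1 x)
  rw [PiLp.norm_eq_of_L1, PiLp.norm_eq_of_L1] at h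
  exact h

theorem matNorm_le_of_forall {T : SL(m + 1, ℤ)} {C : ℝ} (hC : 0 ≤ C)
    (h : ∀ x : Fin (m + 1) → ℝ, l1 (act T x) ≤ C * l1 x) : matNorm T ≤ C := by
  refine ContinuousLinearMap.opNorm_le_bound _ hC fun x => ?_
  rw [PiLp.norm_eq_of_L1, PiLp.norm_eq_of_L1]
  exact h (WithLp.ofLp x)

theorem matNorm_mul_le (S T : SL(m + 1, ℤ)) : matNorm (S * T) ≤ matNorm S * matNorm T :=
  matNorm_le_of_forall (mul_nonneg (matNorm_nonneg _) (matNorm_nonneg _)) fun x => by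
    rw [act_mul, mul_assoc]
    exact (l1_act_le_real S _).trans
      (mul_le_mul_of_nonneg_left (l1_act_le_real T x) (matNorm_nonneg _))

theorem matNorm_one_le : matNorm (1 : SL(m + 1, ℤ)) ≤ 1 :=
  matNorm_le_of_forall zero_le_one fun x => by rw [act_one, one_mul]

theorem sum_abs_col_le (T : SL(m + 1, ℤ)) (j : Fin (m + 1)) :
    ∑ i, |((T i j : ℤ) : ℝ)| ≤ matNorm T := by
  have h := l1_act_le_real T (Pi.single j 1)
  have h1 : l1 (Pi.single j 1 : Fin (m + 1) → ℝ) = 1 := by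
    rw [l1, Finset.sum_eq_single j] <;> simp +contextual
  rw [h1, mul_one] at h
  refine le_trans (le_of_eq ?_) h
  refine Finset.sum_congr rfl fun i _ => ?_
  simp [act_apply, Pi.single_apply]

theorem abs_entry_le (T : SL(m + 1, ℤ)) (i j : Fin (m + 1)) :
    |((T i j : ℤ) : ℝ)| ≤ matNorm T :=
  (Finset.single_le_sum (f := fun i => |((T i j : ℤ) : ℝ)|) (fun _ _ => abs_nonneg _)
    (Finset.mem_univ i)).trans (sum_abs_col_le T j)

theorem one_le_matNorm (T : SL(m + 1, ℤ)) : 1 ≤ matNorm T := by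
  have h : ∃ i, T i 0 ≠ 0 := by
    by_contra! h
    have h0 : (T : Matrix (Fin (m + 1)) (Fin (m + 1)) ℤ).det = 0 :=
      Matrix.det_eq_zero_of_column_eq_zero 0 h
    rw [T.det_coe] at h0
    exact one_ne_zero h0
  obtain ⟨i, hi⟩ := h
  refine le_trans ?_ (abs_entry_le T i 0)
  exact_mod_cast Int.one_le_abs hi

/-- The norm of a real matrix for the `ℓ¹` norm also bounds its action on complex vectors. -/
theorem l1_act_le {𝕜 : Type*} [RCLike 𝕜] (T : SL(m + 1, ℤ)) (x : Fin (m + 1) → 𝕜) :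
    l1 (act T x) ≤ matNorm T * l1 x := by
  calc l1 (act T x) ≤ ∑ i, ∑ j, |((T i j : ℤ) : ℝ)| * ‖x j‖ := by
        refine Finset.sum_le_sum fun i _ => ?_
        rw [act_apply]
        refine (norm_sum_le _ _).trans (Finset.sum_le_sum fun j _ => ?_)
        rw [norm_mul, ← RCLike.ofReal_intCast, RCLike.norm_ofReal]
    _ = ∑ j, (∑ i, |((T i j : ℤ) : ℝ)|) * ‖x j‖ := by
        rw [Finset.sum_comm]; simp only [Finset.sum_mul]
    _ ≤ ∑ j, matNorm T * ‖x j‖ := Finset.sum_le_sum fun j _ =>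
        mul_le_mul_of_nonneg_right (sum_abs_col_le T j) (norm_nonneg _)
    _ = _ := by rw [l1, Finset.mul_sum]

theorem l1_invTranspose_le (T : SL(m + 1, ℤ)) (k : Fin (m + 1) → ℤ) :
    l1 (invTranspose T k) ≤ (m + 1) * matNorm T⁻¹ * l1 k := by
  calc l1 (invTranspose T k) ≤ ∑ _i : Fin (m + 1), matNorm T⁻¹ * l1 k := by
        refine Finset.sum_le_sum fun i _ => ?_
        rw [invTranspose_apply, l1, Finset.mul_sum]
        refine (norm_sum_le _ _).trans (Finset.sum_le_sum fun j _ => ?_)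
        rw [norm_mul]
        refine mul_le_mul_of_nonneg_right ?_ (norm_nonneg _)
        rw [Int.norm_eq_abs]
        exact abs_entry_le _ _ _
    _ = _ := by simp [mul_assoc]

theorem l1_le_invTranspose (T : SL(m + 1, ℤ)) (k : Fin (m + 1) → ℤ) :
    l1 k ≤ (m + 1) * matNorm T * l1 (invTranspose T k) := by
  have h := l1_invTranspose_le T⁻¹ (invTranspose T k)
  rwa [invTranspose_inv_apply, inv_inv] at h

/-! ### Resonant cones along a continued fraction -/

/-- By Dirichlet's theorem a resonant cone contains nonzero modes, supported on the first and the
last coordinate; this is where `d ≥ 2` matters. -/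
theorem cone_diff_zero_nonempty (hm : 1 ≤ m) {v : Fin (m + 1) → ℝ} (hv : v (Fin.last m) = 1)
    {s : ℝ} (hs : 0 < s) : (cone v s \ {0}).Nonempty := by
  obtain ⟨n, hn⟩ := exists_nat_one_div_lt hs
  obtain ⟨j, k, hk0, -, h⟩ := Real.exists_int_int_abs_mul_sub_le (v 0) n.succ_pos
  have h0 : (0 : Fin (m + 1)) ≠ Fin.last m := by
    intro h; have := congrArg Fin.val h; simp at this; omega
  have hne : (Pi.single 0 k - Pi.single (Fin.last m) j : Fin (m + 1) → ℤ) ≠ 0 := by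
    intro h
    have h1 := congrFun h 0
    simp [h0] at h1
    omega
  refine ⟨_, ?_, hne⟩
  have hdot : dotZ (Pi.single 0 k - Pi.single (Fin.last m) j) v = k * v 0 - j := by
    simp [dotZ, sub_mul, Finset.sum_sub_distrib, Pi.single_apply, hv]
  change |dotZ _ v| ≤ s * l1 _
  rw [hdot]
  have h1 := one_le_l1 hne
  have h2 : (1 : ℝ) / ((n.succ : ℕ) + 1) ≤ 1 / (n + 1) := by
    push_cast
    gcongr
    linarith
  nlinarith

section ContinuedFraction

variable {F : Set SL(m + 1, ℝ)} {ω : Fin (m + 1) → ℝ} {t σ : ℕ → ℝ}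

theorem cfP_zero : cfP F ω t 0 = 1 := if_pos rfl

theorem cfT_zero : cfT F ω t 0 = 1 := by
  rw [cfT, cfP_zero]; simp

theorem cfT_succ_mul_cfP (n : ℕ) : cfT F ω t (n + 1) * cfP F ω t n = cfP F ω t (n + 1) := by
  simp [cfT]

theorem lam_mul_act_last (ht : IsStoppingTimes F ω t) (n : ℕ) :
    lam F ω t n * act (cfP F ω t n) ω (Fin.last m) = 1 := by
  have h := ht.gam_ne n
  rw [lam]
  rw [gam] at h ⊢
  have h1 := left_ne_zero_of_mul h
  have h2 := right_ne_zero_of_mul h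
  field_simp

theorem lam_ne_zero (ht : IsStoppingTimes F ω t) (n : ℕ) : lam F ω t n ≠ 0 :=
  left_ne_zero_of_mul (lam_mul_act_last ht n ▸ one_ne_zero)

theorem lam_zero (hω : ω (Fin.last m) = 1) (ht : IsStoppingTimes F ω t) : lam F ω t 0 = 1 := by
  have h := lam_mul_act_last ht 0
  rwa [cfP_zero, act_one, hω, mul_one] at h

theorem om_last (ht : IsStoppingTimes F ω t) (n : ℕ) : om F ω t n (Fin.last m) = 1 :=
  lam_mul_act_last ht n

theorem om_zero (hω : ω (Fin.last m) = 1) (ht : IsStoppingTimes F ω t) : om F ω t 0 = ω := by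
  rw [om, lam_zero hω ht, cfP_zero, act_one, one_smul]

theorem one_le_l1_om (ht : IsStoppingTimes F ω t) (n : ℕ) : 1 ≤ l1 (om F ω t n) := by
  have h := norm_le_l1 (om F ω t n) (Fin.last m)
  rwa [om_last ht, norm_one] at h

theorem om_succ (ht : IsStoppingTimes F ω t) (n : ℕ) :
    om F ω t (n + 1) = eta F ω t (n + 1) • act (cfT F ω t (n + 1)) (om F ω t n) := by
  rw [om, om, act_smul, smul_smul, ← act_mul, cfT_succ_mul_cfP, eta, Nat.add_sub_cancel,
    div_mul_cancel₀ _ (lam_ne_zero ht n)]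

theorem bddAbove_cfA (n : ℕ) :
    BddAbove ((fun k => l1 (invTranspose (cfT F ω t (n + 1)) k) / l1 k) ''
      (cone (om F ω t n) (σ n) \ {0})) := by
  refine ⟨(m + 1) * matNorm (cfT F ω t (n + 1))⁻¹, ?_⟩
  rintro _ ⟨k, hk, rfl⟩
  have h1 := one_le_l1 (k := k) (fun h => hk.2 h)
  simp only
  rw [div_le_iff₀ (by linarith)]
  exact l1_invTranspose_le _ _

theorem l1_invTranspose_cfT_le {n : ℕ} {k : Fin (m + 1) → ℤ}
    (hk : k ∈ cone (om F ω t n) (σ n)) (hk0 : k ≠ 0) :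
    l1 (invTranspose (cfT F ω t (n + 1)) k) ≤ cfA F ω t σ n * l1 k := by
  have h1 := one_le_l1 hk0
  rw [← div_le_iff₀ (by linarith)]
  exact le_csSup (bddAbove_cfA n) ⟨k, ⟨hk, hk0⟩, rfl⟩

theorem cfA_le {n : ℕ} {C : ℝ} (hC : 0 ≤ C)
    (h : ∀ k ∈ cone (om F ω t n) (σ n), k ≠ 0 →
      l1 (invTranspose (cfT F ω t (n + 1)) k) ≤ C * l1 k) : cfA F ω t σ n ≤ C := by
  refine Real.sSup_le ?_ hC
  rintro _ ⟨k, hk, rfl⟩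
  have h1 := one_le_l1 (k := k) (fun h => hk.2 h)
  simp only
  rw [div_le_iff₀ (by linarith)]
  exact h k hk.1 fun h => hk.2 h

theorem cfA_pos (hm : 1 ≤ m) (ht : IsStoppingTimes F ω t) (hσ : IsResonanceWidths σ) (n : ℕ) :
    0 < cfA F ω t σ n := by
  obtain ⟨k, hk, hk0⟩ := cone_diff_zero_nonempty hm (om_last ht n) (hσ.pos n)
  have h0 : k ≠ 0 := fun h => hk0 h
  have h1 := one_le_l1 (invTranspose_ne_zero (T := cfT F ω t (n + 1)) h0)
  have h2 := l1_invTranspose_cfT_le hk h0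
  have h3 := one_le_l1 h0
  by_contra h
  nlinarith

theorem prodA_succ (n : ℕ) : prodA F ω t σ (n + 1) = prodA F ω t σ n * cfA F ω t σ n :=
  Finset.prod_range_succ _ _

theorem prodA_zero : prodA F ω t σ 0 = 1 := Finset.prod_range_zero _

theorem prodA_pos (hm : 1 ≤ m) (ht : IsStoppingTimes F ω t) (hσ : IsResonanceWidths σ) (n : ℕ) :
    0 < prodA F ω t σ n := Finset.prod_pos fun i _ => cfA_pos hm ht hσ i

/-- The transfer matrix from index `j` to index `l` is `P_l P_j⁻¹ = T_l ⋯ T_{j+1}`. -/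
theorem transfer_succ (j l : ℕ) : cfP F ω t (l + 1) * (cfP F ω t j)⁻¹ =
    cfT F ω t (l + 1) * (cfP F ω t l * (cfP F ω t j)⁻¹) := by
  rw [← mul_assoc, cfT_succ_mul_cfP]

theorem dotZ_transfer_om (ht : IsStoppingTimes F ω t) (j l : ℕ) (k : Fin (m + 1) → ℤ) :
    dotZ (invTranspose (cfP F ω t l * (cfP F ω t j)⁻¹) k) (om F ω t l) =
      lam F ω t l / lam F ω t j * dotZ k (om F ω t j) := by
  have h1 : act (cfP F ω t l) ω =
      act (cfP F ω t l * (cfP F ω t j)⁻¹) (act (cfP F ω t j) ω) := by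
    rw [← act_mul, inv_mul_cancel_right]
  rw [om, om, dotZ_smul_right, dotZ_smul_right, h1, dotZ_invTranspose_act, ← mul_assoc,
    div_mul_cancel₀ _ (lam_ne_zero ht j)]

/-- A mode that stays in the resonant cones from index `j` to `l` is contracted by
`A_j ⋯ A_{l-1}`. -/
theorem prodA_mul_l1_transfer_le (hm : 1 ≤ m) (ht : IsStoppingTimes F ω t)
    (hσ : IsResonanceWidths σ) {j l : ℕ} (hjl : j ≤ l) {k : Fin (m + 1) → ℤ} (hk : k ≠ 0)
    (h : ∀ i, j ≤ i → i < l →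
      invTranspose (cfP F ω t i * (cfP F ω t j)⁻¹) k ∈ cone (om F ω t i) (σ i)) :
    prodA F ω t σ j * l1 (invTranspose (cfP F ω t l * (cfP F ω t j)⁻¹) k) ≤
      prodA F ω t σ l * l1 k := by
  induction l, hjl using Nat.le_induction with
  | base => rw [mul_inv_cancel, invTranspose_one]
  | succ l hjl ih =>
    have h1 := ih fun i hi hil => h i hi (by omega)
    have h2 := l1_invTranspose_cfT_le (h l hjl (by omega)) (invTranspose_ne_zero hk)
    rw [transfer_succ, invTranspose_mul, prodA_succ]
    have h3 := (prodA_pos hm ht hσ j).le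
    have h4 := (cfA_pos hm ht hσ l).le
    calc _ ≤ prodA F ω t σ j * (cfA F ω t σ l * _) := mul_le_mul_of_nonneg_left h2 h3
      _ = cfA F ω t σ l * (prodA F ω t σ j * l1 (invTranspose _ k)) := by ring
      _ ≤ cfA F ω t σ l * (prodA F ω t σ l * l1 k) := mul_le_mul_of_nonneg_left h1 h4
      _ = _ := by ring

theorem matNorm_transfer_le {j l : ℕ} (hjl : j ≤ l) :
    matNorm (cfP F ω t l * (cfP F ω t j)⁻¹) ≤
      ∏ i ∈ Finset.range (l + 1), matNorm (cfT F ω t i) := by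
  induction l, hjl using Nat.le_induction with
  | base =>
    rw [mul_inv_cancel]
    refine matNorm_one_le.trans ?_
    exact Finset.prod_induction _ (fun x => (1 : ℝ) ≤ x) (fun _ _ => one_le_mul_of_one_le_of_one_le)
      le_rfl fun i _ => one_le_matNorm _
  | succ l hjl ih =>
    rw [transfer_succ, Finset.prod_range_succ]
    refine (matNorm_mul_le _ _).trans ?_
    rw [mul_comm]
    exact mul_le_mul_of_nonneg_right ih (matNorm_nonneg _)

end ContinuedFraction

end

section

/-! ### Sums over geometric scales -/

theorem sum_range_le_of_ratio {q : ℝ} (hq1 : q < 1) (N : ℕ) :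
    ∀ M : ℕ → ℝ, (∀ n, 0 < M n) → (∀ n, M (n + 1) ≤ q * M n) →
      ∑ n ∈ Finset.range N, M n ≤ M 0 / (1 - q) := by
  induction N with
  | zero => intro M hM _; simp; exact div_nonneg (hM 0).le (by linarith)
  | succ N ih =>
    intro M hM hMq
    have h1 := ih (fun n => M (n + 1)) (fun n => hM _) (fun n => hMq _)
    rw [Finset.sum_range_succ']
    rw [le_div_iff₀ (by linarith)] at h1 ⊢
    have h2 := hMq 0
    simp only [zero_add] at h1 h2
    nlinarith

theorem sum_range_ite_le_of_ratio {q c : ℝ} (hq1 : q < 1) (hc : 0 ≤ c) (N : ℕ) :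
    ∀ M : ℕ → ℝ, (∀ n, 0 < M n) → (∀ n, M (n + 1) ≤ q * M n) →
      ∑ n ∈ Finset.range N, (if M n ≤ c then M n else 0) ≤ c / (1 - q) := by
  induction N with
  | zero => intro M hM _; simp; exact div_nonneg hc (by linarith)
  | succ N ih =>
    intro M hM hMq
    by_cases h : M 0 ≤ c
    · refine le_trans (Finset.sum_le_sum fun n _ => ?_)
        ((sum_range_le_of_ratio hq1 (N + 1) M hM hMq).trans ?_)
      · split_ifs
        exacts [le_rfl, (hM n).le]
      · exact div_le_div_of_nonneg_right h (by linarith)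
    · rw [Finset.sum_range_succ', if_neg h, add_zero]
      exact ih (fun n => M (n + 1)) (fun n => hM _) (fun n => hMq _)

/-- If `∑ βⱼ μⱼ < ∞` and `Mₙ` decreases geometrically, then the sums of `βⱼ` over the `j` with
`Mₙ ≤ K μⱼ` are summable with the weights `Mₙ`. -/
theorem summable_mul_tsum_ite {β μ M : ℕ → ℝ} {q K : ℝ} (hβ : ∀ j, 0 ≤ β j) (hμ : ∀ j, 0 ≤ μ j)
    (hs : Summable fun j => β j * μ j) (hM : ∀ n, 0 < M n) (hq1 : q < 1)
    (hMq : ∀ n, M (n + 1) ≤ q * M n) (hK : 0 ≤ K) :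
    (∀ n, Summable fun j => if M n ≤ K * μ j then β j else 0) ∧
      Summable fun n => M n * ∑' j, if M n ≤ K * μ j then β j else 0 := by
  have h1 : ∀ n, Summable fun j => if M n ≤ K * μ j then β j else 0 := fun n => by
    refine Summable.of_nonneg_of_le (fun j => ?_) (fun j => ?_) (hs.mul_left (K / M n))
    · split_ifs
      exacts [hβ j, le_rfl]
    · split_ifs with h
      · rw [div_mul_eq_mul_div, le_div_iff₀ (hM n)]
        nlinarith [mul_le_mul_of_nonneg_left h (hβ j)]
      · have := hM n; have := hβ j; have := hμ j; positivity
  refine ⟨h1, ?_⟩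
  have hnn : ∀ p : ℕ × ℕ, 0 ≤ β p.1 * (if M p.2 ≤ K * μ p.1 then M p.2 else 0) := fun p => by
    refine mul_nonneg (hβ _) ?_
    split_ifs
    exacts [(hM _).le, le_rfl]
  have hpart : ∀ j N, ∑ n ∈ Finset.range N, (if M n ≤ K * μ j then M n else 0) ≤
      K * μ j / (1 - q) := fun j N =>
    sum_range_ite_le_of_ratio hq1 (mul_nonneg hK (hμ j)) N M hM hMq
  have hnn' : ∀ j n, 0 ≤ (if M n ≤ K * μ j then M n else 0) := fun j n => by
    split_ifs
    exacts [(hM _).le, le_rfl]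
  have h2 : Summable fun p : ℕ × ℕ => β p.1 * (if M p.2 ≤ K * μ p.1 then M p.2 else 0) := by
    rw [summable_prod_of_nonneg hnn]
    have hsum : ∀ j, Summable fun n => if M n ≤ K * μ j then M n else 0 := fun j =>
      summable_of_sum_range_le (hnn' j) (hpart j)
    refine ⟨fun j => (hsum j).mul_left (β j), ?_⟩
    refine Summable.of_nonneg_of_le (fun j => tsum_nonneg fun n => hnn (j, n)) (fun j => ?_)
      (hs.mul_left (K / (1 - q)))
    simp only [tsum_mul_left]
    have := Real.tsum_le_of_sum_range_le (hnn' j) (hpart j)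
    calc _ ≤ β j * (K * μ j / (1 - q)) := mul_le_mul_of_nonneg_left this (hβ j)
      _ = _ := by ring
  have h3 := ((Equiv.prodComm ℕ ℕ).summable_iff.2 h2).prod
  refine h3.congr fun n => ?_
  rw [← tsum_mul_left]
  refine tsum_congr fun j => ?_
  simp [mul_comm]

/-- The running minimum of a sequence. -/
noncomputable def runMin (a : ℕ → ℝ) (n : ℕ) : ℝ :=
  (Finset.range (n + 1)).inf' Finset.nonempty_range_add_one a

theorem le_runMin_iff {a : ℕ → ℝ} {n : ℕ} {c : ℝ} : c ≤ runMin a n ↔ ∀ i ≤ n, c ≤ a i := by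
  rw [runMin, Finset.le_inf'_iff]; simp

theorem runMin_le {a : ℕ → ℝ} {i n : ℕ} (h : i ≤ n) : runMin a n ≤ a i :=
  le_runMin_iff.1 le_rfl i h

/-! ### Growth of the continued fraction data of a vector in the class -/

variable {m : ℕ} {F : Set SL(m + 1, ℝ)} {ω : Fin (m + 1) → ℝ} {t σ : ℕ → ℝ}

/-- All the data at index `l` are at most exponentially large in `G l`. -/
structure GrowthBound (F : Set SL(m + 1, ℝ)) (ω : Fin (m + 1) → ℝ) (t σ G : ℕ → ℝ) : Prop where
  index : ∀ l : ℕ, (l : ℝ) ≤ G l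
  norms : ∀ l, Real.log (∏ i ∈ Finset.range (l + 1), matNorm (cfT F ω t i)) ≤ G l
  lam_le : ∀ l, Real.log |lam F ω t l| ≤ G l
  neg_lam_le : ∀ l, -Real.log |lam F ω t l| ≤ G l
  width : ∀ l, -Real.log (σ l) ≤ G l
  om : ∀ l, Real.log (l1 (om F ω t l)) ≤ G l

/-- The terms of the first series telescope up to nonnegative terms, and the second condition makes
`log (1 / σ_l)` dominate the growth of the matrices. -/
theorem exists_growthBound (hω : ω (Fin.last m) = 1) (hσ : IsResonanceWidths σ)
    (ht : IsStoppingTimes F ω t)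
    (h2 : Tendsto (fun n => 2 ^ (2 * n) * σ n * matNorm (cfP F ω t n)⁻¹ *
      ∏ i ∈ Finset.range (n + 1), matNorm (cfT F ω t i) ^ 2) atTop (𝓝 0)) :
    ∃ C : ℝ, 0 ≤ C ∧ GrowthBound F ω t σ (fun l => C * (1 + ∑ n ∈ Finset.range l,
      |Real.log (|eta F ω t (n + 1)| * matNorm (cfT F ω t (n + 1)) *
        (σ n * l1 (om F ω t (n + 1)) / σ (n + 1)))|)) := by
  obtain ⟨b, hb⟩ : ∃ b : ℕ → ℝ, ∀ n, b n = Real.log (|eta F ω t (n + 1)| *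
      matNorm (cfT F ω t (n + 1)) * (σ n * l1 (om F ω t (n + 1)) / σ (n + 1))) :=
    ⟨_, fun _ => rfl⟩
  obtain ⟨D, hD⟩ : ∃ D : ℕ → ℝ, ∀ l, D l = ∏ i ∈ Finset.range (l + 1), matNorm (cfT F ω t i) :=
    ⟨_, fun _ => rfl⟩
  simp only [← hb]
  have hτ1 : ∀ i, 1 ≤ matNorm (cfT F ω t i) := fun i => one_le_matNorm _
  have hD1 : ∀ l, 1 ≤ D l := fun l => hD l ▸
    Finset.prod_induction _ (fun x => (1 : ℝ) ≤ x) (fun _ _ => one_le_mul_of_one_le_of_one_le)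
      le_rfl fun i _ => hτ1 i
  have hD0 : D 0 ≤ 1 := by
    simp only [hD, zero_add, Finset.prod_range_one, cfT_zero]; exact matNorm_one_le
  have hw1 := one_le_l1_om (F := F) ht
  have hσp := hσ.pos
  have hlam : ∀ l, 0 < |lam F ω t l| := fun l => abs_pos.2 (lam_ne_zero ht l)
  obtain ⟨W, hW⟩ : ∃ W : ℕ → ℝ, ∀ l, W l = ∑ i ∈ Finset.range l,
      Real.log (l1 (om F ω t (i + 1))) := ⟨_, fun _ => rfl⟩
  have hW0 : ∀ l, 0 ≤ W l := fun l => hW l ▸ Finset.sum_nonneg fun i _ => Real.log_nonneg (hw1 _)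
  have hlogD : ∀ l, 0 ≤ Real.log (D l) := fun l => Real.log_nonneg (hD1 l)
  -- the terms of the series telescope
  have htel : ∀ l, Real.log |lam F ω t l| - Real.log (σ l) + Real.log (D l) + W l =
      -Real.log (σ 0) + ∑ n ∈ Finset.range l, b n := by
    intro l
    induction l with
    | zero =>
      have h0 : D 0 = 1 := le_antisymm hD0 (hD1 0)
      simp [h0, hW, lam_zero hω ht]
    | succ l ih =>
      have e1 : b l = Real.log |lam F ω t (l + 1)| - Real.log |lam F ω t l| +
          Real.log (matNorm (cfT F ω t (l + 1))) + (Real.log (σ l) +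
          Real.log (l1 (om F ω t (l + 1))) - Real.log (σ (l + 1))) := by
        have p1 := (hlam (l + 1)).ne'
        have p2 := (hlam l).ne'
        have p3 : matNorm (cfT F ω t (l + 1)) ≠ 0 := by linarith [hτ1 (l + 1)]
        have p4 : l1 (om F ω t (l + 1)) ≠ 0 := by linarith [hw1 (l + 1)]
        have p5 := (hσp l).ne'
        have p6 := (hσp (l + 1)).ne'
        simp only [hb]
        rw [eta, Nat.add_sub_cancel, abs_div, Real.log_mul (by positivity) (by positivity),
          Real.log_mul (by positivity) p3, Real.log_div p1 p2, Real.log_div (by positivity) p6,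
          Real.log_mul p5 p4]
      have e2 : Real.log (D (l + 1)) = Real.log (D l) + Real.log (matNorm (cfT F ω t (l + 1))) := by
        have p3 : matNorm (cfT F ω t (l + 1)) ≠ 0 := by linarith [hτ1 (l + 1)]
        have p4 : D l ≠ 0 := by linarith [hD1 l]
        rw [hD, Finset.prod_range_succ, ← hD, Real.log_mul p4 p3]
      have e3 : W (l + 1) = W l + Real.log (l1 (om F ω t (l + 1))) := by
        rw [hW, hW, Finset.sum_range_succ]
      rw [Finset.sum_range_succ, e2, e3]
      linarith
  have hω1 : 1 ≤ l1 ω := by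
    have h := norm_le_l1 ω (Fin.last m)
    rwa [hω, norm_one] at h
  -- the last component of `ω_l` is `1`, and `‖P_l‖ ≤ D l`
  have hC1 : ∀ l, -Real.log |lam F ω t l| ≤ Real.log (D l) + Real.log (l1 ω) := by
    intro l
    have e1 : 1 ≤ |lam F ω t l| * (D l * l1 ω) := by
      have e2 := congrArg abs (lam_mul_act_last (F := F) (ω := ω) ht l)
      rw [abs_mul, abs_one] at e2
      rw [← e2]
      refine mul_le_mul_of_nonneg_left ?_ (abs_nonneg _)
      refine (norm_le_l1 (act (cfP F ω t l) ω) (Fin.last m)).trans ((l1_act_le _ _).trans ?_)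
      refine mul_le_mul_of_nonneg_right ?_ (by linarith)
      have e3 := matNorm_transfer_le (F := F) (ω := ω) (t := t) (Nat.zero_le l)
      rwa [cfP_zero, inv_one, mul_one, ← hD] at e3
    have e2 := Real.log_nonneg e1
    rw [Real.log_mul (hlam l).ne' (mul_pos (by linarith [hD1 l]) (by linarith)).ne',
      Real.log_mul (by linarith [hD1 l]) (by linarith)] at e2
    linarith
  -- the second condition; only `e ≤ 4` and `‖P_l⁻¹‖ ≥ 1` are needed of its other factors
  obtain ⟨C₀, hC₀⟩ : ∃ C₀, ∀ l : ℕ, (l : ℝ) + Real.log (σ l) + 2 * Real.log (D l) ≤ C₀ := by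
    obtain ⟨B, hB⟩ := h2.bddAbove_range
    refine ⟨Real.log (max B 1), fun l => ?_⟩
    have e1 := hB ⟨l, rfl⟩
    simp only [Finset.prod_pow, ← hD] at e1
    have e2 : Real.exp l * σ l * D l ^ 2 ≤ max B 1 := by
      refine le_trans ?_ (e1.trans (le_max_left _ _))
      have e3 : Real.exp l ≤ 2 ^ (2 * l) := by
        rw [pow_mul, ← Real.exp_one_pow]
        refine pow_le_pow_left₀ (Real.exp_pos _).le ?_ l
        linarith [Real.exp_one_lt_three]
      have e4 := one_le_matNorm (cfP F ω t l)⁻¹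
      have e5 := hσp l
      have e6 := hD1 l
      calc Real.exp l * σ l * D l ^ 2 ≤ 2 ^ (2 * l) * σ l * D l ^ 2 := by gcongr
        _ ≤ (2 ^ (2 * l) * σ l * matNorm (cfP F ω t l)⁻¹) * D l ^ 2 := by
          refine mul_le_mul_of_nonneg_right ?_ (by positivity)
          exact le_mul_of_one_le_right (by positivity) e4
    have e8 : 0 < D l := by linarith [hD1 l]
    have e7 := Real.log_le_log
      (mul_pos (mul_pos (Real.exp_pos _) (hσp l)) (pow_pos e8 2)) e2
    rw [Real.log_mul (mul_ne_zero (Real.exp_pos _).ne' (hσp l).ne') (pow_pos e8 2).ne',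
      Real.log_mul (Real.exp_pos _).ne' (hσp l).ne', Real.log_exp, Real.log_pow] at e7
    push_cast at e7
    linarith
  have hlω : 0 ≤ Real.log (l1 ω) := Real.log_nonneg hω1
  obtain ⟨K, hK⟩ : ∃ K, K = |Real.log (σ 0)| + |C₀| + Real.log (l1 ω) := ⟨_, rfl⟩
  have hK0 : 0 ≤ K := by rw [hK]; positivity
  have a1 := neg_abs_le (Real.log (σ 0))
  have a2 := le_abs_self (Real.log (σ 0))
  have a3 := le_abs_self C₀
  have a4 := abs_nonneg C₀
  obtain ⟨S, hS⟩ : ∃ S : ℕ → ℝ, ∀ l, S l = ∑ n ∈ Finset.range l, |b n| := ⟨_, fun _ => rfl⟩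
  have hS0 : ∀ l, 0 ≤ S l := fun l => hS l ▸ Finset.sum_nonneg fun i _ => abs_nonneg _
  have hbS : ∀ l, ∑ n ∈ Finset.range l, b n ≤ S l := fun l =>
    hS l ▸ Finset.sum_le_sum fun i _ => le_abs_self _
  simp only [← hS]
  -- of the two copies of `log (D l)` in the second condition and the one in the telescoped sum, one
  -- pays for `-log |λ_l|`
  have hmain : ∀ l : ℕ, (l : ℝ) + 2 * Real.log (D l) + W l ≤ 3 * K + S l := fun l => by
    linarith [htel l, hC1 l, hC₀ l, hbS l]
  have hG : ∀ l x, x ≤ 5 * K + 2 * S l → x ≤ (5 * K + 2) * (1 + S l) := fun l x hx => by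
    nlinarith [mul_nonneg hK0 (hS0 l)]
  have hl0 : ∀ l : ℕ, (0 : ℝ) ≤ l := fun l => Nat.cast_nonneg l
  refine ⟨5 * K + 2, by positivity, ⟨fun l => hG l _ ?_, fun l => hG l _ ?_, fun l => hG l _ ?_,
    fun l => hG l _ ?_, fun l => hG l _ ?_, fun l => hG l _ ?_⟩⟩
  · linarith [hmain l, hlogD l, hW0 l, hS0 l]
  · rw [← hD]
    linarith [hmain l, hlogD l, hW0 l, hS0 l, hl0 l]
  · have : Real.log (σ l) ≤ Real.log (σ 0) :=
      Real.log_le_log (hσp l) (hσ.strictAnti.antitone (Nat.zero_le l))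
    linarith [htel l, hmain l, hlogD l, hW0 l, hS0 l, hbS l]
  · linarith [hC1 l, hmain l, hlogD l, hW0 l, hS0 l, hl0 l]
  · linarith [htel l, hC1 l, hmain l, hlogD l, hW0 l, hS0 l, hbS l, hl0 l]
  · rcases Nat.eq_zero_or_pos l with rfl | hl
    · rw [om_zero hω ht]; linarith [hS0 0]
    · have e1 : Real.log (l1 (om F ω t l)) ≤ W l := by
        obtain ⟨n, rfl⟩ := Nat.exists_eq_succ_of_ne_zero hl.ne'
        rw [hW]
        exact Finset.single_le_sum (f := fun i => Real.log (l1 (om F ω t (i + 1))))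
          (fun i _ => Real.log_nonneg (hw1 _)) (Finset.mem_range.2 n.lt_succ_self)
      linarith [hmain l, hlogD l, hW0 l, hS0 l, hl0 l]

end

section

/-! ### Small divisors of a vector in the class -/

variable {m : ℕ} {F : Set SL(m + 1, ℝ)} {ω : Fin (m + 1) → ℝ} {t σ : ℕ → ℝ}

/-- The products `A_0 ⋯ A_{l-1}` are not bounded below: otherwise the first series would bound the
growth function, which dominates the index. -/
theorem exists_prodA_lt (hm : 1 ≤ m) (ht : IsStoppingTimes F ω t) (hσ : IsResonanceWidths σ)
    {β : ℕ → ℝ} {C : ℝ} (hβ : ∀ n, 0 ≤ β n) (hC : 0 ≤ C)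
    (hs : Summable fun n => prodA F ω t σ (n + 1) * β n)
    (hG : GrowthBound F ω t σ (fun l => C * (1 + ∑ n ∈ Finset.range l, β n)))
    {c : ℝ} (hc : 0 < c) : ∃ l, prodA F ω t σ l < c := by
  by_contra! h
  have h1 : ∀ l, ∑ n ∈ Finset.range l, β n ≤ (∑' n, prodA F ω t σ (n + 1) * β n) / c := fun l => by
    rw [le_div_iff₀ hc, Finset.sum_mul]
    refine le_trans (Finset.sum_le_sum fun n _ => ?_) (hs.sum_le_tsum (Finset.range l) fun n _ =>
      mul_nonneg (prodA_pos hm ht hσ _).le (hβ n))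
    rw [mul_comm]
    exact mul_le_mul_of_nonneg_right (h _) (hβ n)
  obtain ⟨l, hl⟩ := exists_nat_gt (C * (1 + (∑' n, prodA F ω t σ (n + 1) * β n) / c))
  have h2 := hG.index l
  have h3 := mul_le_mul_of_nonneg_left (add_le_add_right (h1 l) 1) hC
  linarith

/-- A mode of norm at most `(3/2)^i` leaves the resonant cones at an index `n` with
`A_0 ⋯ A_{j-1} ≥ (2/3)^i` for `j ≤ n`, and its small divisor is then at least `σ_n / |λ_n|`. -/
theorem isBrjuno_of_growthBound (hm : 1 ≤ m) (hω : ω (Fin.last m) = 1)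
    (ht : IsStoppingTimes F ω t) (hσ : IsResonanceWidths σ)
    {β : ℕ → ℝ} {C : ℝ} (hβ : ∀ n, 0 ≤ β n) (hC : 0 ≤ C)
    (hs : Summable fun n => prodA F ω t σ (n + 1) * β n)
    (hG : GrowthBound F ω t σ (fun l => C * (1 + ∑ n ∈ Finset.range l, β n))) : IsBrjuno ω := by
  have hA := prodA_pos hm ht hσ
  set μ : ℕ → ℝ := fun j => runMin (prodA F ω t σ) (j + 1) with hμ
  have hμ0 : ∀ j, 0 ≤ μ j := fun j => le_runMin_iff.2 fun i _ => (hA i).le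
  have hβμ : Summable fun j => β j * μ j := by
    refine Summable.of_nonneg_of_le (fun j => mul_nonneg (hβ j) (hμ0 j)) (fun j => ?_) hs
    rw [mul_comm]
    exact mul_le_mul_of_nonneg_right (runMin_le le_rfl) (hβ j)
  obtain ⟨h1, h2⟩ := summable_mul_tsum_ite (M := fun i => (2 / 3 : ℝ) ^ i) (q := 2 / 3) (K := 1)
    hβ hμ0 hβμ (fun i => by positivity) (by norm_num) (fun i => by rw [pow_succ, mul_comm])
    zero_le_one
  simp only [one_mul] at h1 h2
  set B : ℕ → ℝ := fun i => ∑' j, if (2 / 3 : ℝ) ^ i ≤ μ j then β j else 0 with hB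
  have hterm : ∀ i j, 0 ≤ (if (2 / 3 : ℝ) ^ i ≤ μ j then β j else 0) := fun i j => by
    split_ifs
    exacts [hβ j, le_rfl]
  have hB0 : ∀ i, 0 ≤ B i := fun i => tsum_nonneg (hterm i)
  refine ⟨fun i => 2 * C * (1 + B i), fun i => mul_nonneg (by positivity) (by linarith [hB0 i]),
    ?_, fun i k hk hki => ?_⟩
  · have h3 : Summable fun i : ℕ => (2 / 3 : ℝ) ^ i :=
      summable_geometric_of_lt_one (by norm_num) (by norm_num)
    refine ((h3.add h2).mul_left (2 * C)).congr fun i => ?_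
    ring
  -- the images of the mode `k`; they have integer entries, hence norm at least `1`
  set kn : ℕ → Fin (m + 1) → ℤ := fun n => invTranspose (cfP F ω t n * (cfP F ω t 0)⁻¹) k with hkn
  have hk1 := one_le_l1 hk
  have hkn1 : ∀ n, 1 ≤ l1 (kn n) := fun n => one_le_l1 (invTranspose_ne_zero hk)
  have hlow : ∀ n, (∀ j < n, kn j ∈ cone (om F ω t j) (σ j)) → 1 / l1 k ≤ prodA F ω t σ n := by
    intro n hn
    have h3 := prodA_mul_l1_transfer_le hm ht hσ (Nat.zero_le n) hk fun i _ hi => hn i hi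
    rw [prodA_zero, one_mul] at h3
    rw [div_le_iff₀ (by linarith)]
    exact (hkn1 n).trans h3
  have hexit : ∃ n, kn n ∉ cone (om F ω t n) (σ n) := by
    by_contra! h
    obtain ⟨l, hl⟩ := exists_prodA_lt hm ht hσ hβ hC hs hG (c := 1 / l1 k) (by positivity)
    exact absurd (hlow l fun j _ => h j) (not_le.2 hl)
  classical
  -- the index at which the mode leaves the resonant cones
  set n := Nat.find hexit with hn
  have hnspec : kn n ∉ cone (om F ω t n) (σ n) := Nat.find_spec hexit
  have hnmin : ∀ j < n, kn j ∈ cone (om F ω t j) (σ j) := fun j hj =>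
    not_not.1 (Nat.find_min hexit hj)
  have hki' : (2 / 3 : ℝ) ^ i ≤ 1 / l1 k := by
    rw [le_div_iff₀ (by linarith)]
    calc _ ≤ (2 / 3 : ℝ) ^ i * (3 / 2) ^ i := by gcongr
      _ = 1 := by rw [← mul_pow]; norm_num
  have hSB : ∑ j ∈ Finset.range n, β j ≤ B i := by
    refine le_trans (Finset.sum_le_sum fun j hj => ?_)
      ((h1 i).sum_le_tsum (Finset.range n) fun j _ => hterm i j)
    rw [if_pos]
    refine le_runMin_iff.2 fun l hl => hki'.trans (hlow l fun p hp => hnmin p ?_)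
    have := Finset.mem_range.1 hj
    omega
  have hdot := dotZ_transfer_om ht 0 n k
  rw [lam_zero hω ht, om_zero hω ht, div_one] at hdot
  have hout : σ n * 1 < |lam F ω t n| * |dotZ k ω| := by
    rw [← abs_mul, ← hdot]
    refine lt_of_le_of_lt (mul_le_mul_of_nonneg_left (hkn1 n) (hσ.pos n).le) ?_
    exact not_le.1 hnspec
  have e1 := hG.lam_le n
  have e2 := hG.width n
  have e3 : C * (1 + ∑ j ∈ Finset.range n, β j) ≤ C * (1 + B i) :=
    mul_le_mul_of_nonneg_left (by linarith) hC
  have hl0 : 0 < |lam F ω t n| := abs_pos.2 (lam_ne_zero ht n)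
  have hd0 : 0 < |dotZ k ω| := by
    by_contra h
    have := hσ.pos n
    nlinarith
  rw [← Real.le_log_iff_exp_le hd0]
  have e4 := Real.log_lt_log (by linarith [hσ.pos n]) hout
  rw [mul_one, Real.log_mul hl0.ne' hd0.ne'] at e4
  linarith

end

section

/-! ### Fourier coefficients -/

variable {m : ℕ}

theorem integral_exp_two_pi_int (n : ℤ) :
    ∫ x in Set.Icc (0 : ℝ) 1, Complex.exp (2 * Real.pi * n * Complex.I * x) =
      if n = 0 then 1 else 0 := by
  rw [integral_Icc_eq_integral_Ioc, ← intervalIntegral.integral_of_le zero_le_one]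
  split_ifs with h
  · simp [h]
  · have hc : (2 * Real.pi * n * Complex.I : ℂ) ≠ 0 := by
      simp [Real.pi_ne_zero, h]
    rw [integral_exp_mul_complex hc]
    have : Complex.exp (2 * Real.pi * n * Complex.I * (1 : ℝ)) = 1 := by
      rw [Complex.exp_eq_one_iff]
      exact ⟨n, by push_cast; ring⟩
    rw [this]; simp

theorem continuous_mode (k : Fin (m + 1) → ℤ) : Continuous (mode k) :=
  continuous_iff_continuousAt.2 fun x => (hasFDerivAt_mode k x).continuousAt

theorem integral_mode (k : Fin (m + 1) → ℤ) :
    ∫ x in Set.Icc (0 : Fin (m + 1) → ℝ) 1, mode k x = if k = 0 then 1 else 0 := by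
  have h1 : (volume : Measure (Fin (m + 1) → ℝ)).restrict (Set.Icc 0 1) =
      Measure.pi fun _ => (volume : Measure ℝ).restrict (Set.Icc 0 1) := by
    rw [← Measure.restrict_pi_pi, ← volume_pi, ← Set.pi_univ_Icc]
    rfl
  have h2 : ∀ x : Fin (m + 1) → ℝ, mode k x =
      ∏ j, Complex.exp (2 * Real.pi * k j * Complex.I * x j) := fun x => by
    rw [mode, ← Complex.exp_sum]
    congr 1
    simp only [dotZ]
    push_cast
    rw [Finset.mul_sum, Finset.sum_mul]
    exact Finset.sum_congr rfl fun j _ => by ring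
  simp only [h2, h1]
  rw [integral_fintype_prod_eq_prod (𝕜 := ℂ)
    (f := fun j (x : ℝ) => Complex.exp (2 * Real.pi * k j * Complex.I * x))]
  simp only [integral_exp_two_pi_int]
  split_ifs with h
  · simp [h]
  · obtain ⟨i, hi⟩ := Function.ne_iff.1 h
    exact Finset.prod_eq_zero (Finset.mem_univ i) (if_neg hi)

/-- The coefficients of an absolutely convergent Fourier series. -/
theorem coeff_eq_of_hasSum {f : (Fin (m + 1) → ℝ) → Fin (m + 1) → ℂ}
    {a : (Fin (m + 1) → ℤ) → Fin (m + 1) → ℂ} (hs : ∀ j, Summable fun k => ‖a k j‖)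
    (hf : ∀ x j, HasSum (fun k => a k j * mode k x) (f x j)) (k : Fin (m + 1) → ℤ) :
    coeff f k = a k := by
  funext j
  have : IsFiniteMeasure ((volume : Measure (Fin (m + 1) → ℝ)).restrict (Set.Icc 0 1)) :=
    ⟨by rw [Measure.restrict_apply_univ]; exact isCompact_Icc.measure_lt_top⟩
  have hint : ∀ l, ∫ x in Set.Icc (0 : Fin (m + 1) → ℝ) 1, a l j * mode (l - k) x =
      if l = k then a l j else 0 := fun l => by
    rw [integral_const_mul, integral_mode]
    by_cases h : l = k
    · simp [h]
    · rw [if_neg h, if_neg (sub_ne_zero.2 h), mul_zero]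
  have hnorm : ∀ l x, ‖a l j * mode (l - k) x‖ = ‖a l j‖ := fun l x => by
    rw [norm_mul, norm_mode, mul_one]
  have hI : ∀ l, Integrable (fun x => a l j * mode (l - k) x)
      ((volume : Measure (Fin (m + 1) → ℝ)).restrict (Set.Icc 0 1)) := fun l =>
    (continuous_const.mul (continuous_mode _)).integrableOn_Icc
  have h1 := hasSum_integral_of_summable_integral_norm hI (by
    simp only [hnorm, integral_const]
    exact (hs j).const_smul _)
  simp only [hint] at h1
  have h2 := h1.unique (hasSum_ite_eq k (a k j) |>.congr_fun fun l => by
    by_cases h : l = k <;> simp [h])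
  rw [← h2, coeff]
  refine integral_congr_ae (Eventually.of_forall fun x => ?_)
  have h3 := (hf x j).mul_left (mode (-k) x)
  have h4 : (fun l => mode (-k) x * (a l j * mode l x)) = fun l => a l j * mode (l - k) x := by
    funext l
    rw [sub_eq_add_neg, mode_add_left]; ring
  rw [h4] at h3
  simp only
  rw [h3.tsum_eq, mode, dotZ_neg_left]
  congr 2
  push_cast; ring

theorem coeff_const (v : Fin (m + 1) → ℂ) (k : Fin (m + 1) → ℤ) :
    coeff (fun _ => v) k = if k = 0 then v else 0 := by
  refine coeff_eq_of_hasSum (a := fun k => if k = 0 then v else 0) (fun j => ?_) (fun x j => ?_) k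
  · refine summable_of_ne_finset_zero (s := {0}) fun k hk => ?_
    rw [if_neg (by simpa using hk)]; simp
  · have h := hasSum_ite_eq (0 : Fin (m + 1) → ℤ) (v j)
    refine h.congr_fun fun k => ?_
    by_cases hk : k = 0
    · simp [hk, mode_zero]
    · simp [hk]

theorem MemA.summable_coeff {s : ℝ} (hs : 0 ≤ s) {f : (Fin (m + 1) → ℝ) → Fin (m + 1) → ℂ}
    (hf : MemA s f) (j : Fin (m + 1)) : Summable fun k => ‖coeff f k j‖ := by
  have h1 := hf.norm_lt
  rw [normA, tsum_univ (f := fun k => ENNReal.ofReal (l1 (coeff f k) * Real.exp (s * l1 k)))] at h1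
  have h2 : Summable fun k => l1 (coeff f k) * Real.exp (s * l1 k) := by
    have h3 := ENNReal.summable_toReal h1.ne
    refine h3.congr fun k => ENNReal.toReal_ofReal ?_
    exact mul_nonneg (l1_nonneg _) (Real.exp_pos _).le
  refine Summable.of_nonneg_of_le (fun k => norm_nonneg _) (fun k => ?_) h2
  exact (norm_le_l1 _ j).trans (le_mul_of_one_le_right (l1_nonneg _) (one_le_expWeight hs k))

/-- The action of `T` on frequencies as a permutation of `ℤ^d`. -/
def invTransposeEquiv (T : SL(m + 1, ℤ)) : (Fin (m + 1) → ℤ) ≃ (Fin (m + 1) → ℤ) where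
  toFun := invTranspose T
  invFun := invTranspose T⁻¹
  left_inv := invTranspose_inv_apply T
  right_inv k := by simpa using invTranspose_inv_apply T⁻¹ k

theorem coeff_rescale {s : ℝ} (hs : 0 ≤ s) {f : (Fin (m + 1) → ℝ) → Fin (m + 1) → ℂ}
    (hf : MemA s f) (e : ℝ) (T : SL(m + 1, ℤ)) (k : Fin (m + 1) → ℤ) :
    coeff (rescale e T f) (invTranspose T k) = (e : ℂ) • act T (coeff f k) := by
  have hsum := hf.summable_coeff hs
  have hexp : ∀ k j, ((e : ℂ) • act T (coeff f k)) j =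
      ∑ i, ((e : ℂ) * (T j i : ℤ)) * coeff f k i := fun k j => by
    rw [Pi.smul_apply, act_apply, smul_eq_mul, Finset.mul_sum]
    exact Finset.sum_congr rfl fun i _ => by ring
  have h := coeff_eq_of_hasSum (f := rescale e T f)
    (a := fun k => (e : ℂ) • act T (coeff f ((invTransposeEquiv T).symm k))) (fun j => ?_)
    (fun x j => ?_) (invTransposeEquiv T k)
  · rw [Equiv.symm_apply_apply] at h
    exact h
  · rw [← (invTransposeEquiv T).summable_iff]
    simp only [Function.comp_def, Equiv.symm_apply_apply, hexp]
    refine Summable.of_nonneg_of_le (fun k => norm_nonneg _) (fun k => norm_sum_le _ _)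
      (summable_sum fun i _ => ?_)
    simp only [norm_mul]
    exact (hsum i).mul_left _
  · rw [← (invTransposeEquiv T).hasSum_iff]
    have h1 : HasSum (fun k => ∑ i, ((e : ℂ) * (T j i : ℤ)) *
        (coeff f k i * mode k (act T⁻¹ x))) (∑ i, ((e : ℂ) * (T j i : ℤ)) * f (act T⁻¹ x) i) :=
      hasSum_sum fun i _ => (hf.hasSum (act T⁻¹ x) i).mul_left _
    have h2 : rescale e T f x j = ∑ i, ((e : ℂ) * (T j i : ℤ)) * f (act T⁻¹ x) i := by
      change (e : ℂ) * act T (f (act T⁻¹ x)) j = _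
      rw [act_apply, Finset.mul_sum]
      exact Finset.sum_congr rfl fun i _ => by ring
    rw [h2]
    refine h1.congr_fun fun k => ?_
    simp only [Function.comp_def, Equiv.symm_apply_apply, hexp]
    have h3 : mode (invTransposeEquiv T k) x = mode k (act T⁻¹ x) := by
      rw [mode, mode, dotZ_act, inv_inv]; rfl
    rw [h3, Finset.sum_mul]
    exact Finset.sum_congr rfl fun i _ => by ring

/-- The gain of analyticity `δ` absorbs the weight `1 + 2π‖k‖` in the norm of `𝒜'`. -/
theorem rescaleNorm_le {F : Set SL(m + 1, ℝ)} {ω : Fin (m + 1) → ℝ} {t σ : ℕ → ℝ} {δ : ℝ}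
    (hδ : 0 < δ) {n : ℕ} (hA : 0 < cfA F ω t σ n) :
    rescaleNorm F δ ω t σ (n + 1) ≤
      |eta F ω t (n + 1)| * matNorm (cfT F ω t (n + 1)) * (1 + 2 * Real.pi / δ) := by
  set e := eta F ω t (n + 1)
  set T := cfT F ω t (n + 1) with hT
  have hpi := Real.pi_pos
  have hτ := matNorm_nonneg T
  refine csInf_le ⟨0, fun C hC => hC.1⟩ ⟨by positivity, fun s s' hs hs' hss f hf hres => ?_⟩
  rw [Nat.add_sub_cancel] at hss
  simp only [Nat.add_sub_cancel] at hres
  rw [normA', normA,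
    tsum_univ (f := fun k => ENNReal.ofReal ((1 + 2 * Real.pi * l1 k) *
      l1 (coeff (rescale e T f) k) * Real.exp (s' * l1 k))),
    tsum_univ (f := fun k => ENNReal.ofReal (l1 (coeff f k) * Real.exp (s * l1 k))),
    ← (invTransposeEquiv T).tsum_eq, ← ENNReal.tsum_mul_left]
  refine ENNReal.tsum_le_tsum fun k => ?_
  change ENNReal.ofReal ((1 + 2 * Real.pi * l1 (invTranspose T k)) *
    l1 (coeff (rescale e T f) (invTranspose T k)) * Real.exp (s' * l1 (invTranspose T k))) ≤ _
  rw [← ENNReal.ofReal_mul (by positivity), coeff_rescale hs.le hf]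
  refine ENNReal.ofReal_le_ofReal ?_
  by_cases hk : k ∈ cone (om F ω t n) (σ n) \ {0}
  · have hy := l1_invTranspose_cfT_le hk.1 fun h => hk.2 h
    rw [← hT] at hy
    have hy0 := l1_nonneg (invTranspose T k)
    have hyk := l1_nonneg k
    set y := l1 (invTranspose T k)
    have h1 : l1 ((e : ℂ) • act T (coeff f k)) ≤ |e| * (matNorm T * l1 (coeff f k)) := by
      rw [l1_smul, Complex.norm_real, Real.norm_eq_abs]
      exact mul_le_mul_of_nonneg_left (l1_act_le T _) (abs_nonneg _)
    have h2 : 1 + 2 * Real.pi * y ≤ (1 + 2 * Real.pi / δ) * Real.exp (δ * y) := by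
      have h3 := Real.add_one_le_exp (δ * y)
      have h4 : 0 ≤ δ * y := by positivity
      calc 1 + 2 * Real.pi * y ≤ 1 * (δ * y + 1) + 2 * Real.pi / δ * (δ * y + 1) := by
            have : 2 * Real.pi / δ * (δ * y + 1) = 2 * Real.pi * y + 2 * Real.pi / δ := by
              field_simp
            rw [this]
            have : 0 ≤ 2 * Real.pi / δ := by positivity
            linarith
        _ = (1 + 2 * Real.pi / δ) * (δ * y + 1) := by ring
        _ ≤ _ := by gcongr
    have h3 : Real.exp (δ * y) * Real.exp (s' * y) ≤ Real.exp (s * l1 k) := by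
      rw [← Real.exp_add, ← add_mul]
      refine Real.exp_le_exp.2 ?_
      calc (δ + s') * y ≤ s / cfA F ω t σ n * (cfA F ω t σ n * l1 k) := by
            refine mul_le_mul (by linarith) hy hy0 (by positivity)
        _ = s * l1 k := by field_simp
    have hc0 := l1_nonneg (coeff f k)
    have hl0 := l1_nonneg ((e : ℂ) • act T (coeff f k))
    calc _ ≤ ((1 + 2 * Real.pi / δ) * Real.exp (δ * y)) * (|e| * (matNorm T * l1 (coeff f k))) *
          Real.exp (s' * y) := by gcongr
      _ = |e| * matNorm T * (1 + 2 * Real.pi / δ) * (l1 (coeff f k) *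
          (Real.exp (δ * y) * Real.exp (s' * y))) := by ring
      _ ≤ _ := by gcongr
  · rw [hres k hk]
    have h0 : act T (0 : Fin (m + 1) → ℂ) = 0 := Matrix.mulVec_zero _
    rw [h0, smul_zero, l1_zero, mul_zero, zero_mul]
    have := l1_nonneg (0 : Fin (m + 1) → ℂ)
    positivity

end

section

/-! ### Sparse stopping times -/

variable {m : ℕ} {F : Set SL(m + 1, ℝ)} {ω : Fin (m + 1) → ℝ} {t σ : ℕ → ℝ}

/-- The successive indices at which a positive sequence has halved for the first time. -/
theorem exists_halving_indices {a : ℕ → ℝ} (ha : ∀ n, 0 < a n)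
    (h : ∀ c : ℝ, 0 < c → ∃ l, a l < c) :
    ∃ j : ℕ → ℕ, j 0 = 0 ∧ StrictMono j ∧ (∀ n, a (j (n + 1)) ≤ a (j n) / 2) ∧
      ∀ n l, l < j (n + 1) → a (j n) / 2 < a l := by
  classical
  obtain ⟨j, h0, -, hR⟩ := exists_seq_of_step (P := fun _ s => ∀ l ≤ s, a s ≤ a l)
    (R := fun _ s s' => s < s' ∧ a s' ≤ a s / 2 ∧ ∀ l < s', a s / 2 < a l) (a := 0)
    (fun l hl => by rw [Nat.le_zero.1 hl]) (fun _ s hs => by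
      have hex : ∃ l, a l ≤ a s / 2 := (h (a s / 2) (half_pos (ha s))).imp fun l hl => hl.le
      have hmin : ∀ l < Nat.find hex, a s / 2 < a l := fun l hl => not_le.1 (Nat.find_min hex hl)
      have hspec := Nat.find_spec hex
      refine ⟨Nat.find hex, fun l hl => ?_, ?_, hspec, hmin⟩
      · rcases hl.lt_or_eq with hl | rfl
        exacts [hspec.trans (hmin l hl).le, le_rfl]
      · by_contra hle
        have := hs _ (not_lt.1 hle)
        linarith [ha s])
  exact ⟨j, h0, strictMono_nat_of_lt_succ fun n => (hR n).1, fun n => (hR n).2.1,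
    fun n l hl => (hR n).2.2 l hl⟩

section Subsequence

variable {j : ℕ → ℕ}

theorem cfP_comp (h0 : j 0 = 0) (hj : StrictMono j) (n : ℕ) :
    cfP F ω (fun n => t (j n)) n = cfP F ω t (j n) := by
  rcases Nat.eq_zero_or_pos n with rfl | hn
  · rw [h0, cfP_zero, cfP_zero]
  · have h1 : j n ≠ 0 := by have := hj hn; omega
    rw [cfP, cfP, if_neg hn.ne', if_neg h1]

theorem gam_comp (h0 : j 0 = 0) (hj : StrictMono j) (n : ℕ) :
    gam F ω (fun n => t (j n)) n = gam F ω t (j n) := by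
  rw [gam, gam, cfP_comp h0 hj]

theorem lam_comp (h0 : j 0 = 0) (hj : StrictMono j) (n : ℕ) :
    lam F ω (fun n => t (j n)) n = lam F ω t (j n) := by
  rw [lam, lam, gam_comp h0 hj]

theorem om_comp (h0 : j 0 = 0) (hj : StrictMono j) (n : ℕ) :
    om F ω (fun n => t (j n)) n = om F ω t (j n) := by
  rw [om, om, lam_comp h0 hj, cfP_comp h0 hj]

theorem cfT_comp (h0 : j 0 = 0) (hj : StrictMono j) (n : ℕ) :
    cfT F ω (fun n => t (j n)) (n + 1) = cfP F ω t (j (n + 1)) * (cfP F ω t (j n))⁻¹ := by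
  rw [cfT, Nat.add_sub_cancel, cfP_comp h0 hj, cfP_comp h0 hj]

end Subsequence

/-- If `s` is small compared with the data at the indices `p` and `l`, the modes in the cone of
width `s` for `ω_p` are transferred to modes in the resonant cone of index `l`. -/
theorem transfer_mem_cone (ht : IsStoppingTimes F ω t) (hσ : IsResonanceWidths σ) {G : ℕ → ℝ}
    (hG : GrowthBound F ω t σ G) {p l : ℕ} (hpl : p ≤ l) {g s : ℝ} (hgp : G p ≤ g) (hgl : G l ≤ g)
    (hs : (m + 1) * s ≤ Real.exp (-(4 * g))) {k : Fin (m + 1) → ℤ}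
    (hk : k ∈ cone (om F ω t p) s) :
    invTranspose (cfP F ω t l * (cfP F ω t p)⁻¹) k ∈ cone (om F ω t l) (σ l) := by
  have hl : 0 < |lam F ω t l| := abs_pos.2 (lam_ne_zero ht l)
  have hp : 0 < |lam F ω t p| := abs_pos.2 (lam_ne_zero ht p)
  have e1 : |lam F ω t l| ≤ Real.exp g := by
    rw [← Real.log_le_iff_le_exp hl]; exact (hG.lam_le l).trans hgl
  have e2 : Real.exp (-g) ≤ |lam F ω t p| := by
    rw [← Real.le_log_iff_exp_le hp]; linarith [hG.neg_lam_le p]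
  have e3 : matNorm (cfP F ω t l * (cfP F ω t p)⁻¹) ≤ Real.exp g := by
    refine (matNorm_transfer_le hpl).trans ?_
    rw [← Real.log_le_iff_le_exp (Finset.prod_pos fun i _ =>
      zero_lt_one.trans_le (one_le_matNorm _))]
    exact (hG.norms l).trans hgl
  have e4 : Real.exp (-g) ≤ σ l := by
    rw [← Real.le_log_iff_exp_le (hσ.pos l)]; linarith [hG.width l]
  change |dotZ _ _| ≤ _
  rw [dotZ_transfer_om ht, abs_mul, abs_div]
  have hk' : |dotZ k (om F ω t p)| ≤ s * l1 k := hk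
  have hy := l1_le_invTranspose (cfP F ω t l * (cfP F ω t p)⁻¹) k
  set y := l1 (invTranspose (cfP F ω t l * (cfP F ω t p)⁻¹) k)
  have hy0 : 0 ≤ y := l1_nonneg _
  have hk0 := l1_nonneg k
  have hm0 : (0 : ℝ) ≤ m := Nat.cast_nonneg m
  have e5 : |lam F ω t l| / |lam F ω t p| ≤ Real.exp (2 * g) := by
    rw [div_le_iff₀ hp]
    calc |lam F ω t l| ≤ Real.exp g := e1
      _ = Real.exp (2 * g) * Real.exp (-g) := by rw [← Real.exp_add]; congr 1; ring
      _ ≤ _ := by gcongr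
  have e6 : s * l1 k ≤ Real.exp (-(4 * g)) * (Real.exp g * y) := by
    calc s * l1 k ≤ (Real.exp (-(4 * g)) / (m + 1)) * l1 k := by
          gcongr
          rw [le_div_iff₀ (by positivity), mul_comm]; exact hs
      _ ≤ (Real.exp (-(4 * g)) / (m + 1)) * ((m + 1) * Real.exp g * y) := by
          gcongr
          exact hy.trans (by gcongr)
      _ = _ := by field_simp
  calc _ ≤ Real.exp (2 * g) * (Real.exp (-(4 * g)) * (Real.exp g * y)) :=
        mul_le_mul e5 (hk'.trans e6) (abs_nonneg _) (Real.exp_pos _).le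
    _ = Real.exp (-g) * y := by
        rw [← mul_assoc, ← mul_assoc, ← Real.exp_add, ← Real.exp_add]; congr 2; ring
    _ ≤ σ l * y := by gcongr

/-- The growth factor `φ_n` in terms of a common bound for the data at `n` and `n - 1`. -/
theorem log_phi_le {δ ν : ℝ} (hδ : 0 < δ) (hν : 0 < ν) :
    ∃ Q : ℝ, 0 ≤ Q ∧ ∀ (t σ : ℕ → ℝ), IsResonanceWidths σ → IsStoppingTimes F ω t →
      ∀ (n : ℕ) (g : ℝ), 0 < cfA F ω t σ n → σ n ≤ 1 → σ (n + 1) ≤ 1 →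
        |eta F ω t (n + 1)| ≤ Real.exp g → matNorm (cfT F ω t (n + 1)) ≤ Real.exp g →
        Real.exp (-g) ≤ σ (n + 1) → l1 (om F ω t (n + 1)) ≤ Real.exp g → 0 ≤ g →
        Real.log (phi F δ ν ω t σ (n + 1)) ≤ Q + 5 * g := by
  have hpi := Real.pi_pos
  have hm0 : (0 : ℝ) ≤ m := Nat.cast_nonneg m
  set c := min (ν / (4 * Real.pi)) (1 / 72) with hc
  have hc0 : 0 < c := lt_min (by positivity) (by norm_num)
  set q := 2 * ((m : ℝ) + 2) * (1 + 2 * Real.pi / δ) * (ν / (4 * Real.pi) / c) with hq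
  have hq0 : 0 < q := by positivity
  refine ⟨Real.log (max 1 q), Real.log_nonneg (le_max_left _ _),
    fun t σ hσ ht n g hA hσ1 hσ2 he hT hw hom hg => ?_⟩
  have hs := hσ.pos n
  have hs' := hσ.pos (n + 1)
  have hw1 := one_le_l1_om (F := F) ht (n + 1)
  set w := l1 (om F ω t (n + 1))
  have hw0 : 0 < w := by linarith
  have h1 : eps F ν ω t σ n ≤ 1 / 42 * (ν / (4 * Real.pi)) := by
    rw [eps, unifRadius]
    refine mul_le_mul (by linarith) (min_le_left _ _) ?_ (by norm_num)
    have := l1_nonneg (om F ω t n)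
    exact le_min (by positivity) (by positivity)
  have h2 : 1 / 42 * c * Real.exp (-(3 * g)) ≤ eps F ν ω t σ (n + 1) := by
    rw [eps, unifRadius]
    have e1 : c * Real.exp (-(2 * g)) ≤ min (ν / (4 * Real.pi)) (σ (n + 1) / (72 * w)) := by
      refine le_min ?_ ?_
      · calc c * Real.exp (-(2 * g)) ≤ (ν / (4 * Real.pi)) * 1 := by
              gcongr
              · exact min_le_left _ _
              · exact Real.exp_le_one_iff.2 (by linarith)
          _ = _ := mul_one _
      · calc c * Real.exp (-(2 * g)) ≤ 1 / 72 * (Real.exp (-g) * Real.exp (-g)) := by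
              rw [← Real.exp_add]
              gcongr
              · exact min_le_right _ _
              · linarith
          _ ≤ 1 / 72 * (σ (n + 1) * (1 / w)) := by
              gcongr
              rw [Real.exp_neg, one_div]
              exact inv_anti₀ hw0 hom
          _ = _ := by field_simp
    calc _ = (Real.exp (-g) / 42) * (c * Real.exp (-(2 * g))) := by
          rw [show -(3 * g) = -g + -(2 * g) by ring, Real.exp_add]; ring
      _ ≤ _ := by gcongr
  have h3 : eps F ν ω t σ n / eps F ν ω t σ (n + 1) ≤
      (ν / (4 * Real.pi) / c) * Real.exp (3 * g) := by
    rw [div_le_iff₀ (lt_of_lt_of_le (by positivity) h2)]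
    calc _ ≤ 1 / 42 * (ν / (4 * Real.pi)) := h1
      _ = (ν / (4 * Real.pi) / c) * Real.exp (3 * g) *
          (1 / 42 * c * Real.exp (-(3 * g))) := by
          rw [Real.exp_neg]; field_simp
      _ ≤ _ := by gcongr
  have h4 : rescaleNorm F δ ω t σ (n + 1) ≤ Real.exp (2 * g) * (1 + 2 * Real.pi / δ) := by
    refine (rescaleNorm_le hδ hA).trans ?_
    have := matNorm_nonneg (cfT F ω t (n + 1))
    rw [show 2 * g = g + g by ring, Real.exp_add]
    gcongr
  have h5 : phi F δ ν ω t σ (n + 1) ≤ max 1 q * Real.exp (5 * g) := by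
    have hexp : 1 ≤ Real.exp (5 * g) := Real.one_le_exp (by linarith)
    refine max_le ?_ ?_
    · exact one_le_mul_of_one_le_of_one_le (le_max_left _ _) hexp
    · rw [Nat.add_sub_cancel]
      have h6 : 0 ≤ eps F ν ω t σ n / eps F ν ω t σ (n + 1) := by
        refine div_nonneg ?_ ((by positivity : (0 : ℝ) ≤ _).trans h2)
        rw [eps, unifRadius]
        have := l1_nonneg (om F ω t n)
        have : 0 ≤ min (ν / (4 * Real.pi)) (σ n / (72 * l1 (om F ω t n))) :=
          le_min (by positivity) (by positivity)
        positivity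
      calc _ ≤ 2 * ((m : ℝ) + 2) * (Real.exp (2 * g) * (1 + 2 * Real.pi / δ)) *
            ((ν / (4 * Real.pi) / c) * Real.exp (3 * g)) := by gcongr
        _ = q * Real.exp (5 * g) := by
            rw [show 5 * g = 2 * g + 3 * g by ring, Real.exp_add, hq]; ring
        _ ≤ _ := by gcongr; exact le_max_right _ _
  have h7 : 0 < phi F δ ν ω t σ (n + 1) := zero_lt_one.trans_le (le_max_left _ _)
  have h8 := Real.log_le_log h7 h5
  rwa [Real.log_mul (by positivity) (Real.exp_pos _).ne', Real.log_exp] at h8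

/-- Along a sparse subsequence of the stopping times, with resonance widths small enough for a
mode in a new cone to stay in all the intermediate old cones, `ℬ_n` converges. -/
theorem exists_scheme (hm : 1 ≤ m) (ht : IsStoppingTimes F ω t)
    (hσ : IsResonanceWidths σ) {β : ℕ → ℝ} {C : ℝ} (hβ : ∀ n, 0 ≤ β n) (hC : 0 ≤ C)
    (hs : Summable fun n => prodA F ω t σ (n + 1) * β n)
    (hG : GrowthBound F ω t σ (fun l => C * (1 + ∑ n ∈ Finset.range l, β n)))
    {δ ν : ℝ} (hδ : 0 < δ) (hν : 0 < ν) :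
    ∃ t' σ' : ℕ → ℝ, IsStoppingTimes F ω t' ∧ IsResonanceWidths σ' ∧
      (∀ n, σ' n < l1 (om F ω t' n)) ∧ ∃ B, Tendsto (calB F δ ν ω t' σ') atTop (𝓝 B) := by
  have hm0 : (0 : ℝ) ≤ m := Nat.cast_nonneg m
  have hA := prodA_pos hm ht hσ
  obtain ⟨j, h0, hj, hhalf, hbig⟩ := exists_halving_indices hA
    fun c hc => exists_prodA_lt hm ht hσ hβ hC hs hG hc
  -- `g n` bounds the data at all the indices below `j (n + 1)`
  obtain ⟨T, hT⟩ : ∃ T : ℕ → ℝ, ∀ n, T n = ∑ i ∈ Finset.range (j (n + 1) - 1), β i :=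
    ⟨_, fun _ => rfl⟩
  have hT0 : ∀ n, 0 ≤ T n := fun n => hT n ▸ Finset.sum_nonneg fun i _ => hβ i
  have hsumT : ∀ n l, l < j (n + 1) → ∑ i ∈ Finset.range l, β i ≤ T n := fun n l hl => by
    rw [hT]
    exact Finset.sum_le_sum_of_subset_of_nonneg (Finset.range_mono (by omega)) fun i _ _ => hβ i
  obtain ⟨g, hg⟩ : ∃ g : ℕ → ℝ, ∀ n, g n = C * (1 + T n) := ⟨_, fun _ => rfl⟩
  have hg0 : ∀ n, 0 ≤ g n := fun n => hg n ▸ mul_nonneg hC (by linarith [hT0 n])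
  have hGg : ∀ n l, l < j (n + 1) → C * (1 + ∑ i ∈ Finset.range l, β i) ≤ g n := fun n l hl => by
    rw [hg]
    exact mul_le_mul_of_nonneg_left (by linarith [hsumT n l hl]) hC
  have hgmono : ∀ n, g n ≤ g (n + 1) := fun n => by
    have h1 := hj (show n + 1 < n + 2 by omega)
    rw [hg n, hT n]
    exact hGg (n + 1) _ (by have : j (n + 1) < j (n + 1 + 1) := h1; omega)
  set M : ℕ → ℝ := fun n => prodA F ω t σ (j n) with hM
  have hM0 : ∀ n, 0 < M n := fun n => hA _
  have hMsum : Summable M := by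
    refine summable_of_sum_range_le (fun n => (hM0 n).le) (c := M 0 / (1 - 1 / 2)) fun N => ?_
    exact sum_range_le_of_ratio (by norm_num) N M hM0 fun n => by
      have := hhalf n; simp only [hM]; linarith
  have hMT : Summable fun n => M n * T n := by
    set μ : ℕ → ℝ := fun i => runMin (prodA F ω t σ) (i + 1) with hμ
    have hμ0 : ∀ i, 0 ≤ μ i := fun i => le_runMin_iff.2 fun i _ => (hA i).le
    have hβμ : Summable fun i => β i * μ i := by
      refine Summable.of_nonneg_of_le (fun i => mul_nonneg (hβ i) (hμ0 i)) (fun i => ?_) hs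
      rw [mul_comm]
      exact mul_le_mul_of_nonneg_right (runMin_le le_rfl) (hβ i)
    -- before index `j (n + 1)` the products `A_0 ⋯ A_{l-1}` exceed `M n / 2`
    obtain ⟨e1, e2⟩ := summable_mul_tsum_ite (M := M) (q := 1 / 2) (K := 2) hβ hμ0 hβμ hM0
      (by norm_num) (fun n => by have := hhalf n; simp only [hM]; linarith) (by norm_num)
    refine Summable.of_nonneg_of_le (fun n => mul_nonneg (hM0 n).le (hT0 n)) (fun n => ?_) e2
    refine mul_le_mul_of_nonneg_left ?_ (hM0 n).le
    rw [hT]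
    refine le_trans (Finset.sum_le_sum fun i hi => ?_)
      ((e1 n).sum_le_tsum (Finset.range (j (n + 1) - 1)) fun i _ => ?_)
    · rw [if_pos]
      have hi' := Finset.mem_range.1 hi
      have h1 : M n / 2 ≤ μ i := le_runMin_iff.2 fun l hl => (hbig n l (by omega)).le
      linarith
    · split_ifs
      exacts [hβ i, le_rfl]
  have hMg : Summable fun n => M n * g n := by
    refine ((hMsum.add hMT).mul_left C).congr fun n => ?_
    rw [hg]; ring
  set t' : ℕ → ℝ := fun n => t (j n) with ht'
  -- `4 g n` is what `transfer_mem_cone` needs, and `n + 1` makes the widths strictly decreasing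
  obtain ⟨σ', hσ'⟩ : ∃ σ' : ℕ → ℝ, ∀ n,
      σ' n = Real.exp (-(4 * g n + (n + 1))) / (m + 1) := ⟨_, fun _ => rfl⟩
  have hσ'0 : ∀ n, 0 < σ' n := fun n => by rw [hσ']; positivity
  have hσ'1 : ∀ n, (m + 1) * σ' n ≤ Real.exp (-(4 * g n)) := fun n => by
    rw [hσ', mul_div_cancel₀ _ (by positivity)]
    refine Real.exp_le_exp.2 ?_
    have : (0 : ℝ) ≤ n := Nat.cast_nonneg n
    linarith
  have hσ'lt : ∀ n, σ' n < 1 := fun n => by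
    have h1 : Real.exp (-(4 * g n + (n + 1))) < 1 := by
      rw [Real.exp_lt_one_iff]
      have : (0 : ℝ) ≤ n := Nat.cast_nonneg n
      linarith [hg0 n]
    rw [hσ', div_lt_one (by positivity)]
    linarith
  have hwid : IsResonanceWidths σ' := ⟨hσ'0, strictAnti_nat_of_succ_lt fun n => by
    rw [hσ', hσ']
    refine div_lt_div_of_pos_right (Real.exp_lt_exp.2 ?_) (by positivity)
    push_cast
    linarith [hgmono n]⟩
  have hcontract : ∀ n, ∀ k ∈ cone (om F ω t' n) (σ' n), k ≠ 0 →
      l1 (invTranspose (cfT F ω t' (n + 1)) k) ≤ M (n + 1) / M n * l1 k := fun n k hk hk0 => by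
    have hjn : j n < j (n + 1) := hj n.lt_succ_self
    rw [om_comp h0 hj] at hk
    have h1 := prodA_mul_l1_transfer_le hm ht hσ hjn.le hk0 fun i hi hil =>
      transfer_mem_cone ht hσ hG hi (hGg n _ hjn) (hGg n i hil) (hσ'1 n) hk
    rw [cfT_comp h0 hj, div_mul_eq_mul_div, le_div_iff₀ (hM0 n), mul_comm]
    exact h1
  have hratio : ∀ n, M (n + 1) / M n ≤ 1 / 2 := fun n => by
    rw [div_le_iff₀ (hM0 n)]
    have := hhalf n
    simp only [hM]; linarith
  have htimes : IsStoppingTimes F ω t' := by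
    refine ⟨by simp only [ht', h0, ht.zero], ht.strictMono.comp hj,
      ht.tendsto.comp hj.tendsto_atTop, fun n h => ?_, fun n => ?_⟩
    -- a mode in the cone is contracted, so the continued fraction matrix has changed
    · have hom : om F ω t' n (Fin.last m) = 1 := by rw [om_comp h0 hj]; exact om_last ht _
      obtain ⟨k, hk, hk0⟩ := cone_diff_zero_nonempty hm hom (hσ'0 n)
      have h1 := hcontract n k hk fun h => hk0 h
      rw [cfT, Nat.add_sub_cancel, h, mul_inv_cancel, invTranspose_one] at h1
      have h2 := one_le_l1 (k := k) fun h => hk0 h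
      have h3 := hratio n
      nlinarith
    · rw [gam_comp h0 hj]; exact ht.gam_ne _
  have hA' := prodA_pos hm htimes hwid
  have hcA := cfA_pos hm htimes hwid
  have hAM : ∀ n, prodA F ω t' σ' n ≤ M n := by
    intro n
    induction n with
    | zero => rw [prodA_zero, hM]; simp only [h0, prodA_zero, le_refl]
    | succ n ih =>
      rw [prodA_succ]
      calc _ ≤ M n * (M (n + 1) / M n) :=
            mul_le_mul ih (cfA_le (div_pos (hM0 _) (hM0 _)).le (hcontract n)) (hcA n).le (hM0 n).le
        _ = _ := by rw [mul_div_cancel₀ _ (hM0 n).ne']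
  obtain ⟨Q, hQ0, hQ⟩ := log_phi_le (F := F) (ω := ω) hδ hν
  have hphi : ∀ n, Real.log (phi F δ ν ω t' σ' (n + 1)) ≤
      Q + 5 * (5 * g (n + 1) + 1 + Real.log (m + 1)) := fun n => by
    have hjn : j n < j (n + 1) := hj n.lt_succ_self
    have hjn' : j (n + 1) < j (n + 2) := hj (n + 1).lt_succ_self
    have hlm : 0 ≤ Real.log (m + 1 : ℝ) := Real.log_nonneg (by linarith)
    have hgn := hg0 (n + 1)
    have hlg : ∀ l, l < j (n + 2) → C * (1 + ∑ i ∈ Finset.range l, β i) ≤ g (n + 1) := hGg (n + 1)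
    refine hQ t' σ' hwid htimes n _ (hcA n) (hσ'lt n).le (hσ'lt _).le ?_ ?_ ?_ ?_ (by linarith)
    · have p1 : 0 < |lam F ω t (j (n + 1))| := abs_pos.2 (lam_ne_zero ht _)
      have p2 : 0 < |lam F ω t (j n)| := abs_pos.2 (lam_ne_zero ht _)
      rw [eta, Nat.add_sub_cancel, lam_comp h0 hj, lam_comp h0 hj, abs_div,
        ← Real.log_le_iff_le_exp (div_pos p1 p2), Real.log_div p1.ne' p2.ne']
      linarith [hG.lam_le (j (n + 1)), hG.neg_lam_le (j n), hlg _ hjn', hlg _ (hjn.trans hjn')]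
    · rw [cfT_comp h0 hj]
      refine (matNorm_transfer_le hjn.le).trans ?_
      rw [← Real.log_le_iff_le_exp (Finset.prod_pos fun i _ =>
        zero_lt_one.trans_le (one_le_matNorm _))]
      linarith [hG.norms (j (n + 1)), hlg _ hjn']
    · have h1 : ((n + 1 : ℕ) : ℝ) ≤ g (n + 1) := by
        refine le_trans ?_ ((hG.index (j (n + 1))).trans (hlg _ hjn'))
        exact_mod_cast hj.id_le (n + 1)
      rw [hσ', ← Real.exp_log (show (0 : ℝ) < m + 1 by positivity), ← Real.exp_sub,
        Real.log_exp]
      refine Real.exp_le_exp.2 ?_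
      linarith
    · have p1 := one_le_l1_om (F := F) ht (j (n + 1))
      rw [om_comp h0 hj, ← Real.log_le_iff_le_exp (by linarith)]
      linarith [hG.om (j (n + 1)), hlg _ hjn']
  have hphi1 : ∀ n, 1 ≤ phi F δ ν ω t' σ' n := fun n => le_max_left _ _
  have hterm : ∀ n, Real.log (Real.exp (δ + ν / cfA F ω t' σ' n) * phi F δ ν ω t' σ' (n + 1)) =
      δ + ν / cfA F ω t' σ' n + Real.log (phi F δ ν ω t' σ' (n + 1)) := fun n => by
    rw [Real.log_mul (Real.exp_pos _).ne' (zero_lt_one.trans_le (hphi1 _)).ne', Real.log_exp]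
  have hsummable : Summable fun i => prodA F ω t' σ' (i + 1) *
      Real.log (Real.exp (δ + ν / cfA F ω t' σ' i) * phi F δ ν ω t' σ' (i + 1)) := by
    have hb : Summable fun n => (δ + (Q + 5 * (1 + Real.log (m + 1)))) * M (n + 1) +
        25 * (M (n + 1) * g (n + 1)) + ν * M n :=
      ((((summable_nat_add_iff 1).2 hMsum).mul_left _).add
        (((summable_nat_add_iff 1).2 hMg).mul_left 25)).add (hMsum.mul_left ν)
    refine Summable.of_nonneg_of_le (fun n => ?_) (fun n => ?_) hb
    · rw [hterm]
      have := hcA n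
      have := hA' (n + 1)
      have := Real.log_nonneg (hphi1 (n + 1))
      positivity
    · rw [hterm]
      have h1 : prodA F ω t' σ' (n + 1) * (ν / cfA F ω t' σ' n) = ν * prodA F ω t' σ' n := by
        have := (hcA n).ne'
        rw [prodA_succ]; field_simp
      have hlog := Real.log_nonneg (hphi1 (n + 1))
      calc _ = prodA F ω t' σ' (n + 1) * (δ + Real.log (phi F δ ν ω t' σ' (n + 1))) +
            prodA F ω t' σ' (n + 1) * (ν / cfA F ω t' σ' n) := by ring
        _ ≤ M (n + 1) * (δ + (Q + 5 * (5 * g (n + 1) + 1 + Real.log (m + 1)))) + ν * M n := by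
            rw [h1]
            refine add_le_add (mul_le_mul (hAM _) (by linarith [hphi n]) (by linarith)
              (hM0 _).le) (mul_le_mul_of_nonneg_left (hAM n) hν.le)
        _ = _ := by ring
  refine ⟨t', σ', htimes, hwid, fun n => (hσ'lt n).trans_le (one_le_l1_om htimes n), _,
    hsummable.hasSum.tendsto_sum_nat⟩

end

section

/-! ### Constant fields -/

variable {m : ℕ}

theorem normA'_eq_zero {S : Set (Fin (m + 1) → ℤ)} {f : (Fin (m + 1) → ℝ) → Fin (m + 1) → ℂ}
    (h : ∀ k ∈ S, coeff f k = 0) (ρ : ℝ) : normA' S ρ f = 0 := by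
  rw [normA', ENNReal.tsum_eq_zero]
  intro k
  rw [h k k.2, l1_zero, mul_zero, zero_mul, ENNReal.ofReal_zero]

theorem normA_eq_zero {S : Set (Fin (m + 1) → ℤ)} {f : (Fin (m + 1) → ℝ) → Fin (m + 1) → ℂ}
    (h : ∀ k ∈ S, coeff f k = 0) (ρ : ℝ) : normA S ρ f = 0 := by
  rw [normA, ENNReal.tsum_eq_zero]
  intro k
  rw [h k k.2, l1_zero, zero_mul, ENNReal.ofReal_zero]

theorem coeff_cx_const (v : Fin (m + 1) → ℝ) {k : Fin (m + 1) → ℤ} (hk : k ≠ 0) :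
    coeff (cx fun _ => v) k = 0 :=
  (coeff_const (fun i => (v i : ℂ)) k).trans (if_neg hk)

theorem coeff_cx_zero (k : Fin (m + 1) → ℤ) :
    coeff (cx fun _ => (0 : Fin (m + 1) → ℝ)) k = 0 := by
  refine (coeff_const (fun i => ((0 : Fin (m + 1) → ℝ) i : ℂ)) k).trans ?_
  split_ifs
  · ext; simp
  · rfl

theorem hasSum_coeff_const (v x : Fin (m + 1) → ℝ) (j : Fin (m + 1)) :
    HasSum (fun k => coeff (cx fun _ => v) k j *
      Complex.exp ((2 * Real.pi * dotZ k x : ℝ) * Complex.I)) ((cx fun _ => v) x j) := by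
  have h := hasSum_single (f := fun k => coeff (cx fun _ => v) k j * mode k x) 0 fun k hk => by
    rw [coeff_cx_const v hk, Pi.zero_apply, zero_mul]
  simp only [mode_zero, mul_one] at h
  rw [show coeff (cx fun _ => v) 0 = fun i => (v i : ℂ) from
    (coeff_const (fun i => (v i : ℂ)) 0).trans (if_pos rfl)] at h
  exact h

theorem memA'_const (ρ : ℝ) (v : Fin (m + 1) → ℝ) : MemA' ρ (cx fun _ => v) := by
  refine ⟨hasSum_coeff_const v, ?_⟩
  rw [normA', tsum_eq_single ⟨0, Set.mem_univ 0⟩ fun k hk => ?_]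
  · exact ENNReal.ofReal_lt_top
  · rw [coeff_cx_const v fun h => hk (Subtype.ext h), l1_zero, mul_zero, zero_mul,
      ENNReal.ofReal_zero]

theorem memA_const (ρ : ℝ) (v : Fin (m + 1) → ℝ) : MemA ρ (cx fun _ => v) := by
  refine ⟨hasSum_coeff_const v, ?_⟩
  rw [normA, tsum_eq_single ⟨0, Set.mem_univ 0⟩ fun k hk => ?_]
  · exact ENNReal.ofReal_lt_top
  · rw [coeff_cx_const v fun h => hk (Subtype.ext h), l1_zero, zero_mul, ENNReal.ofReal_zero]

theorem hasRot_const (ω : Fin (m + 1) → ℝ) : HasRot (fun _ => ω) ω := by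
  refine ⟨fun t x => x + t • ω, fun x => by simp, fun x t => ?_, fun x => ?_⟩
  · simpa using ((hasDerivAt_id t).smul_const ω).const_add x
  · refine tendsto_const_nhds.congr' ?_
    filter_upwards [eventually_ne_atTop 0] with t ht
    rw [add_sub_cancel_left, smul_smul, inv_mul_cancel₀ ht, one_smul]

theorem pullback_id (X : (Fin (m + 1) → ℝ) → Fin (m + 1) → ℝ) : pullback id X = X := by
  funext x
  rw [pullback, fderiv_id, ContinuousLinearMap.inverse_id]
  rfl

theorem isAnalyticTorusDiffeo_id : IsAnalyticTorusDiffeo (m := m) id := by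
  refine ⟨fun x _ => analyticAt_id, ⟨1, fun x k => ?_⟩, id, fun x _ => analyticAt_id,
    fun x => rfl, fun x => rfl⟩
  simp

theorem unifRadius_pos {ν s : ℝ} (hν : 0 < ν) (hs : 0 < s) {v : Fin (m + 1) → ℝ}
    (hv : 0 < l1 v) : 0 < unifRadius ν s v := by
  have := Real.pi_pos
  unfold unifRadius
  positivity

theorem zero_mem_cone (v : Fin (m + 1) → ℝ) (s : ℝ) : 0 ∈ cone v s := by
  simp [cone, dotZ_zero_left, l1_zero]

/-- A constant field is in normal form already. -/
theorem isUniformization_const {v : Fin (m + 1) → ℝ} {s ρ ν : ℝ} (hv : 0 < l1 v) (hs : 0 < s)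
    (hρ : 0 < ρ) (hν : 0 < ν) : IsUniformization v s ρ ν (fun _ => v) id := by
  have h0 : ∀ k, coeff (cx fun _ => (0 : Fin (m + 1) → ℝ)) k = 0 := coeff_cx_zero
  refine ⟨hρ, memA'_const _ v, ?_, isAnalyticTorusDiffeo_id, ?_, ?_, fun k hk => ?_, ?_, ?_⟩
  · simp only [sub_self]
    rw [normA'_eq_zero fun k _ => h0 k]
    exact ENNReal.ofReal_pos.2 (unifRadius_pos hν hs hv)
  · simpa only [id, sub_self] using memA'_const ρ (0 : Fin (m + 1) → ℝ)
  · simpa only [pullback_id] using memA_const ρ v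
  · rw [pullback_id]
    exact coeff_cx_const v fun h => hk (h ▸ zero_mem_cone v s)
  · simp only [id, sub_self]
    rw [normA'_eq_zero fun k _ => h0 k]
    exact zero_le
  · simp only [pullback_id, sub_self]
    rw [normA_eq_zero fun k _ => h0 k]
    exact zero_le

theorem rescale_const (e : ℝ) (T : SL(m + 1, ℤ)) (v : Fin (m + 1) → ℝ) :
    rescale e T (fun _ => v) = fun _ => e • act T v := rfl

section Widths

variable {F : Set SL(m + 1, ℝ)} {ω : Fin (m + 1) → ℝ} {t σ : ℕ → ℝ} {δ ν B : ℝ}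

theorem calB_add_le (hm : 1 ≤ m) (ht : IsStoppingTimes F ω t) (hσ : IsResonanceWidths σ)
    (hδ : 0 ≤ δ) (n : ℕ) :
    calB F δ ν ω t σ n + ν * prodA F ω t σ n ≤ calB F δ ν ω t σ (n + 1) := by
  have hA := cfA_pos hm ht hσ n
  have hP := prodA_pos hm ht hσ n
  have hφ : 1 ≤ phi F δ ν ω t σ (n + 1) := le_max_left _ _
  have hlog := Real.log_nonneg hφ
  rw [calB, calB, Finset.sum_range_succ, Real.log_mul (Real.exp_pos _).ne'
    (zero_lt_one.trans_le hφ).ne', Real.log_exp, prodA_succ]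
  have h1 : ν * prodA F ω t σ n =
      prodA F ω t σ n * cfA F ω t σ n * (ν / cfA F ω t σ n) := by field_simp
  rw [h1]
  gcongr
  linarith

/-- All the strip widths exceed `ν`: the sum `ℬ` contains the term `ν A_0 ⋯ A_{n-1}`. -/
theorem lt_width (hm : 1 ≤ m) (ht : IsStoppingTimes F ω t) (hσ : IsResonanceWidths σ)
    (hδ : 0 ≤ δ) (hν : 0 ≤ ν) (hB : Tendsto (calB F δ ν ω t σ) atTop (𝓝 B)) {ρ : ℝ} (hρ : B < ρ)
    (n : ℕ) : ν < width F δ ν ω t σ ρ n := by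
  have hstep := calB_add_le (ν := ν) hm ht hσ hδ
  have hmono : Monotone (calB F δ ν ω t σ) := monotone_nat_of_le_succ fun n =>
    (le_add_of_nonneg_right (mul_nonneg hν (prodA_pos hm ht hσ n).le)).trans (hstep n)
  rw [width, lt_div_iff₀ (prodA_pos hm ht hσ n)]
  linarith [hstep n, hmono.ge_of_tendsto hB (n + 1)]

theorem infinitelyRenormalizable_const (hm : 1 ≤ m) (hω : ω (Fin.last m) = 1)
    (ht : IsStoppingTimes F ω t) (hσ : IsResonanceWidths σ) (hδ : 0 ≤ δ) (hν : 0 < ν)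
    (hB : Tendsto (calB F δ ν ω t σ) atTop (𝓝 B)) {ρ : ℝ} (hρ : B < ρ) :
    InfinitelyRenormalizable F δ ν ω t σ ρ (fun _ => ω) := by
  refine ⟨fun n _ => om F ω t n, fun _ => id, by simp only [om_zero hω ht], fun n => ⟨?_, ?_⟩⟩
  · exact isUniformization_const (zero_lt_one.trans_le (one_le_l1_om ht n)) (hσ.pos n)
      (sub_pos.2 (lt_width hm ht hσ hδ hν.le hB hρ n)) hν
  · simp only [pullback_id, rescale_const, om_succ ht n]

theorem convergenceHypotheses_const (hm : 1 ≤ m) (ht : IsStoppingTimes F ω t)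
    (hσ : IsResonanceWidths σ) (hlt : ∀ n, σ n < l1 (om F ω t n)) (hδ : 0 ≤ δ) (hν : 0 < ν)
    (hB : Tendsto (calB F δ ν ω t σ) atTop (𝓝 B)) {ρ : ℝ}
    (hρ : B < ρ) : ConvergenceHypotheses F δ ν ω t σ ρ (fun _ => ω) := by
  refine ⟨hσ, ht, hlt, ?_, memA'_const ρ ω, hasRot_const ω, ?_, B, hB, hρ⟩
  · have h := lt_width hm ht hσ hδ hν.le hB hρ 0
    rw [width, prodA_zero, div_one, calB, Finset.range_zero, Finset.sum_empty, sub_zero] at h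
    linarith
  · rw [normA'_eq_zero (S := {0}ᶜ) fun k hk => coeff_cx_const ω hk]
    have h1 : 0 < eps F ν ω t σ 0 :=
      unifRadius_pos hν (hσ.pos 0) (zero_lt_one.trans_le (one_le_l1_om ht 0))
    exact ENNReal.ofReal_pos.2 (by positivity)

end Widths

/-! ### Conjugacies as diffeomorphisms of the torus -/

/-- A real field in `𝒜_r` is the sum of a constant and a field controlled by the norm of `(𝕀 - 𝔼)
X`. -/
theorem exists_eq_const_add {r ε : ℝ} {X : (Fin (m + 1) → ℝ) → Fin (m + 1) → ℝ} (hr : 0 ≤ r)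
    (hX : MemA r (cx X)) (hε : normA {0}ᶜ r (cx X) < ENNReal.ofReal ε) :
    ∃ (a : Fin (m + 1) → ℝ) (g : (Fin (m + 1) → ℝ) → Fin (m + 1) → ℝ),
      (∀ j, WienerLE r ε (fun x => (g x j : ℂ))) ∧ X = fun x => a + g x := by
  obtain ⟨c, hc⟩ : ∃ c, c = coeff (cx X) := ⟨_, rfl⟩
  have hXsum : ∀ x j, HasSum (fun k => c k j * mode k x) (X x j : ℂ) := hc ▸ hX.hasSum
  have hε0 : 0 < ε := by
    by_contra h
    rw [ENNReal.ofReal_of_nonpos (not_lt.1 h)] at hε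
    exact not_lt_zero hε
  obtain ⟨u, hu⟩ : ∃ u : ({0}ᶜ : Set (Fin (m + 1) → ℤ)) → ℝ,
      u = fun k : ({0}ᶜ : Set (Fin (m + 1) → ℤ)) =>
        l1 (c k) * Real.exp (r * l1 (k : Fin (m + 1) → ℤ)) := ⟨_, rfl⟩
  have hnn : ∀ k, 0 ≤ u k := fun k => by
    rw [hu]
    exact mul_nonneg (l1_nonneg _) (Real.exp_pos _).le
  have hε' : ∑' k, ENNReal.ofReal (u k) < ENNReal.ofReal ε := by
    rw [hu, hc]
    exact hε
  have hs : Summable u :=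
    (ENNReal.summable_toReal (hε'.trans ENNReal.ofReal_lt_top).ne).congr fun k =>
      ENNReal.toReal_ofReal (hnn k)
  have hle : ∑' k, u k ≤ ε := by
    rw [← ENNReal.ofReal_tsum_of_nonneg hnn hs] at hε'
    exact ((ENNReal.ofReal_lt_ofReal_iff hε0).1 hε').le
  have hsum : ∀ x j, HasSum (fun k : ({0}ᶜ : Set (Fin (m + 1) → ℤ)) => c k j * mode k x)
      ((X x j : ℂ) - c 0 j) := fun x j => by
    have h := hasSum_unique fun k : ({0} : Set (Fin (m + 1) → ℤ)) => c k j * mode k x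
    have h0 : ((default : ({0} : Set (Fin (m + 1) → ℤ))) : Fin (m + 1) → ℤ) = 0 := rfl
    rw [h0, mode_zero, mul_one] at h
    exact (HasSum.hasSum_iff_compl (f := fun k => c k j * mode k x) h).1 (hXsum x j)
  have hw : ∀ j, WienerLE r ε (fun x => (X x j : ℂ) - c 0 j) := fun j => by
    have hb : ∀ k : ({0}ᶜ : Set (Fin (m + 1) → ℤ)),
        ‖c k j‖ * Real.exp (r * l1 (k : Fin (m + 1) → ℤ)) ≤ u k := fun k => by
      rw [hu]
      exact mul_le_mul_of_nonneg_right (norm_le_l1 _ j) (Real.exp_pos _).le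
    have hs' := Summable.of_nonneg_of_le (fun k => by positivity) hb hs
    exact ⟨({0}ᶜ : Set (Fin (m + 1) → ℤ)), fun k => c k j, fun k => k, _,
      (hs'.tsum_le_tsum hb hs).trans hle, hs'.hasSum,
      fun x => hsum x j⟩
  refine ⟨fun j => (c 0 j).re, fun x j => X x j - (c 0 j).re, fun j => ?_, ?_⟩
  · exact ((hw j).re hr).congr fun x => by simp
  · funext x j
    simp

/-- A small displacement has derivative at most `1/2`, so that `id + H` is a homeomorphism; its
inverse is analytic by the inverse function theorem. -/
theorem isAnalyticTorusDiffeo_id_add {ρ C : ℝ} (hρ : 0 < ρ) (hC : 2 * Real.pi / ρ * C ≤ 1 / 2)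
    {H : (Fin (m + 1) → ℝ) → Fin (m + 1) → ℝ} (hH : ∀ j, WienerLE ρ C (fun x => (H x j : ℂ))) :
    IsAnalyticTorusDiffeo (fun x => x + H x) := by
  obtain ⟨H', hd, hb⟩ := exists_hasFDerivAt_pi hρ hH
  replace hb : ∀ x, ‖H' x‖ ≤ 1 / 2 := fun x => (hb x).trans hC
  obtain ⟨e, he⟩ := exists_homeomorph_id_add hd hb
  have hHa : AnalyticOnNhd ℝ H Set.univ := analyticOnNhd_pi_iff.2 fun j x hx =>
    (Complex.reCLM.analyticAt _).comp ((hH j).analyticOnNhd hρ x hx)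
  have ha : AnalyticOnNhd ℝ (fun x => x + H x) Set.univ := fun x hx =>
    analyticAt_id.add (hHa x hx)
  have hef : (e : (Fin (m + 1) → ℝ) → Fin (m + 1) → ℝ) = fun x => x + H x := funext he
  refine ⟨ha, ⟨1, fun x k => ?_⟩, e.symm, fun y _ => ?_, fun x => ?_, fun y => ?_⟩
  · have h1 : H (x + fun i => (k i : ℝ)) = H x := funext fun j => by
      exact_mod_cast (hH j).periodic x k
    simp only [h1]
    funext i
    simp [add_right_comm]
  · obtain ⟨i, hi⟩ := exists_equiv_id_add (H' (e.symm y)) (hb _)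
    refine e.toOpenPartialHomeomorph.analyticAt_symm (i := i) (by simp) ?_ ?_
    · change AnalyticAt ℝ e (e.symm y)
      rw [hef]
      exact ha _ (Set.mem_univ _)
    · change fderiv ℝ e (e.symm y) = i
      rw [hef, hi]
      exact ((hasFDerivAt_id _).add (hd _)).fderiv
  · simp only [← he, e.symm_apply_apply]
  · simp only [← he, e.apply_symm_apply]

theorem pullback_id_add {H X : (Fin (m + 1) → ℝ) → Fin (m + 1) → ℝ}
    {H' : (Fin (m + 1) → ℝ) → (Fin (m + 1) → ℝ) →L[ℝ] (Fin (m + 1) → ℝ)}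
    (hd : ∀ x, HasFDerivAt H (H' x) x) (hb : ∀ x, ‖H' x‖ ≤ 1 / 2) {ω : Fin (m + 1) → ℝ}
    (h : ∀ x, X (x + H x) = ω + H' x ω) : pullback (fun x => x + H x) X = fun _ => ω := by
  funext x
  obtain ⟨i, hi⟩ := exists_equiv_id_add (H' x) (hb x)
  have h1 : fderiv ℝ (fun x => x + H x) x = i := by
    rw [hi]
    exact ((hasFDerivAt_id _).add (hd _)).fderiv
  have h2 : X (x + H x) = i ω := by
    have h3 := congrArg (fun L => L ω) hi
    rw [h x]
    exact h3.symm
  rw [pullback, h1, ContinuousLinearMap.inverse_equiv, h2]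
  exact i.symm_apply_apply ω

/-- A close to constant field with a Brjuno rotation vector `ω` is analytically conjugate to the
constant field `ω`. -/
theorem IsBrjuno.exists_pullback_eq_const {ω : Fin (m + 1) → ℝ} (hω : IsBrjuno ω) {r : ℝ}
    (hr : 0 < r) : ∃ ε : ℝ, 0 < ε ∧ ∀ X : (Fin (m + 1) → ℝ) → Fin (m + 1) → ℝ,
      MemA r (cx X) → HasRot X ω → normA {0}ᶜ r (cx X) < ENNReal.ofReal ε →
      ∃ ψ, IsAnalyticTorusDiffeo ψ ∧ pullback ψ X = fun _ => ω := by
  have hpi := Real.pi_pos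
  -- with this `η` the derivative of the conjugacy differs from the identity by at most `1/2`
  have hC : 2 * Real.pi / (r / 2) * (r / (8 * Real.pi)) ≤ 1 / 2 := le_of_eq (by field_simp; ring)
  obtain ⟨ε, hε, h⟩ := hω.exists_conjugacy hr (η := r / (8 * Real.pi)) (by positivity)
  refine ⟨ε, hε, fun X hX hrot hs => ?_⟩
  obtain ⟨a, g, hg, rfl⟩ := exists_eq_const_add hr.le hX hs
  obtain ⟨H, H', hH, hd, hconj⟩ := h (a - ω) g hg (by simpa only [add_sub_cancel] using hrot)
  obtain ⟨H'', hd'', hb''⟩ := exists_hasFDerivAt_pi (half_pos hr) hH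
  have hb : ∀ x, ‖H' x‖ ≤ 1 / 2 := fun x => by
    rw [(hd x).unique (hd'' x)]
    exact (hb'' x).trans hC
  exact ⟨_, isAnalyticTorusDiffeo_id_add (half_pos hr) hC hH,
    pullback_id_add hd hb fun x => by rw [← hconj x, add_sub_cancel]⟩

end

end TorusRenorm

theorem mainTheorem6 (m : ℕ) (hm : 1 ≤ m) (F : Set SL(m + 1, ℝ)) (hF : IsFundDomain F)
    (δ ν : ℝ) (hδ : 0 < δ) (hν : 0 < ν)
    (ω : Fin (m + 1) → ℝ) (hω : ω ∈ classY F) (r : ℝ) (hr : 0 < r) :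
    ∃ ε : ℝ, 0 < ε ∧ ∃ (ρ : ℝ) (t σ : ℕ → ℝ),
      ∀ X : (Fin (m + 1) → ℝ) → (Fin (m + 1) → ℝ),
        MemA r (cx X) → HasRot X ω → normA {0}ᶜ r (cx X) < ENNReal.ofReal ε →
        ∃ ψ : (Fin (m + 1) → ℝ) → (Fin (m + 1) → ℝ),
          IsAnalyticTorusDiffeo ψ ∧
          ConvergenceHypotheses F δ ν ω t σ ρ (pullback ψ X) ∧
          InfinitelyRenormalizable F δ ν ω t σ ρ (pullback ψ X) := by
  obtain ⟨hlast, σ₀, t₀, hσ₀, ht₀, hs, hlim⟩ := hω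
  obtain ⟨C, hC, hG⟩ := exists_growthBound hlast hσ₀ ht₀ hlim
  have hs' : Summable fun n => prodA F ω t₀ σ₀ (n + 1) *
      |Real.log (|eta F ω t₀ (n + 1)| * matNorm (cfT F ω t₀ (n + 1)) *
        (σ₀ n * l1 (om F ω t₀ (n + 1)) / σ₀ (n + 1)))| := hs.abs.congr fun n => by
    rw [abs_mul, abs_of_pos (prodA_pos hm ht₀ hσ₀ (n + 1))]
  have hBr := isBrjuno_of_growthBound hm hlast ht₀ hσ₀ (fun n => abs_nonneg _) hC hs' hG
  obtain ⟨t, σ, ht, hσ, hlt, B, hB⟩ :=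
    exists_scheme hm ht₀ hσ₀ (fun n => abs_nonneg _) hC hs' hG hδ hν
  obtain ⟨ε, hε, hconj⟩ := hBr.exists_pullback_eq_const hr
  -- any strip width above `B` will do, because the conjugated field is constant
  refine ⟨ε, hε, B + 1, t, σ, fun X hX hrot hsmall => ?_⟩
  obtain ⟨ψ, hψ, hpull⟩ := hconj X hX hrot hsmall
  refine ⟨ψ, hψ, ?_, ?_⟩ <;> rw [hpull]
  · exact convergenceHypotheses_const hm ht hσ hlt hδ.le hν hB (lt_add_one B)
  · exact infinitelyRenormalizable_const hm hlast ht hσ hδ.le hν hB (lt_add_one B)
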